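/- **Setting.** Let $d\in\{1,2,3\}$ and let $\Omega\subset\mathbb R^d$ be open and bounded. Write $\|\cdot\|_0$ for the $L^2(\Omega)$-norm and $|v|_1=\|\nabla v\|_0$; a further subscript $S$ means that the integral is taken over $\Omega\cap S$. Let $\lambda,\Lambda_0,\Lambda_1>0$. The coefficient $\alpha:\Omega\times\mathbb R\to\mathbb R^{d\times d}$ is measurable in $x$ and satisfies, for all $x\in\Omega$, $s,s_1,s_2\in\mathbb R$, $\psi\in\mathbb R^d$, $$|\alpha(x,s_1)-\alpha(x,s_2)|\le\Lambda_0|s_1-s_2|,\qquad \alpha(x,s)\psi\cdot\psi\ge\lambda\|\psi\|^2,\qquad \|\alpha(x,s)\psi\|\le\Lambda_1\|\psi\| .$$ Let $f\in L^2(\Omega)$, and let $u\in H^1_0(\Omega)$ satisfy $\int_\Omega\alpha(x,u)\nabla u\cdot\nabla v\,dx=\int_\Omega fv\,dx$ for all $v\in H_0^1(\Omega)$. **Mesh and interpolation.** Let $\mathcal T_H$ be a finite partition of $\overline\Omega$ into closed non-overlapping elements, each a simplex or a quadrilateral (the image of $[0,1]^d$ under a multilinear map). Let $H_K=\operatorname{diam}K$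 and $H=\max_KH_K$. The mesh is shape-regular and quasi-uniform with constant $\gamma$: $H_K>0$, the standard parametrization $F_K$ of $K$ over the unit simplex or cube satisfies $\gamma^{-1}H_K|s-t|\le|F_K(s)-F_K(t)|\le\gamma H_K|s-t|$, and $H\le\gamma H_K$. Let $V_H\subset H^1_0(\Omega)$ be the functions that on every $K$ are affine (simplex) or of partial degree at most one in each reference variable (quadrilateral). Set $N^0(T)=T$, let $N^{k}(T)$ be the union of the elements that meet $N^{k-1}(T)$, let $N(K)=N^1(K)$, and let $C_{\mathrm{ol}}=\max_T\#\{K\in\mathcal T_H:K\subseteq N^k(T)\}$. Let $I_H:H^1_0(\Omega)\to V_H$ be a linear projection onto $V_H$ with $$|I_Hv|_{1,K}\le\kappa|v|_{1,N(K)},\qquad\|v-I_Hv\|_{0,K}\le\kappa H|v|_{1,N(K)}\qquad(K\in\mathcal T_H,\ v\in H^1_0(\Omega)),$$ and put $W=\ker I_H$ and $W(S)=\{w\in W:\operatorname{supp}w\subseteq S\}$ for closed $S$. **Linearization and multiscale space.** Fix $p^*\in H_0^1(\Omega)$. Let $\mathbf A_L(x,p^*,\nabla v)=\alpha(x,p^*)\nabla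 v+v\,\beta(x,p^*)$ with $\beta=0$ (Kačanov) or $\beta=\alpha_s(x,p^*)\nabla p^*$ (Fréchet), where $\alpha_s=\partial\alpha/\partial s$. For $k\ge0$ and $T\in\mathcal T_H$ let $Q_{T,k}:V_H\to W(N^k(T))$ satisfy $$\int_{\Omega\cap N^k(T)}\mathbf A_L(x,p^*,\nabla Q_{T,k}v_H)\cdot\nabla w\,dx=\int_{\Omega\cap T}\mathbf A_L(x,p^*,\nabla v_H)\cdot\nabla w\,dx\qquad\forall\,w\in W(N^k(T)),\ v_H\in V_H .$$ Let $Q^k=\sum_TQ_{T,k}$ and $V_{H,k}=(\mathrm{id}-Q^k)V_H$, and let $u_{H,k}\in V_{H,k}$ be any function with $\int_\Omega\alpha(x,u_{H,k})\nabla u_{H,k}\cdot\nabla v\,dx=\int_\Omega fv\,dx$ for all $v\in V_{H,k}$. Let $$\eta(u)=\sup_{w\in H^1_0(\Omega),\,|w|_1=1}\Bigl|\int_\Omega[\alpha(x,u)\nabla u-\mathbf A_L(x,p^*,\nabla u)]\cdot\nabla w\,dx\Bigr|,$$ and, with $v_{H,k}=(\mathrm{id}-Q^k)I_Hu$, $$G(u,u_{H,k},p^*)=\|(\alpha(x,p^*)-\alpha(x,u))\nabla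 v_{H,k}+(\alpha(x,u_{H,k})-\alpha(x,p^*))\nabla u_{H,k}\|_0 .$$ **Theorem.** (a) *Kačanov.* There are $C>0$ and $\nu\in(0,1)$, depending only on $\Omega,d,\lambda,\Lambda_0,\Lambda_1,\gamma,\kappa$, such that always $$|u-u_{H,k}|_1\le C\Bigl(\bigl(H+C_{\mathrm{ol}}^{1/2}\nu^k\bigr)\|f\|_0+\eta(u)+G(u,u_{H,k},p^*)\Bigr).\tag{$*$}$$ (b) *Fréchet.* Let $C_{p^*}\ge0$ and $\theta\in(0,1)$. There are $C>0$ and $\nu\in(0,1)$, depending only on $\Omega,d,\lambda,\Lambda_0,\Lambda_1,\gamma,\kappa,C_{p^*},\theta$, such that $(*)$ holds whenever $\alpha(x,\cdot)$ is twice differentiable for all $x\in\Omega$, $\|\alpha_s(\cdot,p^*)\nabla p^*\|_{L^\infty(\Omega)}\le C_{p^*}$, and $$C_I\,C_{p^*}H\le\theta\lambda$$ for some constant $C_I$ with $\|v-I_Hv\|_0\le C_IH|v|_1$ for all $v\in H^1_0(\Omega)$. -/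

import Mathlib

open MeasureTheory
open scoped ContDiff

noncomputable section

namespace LOD

/-- Points of `ℝ^d` with the Euclidean norm. -/
abbrev Pt (d : ℕ) : Type := EuclideanSpace ℝ (Fin d)

/-- The space `L²(Ω)`. -/
abbrev L2 {d : ℕ} (Ω : Set (Pt d)) : Type := Lp ℝ 2 (volume.restrict Ω)

/-- The space `L²(Ω; ℝ^d)`. -/
abbrev L2vec {d : ℕ} (Ω : Set (Pt d)) : Type := Lp (Pt d) 2 (volume.restrict Ω)

/-- The pairs `(φ, ∇φ)`, `φ` a smooth function with compact support in `Ω`. -/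
def testPairs {d : ℕ} (Ω : Set (Pt d)) : Set (WithLp 2 (L2 Ω × L2vec Ω)) :=
  {z | ∃ φ : Pt d → ℝ, ContDiff ℝ ∞ φ ∧ HasCompactSupport φ ∧ tsupport φ ⊆ Ω ∧
    (∀ᵐ x ∂(volume.restrict Ω), z.fst x = φ x) ∧
    (∀ᵐ x ∂(volume.restrict Ω), z.snd x = gradient φ x)}

/-- `H¹₀(Ω)`, the closure of the smooth compactly supported functions in the `H¹`-norm. A function
`v` is recorded together with its weak gradient, as the pair `(v, ∇v)` in `L² × L²`; the gradient is
determined by `v`. The norm inherited from the product is the `H¹`-norm. -/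
def H10 {d : ℕ} (Ω : Set (Pt d)) : Submodule ℝ (WithLp 2 (L2 Ω × L2vec Ω)) :=
  (Submodule.span ℝ (testPairs Ω)).topologicalClosure

/-- The function underlying an element of `H¹₀(Ω)`. -/
def val {d : ℕ} {Ω : Set (Pt d)} (v : H10 Ω) : L2 Ω := v.1.fst

/-- The weak gradient of an element of `H¹₀(Ω)`. -/
def grad {d : ℕ} {Ω : Set (Pt d)} (v : H10 Ω) : L2vec Ω := v.1.snd

/-- The seminorm `|v|₁ = ‖∇v‖₀` over `Ω`. -/
def semi {d : ℕ} {Ω : Set (Pt d)} (v : H10 Ω) : ℝ := ‖grad v‖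

/-- The norm `‖v‖₀` over `Ω ∩ S`. -/
def normOn {d : ℕ} {Ω : Set (Pt d)} (v : H10 Ω) (S : Set (Pt d)) : ℝ :=
  Real.sqrt (∫ x in S, (val v x) ^ 2 ∂(volume.restrict Ω))

/-- The seminorm `|v|₁` over `Ω ∩ S`. -/
def semiOn {d : ℕ} {Ω : Set (Pt d)} (v : H10 Ω) (S : Set (Pt d)) : ℝ :=
  Real.sqrt (∫ x in S, ‖grad v x‖ ^ 2 ∂(volume.restrict Ω))

/-! ### The coefficient and the weak problem -/

/-- A matrix-valued coefficient `α(x, s)`; matrices are linear maps of `ℝ^d`. -/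
abbrev Coeff (d : ℕ) : Type := Pt d → ℝ → (Pt d →L[ℝ] Pt d)

/-- The standing assumptions: measurability in `x`, uniform Lipschitz continuity in `s`, uniform
ellipticity and boundedness. -/
structure CoeffAssumption {d : ℕ} (Ω : Set (Pt d)) (lam Lam0 Lam1 : ℝ) (α : Coeff d) : Prop where
  measurable : ∀ s : ℝ, AEStronglyMeasurable (fun x => α x s) (volume.restrict Ω)
  lipschitz : ∀ x ∈ Ω, ∀ s₁ s₂ : ℝ, ‖α x s₁ - α x s₂‖ ≤ Lam0 * |s₁ - s₂|
  elliptic : ∀ x ∈ Ω, ∀ s : ℝ, ∀ ψ : Pt d, lam * ‖ψ‖ ^ 2 ≤ inner ℝ (α x s ψ) ψ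
  bounded : ∀ x ∈ Ω, ∀ s : ℝ, ∀ ψ : Pt d, ‖α x s ψ‖ ≤ Lam1 * ‖ψ‖

/-- `α` is twice differentiable in its second argument. -/
def TwiceDifferentiable {d : ℕ} (Ω : Set (Pt d)) (α : Coeff d) : Prop :=
  ∀ x ∈ Ω, Differentiable ℝ (α x) ∧ Differentiable ℝ (deriv (α x))

/-- The form `𝒜(q; v, w) = (α(x, q)∇v, ∇w)`. -/
def form {d : ℕ} {Ω : Set (Pt d)} (α : Coeff d) (q v w : H10 Ω) : ℝ :=
  ∫ x in Ω, inner ℝ (α x (val q x) (grad v x)) (grad w x)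

/-- The functional `F(v) = (f, v)`. -/
def load {d : ℕ} {Ω : Set (Pt d)} (f : L2 Ω) (v : H10 Ω) : ℝ :=
  ∫ x in Ω, f x * val v x

/-- `u ∈ H¹₀(Ω)` solves `𝒜(u; u, v) = (f, v)` for all `v ∈ H¹₀(Ω)`. -/
def IsWeakSolution {d : ℕ} {Ω : Set (Pt d)} (α : Coeff d) (f : L2 Ω) (u : H10 Ω) : Prop :=
  ∀ v : H10 Ω, form α u u v = load f v

/-! ### Linearizations -/

/-- The two linearization techniques. -/
inductive Linearization
  | kacanov
  | frechet

/-- The drift coefficient `β(x, p)`: zero for the Kačanov linearization, and `α_s(x, p)∇p` for the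
Fréchet linearization. -/
def drift {d : ℕ} {Ω : Set (Pt d)} (l : Linearization) (α : Coeff d) (p : H10 Ω) (x : Pt d) :
    Pt d :=
  match l with
  | .kacanov => 0
  | .frechet => deriv (α x) (val p x) (grad p x)

/-- The linearized flux `A_L(x, p, ∇v) = α(x, p)∇v + v β(x, p)`. -/
def linFlux {d : ℕ} {Ω : Set (Pt d)} (l : Linearization) (α : Coeff d) (p v : H10 Ω) (x : Pt d) :
    Pt d :=
  α x (val p x) (grad v x) + val v x • drift l α p x

/-- The linearized form restricted to `S`, i.e. `(A_L(x, p, ∇v), ∇w)` over `Ω ∩ S`. -/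
def linForm {d : ℕ} {Ω : Set (Pt d)} (l : Linearization) (α : Coeff d) (p : H10 Ω)
    (S : Set (Pt d)) (v w : H10 Ω) : ℝ :=
  ∫ x in S, inner ℝ (linFlux l α p v x) (grad w x) ∂(volume.restrict Ω)

/-- The linearization error `η(v)` at the linearization point `p`. -/
def linError {d : ℕ} {Ω : Set (Pt d)} (l : Linearization) (α : Coeff d) (p v : H10 Ω) : ℝ :=
  sSup {r : ℝ | ∃ w : H10 Ω, semi w = 1 ∧
    r = |∫ x in Ω, inner ℝ (α x (val v x) (grad v x) - linFlux l α p v x) (grad w x)|}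

/-- The coefficient mismatch
`‖(α(x,p) - α(x,u))∇z + (α(x,y) - α(x,p))∇y‖₀`. -/
def mismatch {d : ℕ} {Ω : Set (Pt d)} (α : Coeff d) (p u y z : H10 Ω) : ℝ :=
  Real.sqrt (∫ x in Ω, ‖(α x (val p x) - α x (val u x)) (grad z x)
    + (α x (val y x) - α x (val p x)) (grad y x)‖ ^ 2)

/-! ### Meshes and finite elements -/

/-- An element, given by its vertices: a simplex, or a quadrilateral (a hexahedron if `d = 3`). -/
inductive Cell (d : ℕ) : Type
  | simplex (P : Fin (d + 1) → Pt d)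
  | quad (P : (Fin d → Bool) → Pt d)

/-- The affine function on `ℝ^d` with value `c 0` at the origin and `c i` at the `i`-th unit
vector. -/
def affineInterp {d : ℕ} {M : Type} [AddCommGroup M] [Module ℝ M] (c : Fin (d + 1) → M)
    (t : Pt d) : M :=
  (1 - ∑ i, t i) • c 0 + ∑ i : Fin d, t i • c i.succ

/-- The function of partial degree at most one in each variable with value `c b` at the vertex `b`
of the unit cube. -/
def cubeInterp {d : ℕ} {M : Type} [AddCommGroup M] [Module ℝ M] (c : (Fin d → Bool) → M)
    (t : Pt d) : M :=
  ∑ b : Fin d → Bool, (∏ i, if b i then t i else 1 - t i) • c b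

/-- The reference element: the unit simplex or the unit cube. -/
def Cell.ref {d : ℕ} : Cell d → Set (Pt d)
  | .simplex _ => {t | (∀ i, 0 ≤ t i) ∧ ∑ i, t i ≤ 1}
  | .quad _ => {t | ∀ i, 0 ≤ t i ∧ t i ≤ 1}

/-- The standard (affine or multilinear) parametrization of an element over its reference
element. -/
def Cell.param {d : ℕ} : Cell d → Pt d → Pt d
  | .simplex P => affineInterp P
  | .quad P => cubeInterp P

/-- The (closed) element as a set of points. -/
def Cell.toSet {d : ℕ} (K : Cell d) : Set (Pt d) := K.param '' K.ref

/-- The diameter `H_K`. -/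
def Cell.diam {d : ℕ} (K : Cell d) : ℝ := Metric.diam K.toSet

/-- `g` is a lowest-order shape function on `K`: affine on a simplex; of partial degree at most one
in each reference variable on a quadrilateral. -/
def Cell.IsShape {d : ℕ} (K : Cell d) (g : Pt d → ℝ) : Prop :=
  match K with
  | .simplex P => ∃ c : Fin (d + 1) → ℝ, ∀ t ∈ (Cell.simplex P).ref,
      g ((Cell.simplex P).param t) = affineInterp c t
  | .quad P => ∃ c : (Fin d → Bool) → ℝ, ∀ t ∈ (Cell.quad P).ref,
      g ((Cell.quad P).param t) = cubeInterp c t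

/-- Shape regularity of an element: it is nondegenerate, and its parametrization, scaled by the
diameter, is bi-Lipschitz with constant `γ`. -/
def Cell.ShapeRegular {d : ℕ} (γ : ℝ) (K : Cell d) : Prop :=
  0 < K.diam ∧ ∀ s ∈ K.ref, ∀ t ∈ K.ref,
    ‖K.param s - K.param t‖ ≤ γ * K.diam * ‖s - t‖ ∧
    K.diam * ‖s - t‖ ≤ γ * ‖K.param s - K.param t‖

/-- A partition of `Ω` into finitely many elements. -/
structure Mesh {d : ℕ} (Ω : Set (Pt d)) where
  cells : Finset (Cell d)
  cover : (⋃ K ∈ cells, K.toSet) = closure Ω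
  nonoverlapping : ∀ K ∈ cells, ∀ K' ∈ cells, K ≠ K' → volume (K.toSet ∩ K'.toSet) = 0

/-- The mesh size `H = max H_K`. -/
def Mesh.size {d : ℕ} {Ω : Set (Pt d)} (T : Mesh Ω) : ℝ := ⨆ K : T.cells, K.1.diam

/-- Shape regularity and quasi-uniformity with constant `γ`. -/
def Mesh.Regular {d : ℕ} {Ω : Set (Pt d)} (γ : ℝ) (T : Mesh Ω) : Prop :=
  ∀ K ∈ T.cells, K.ShapeRegular γ ∧ T.size ≤ γ * K.diam

/-- The `k`-layer patch `N^k(K)` (elements are compact, so closures are not needed). -/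
def Mesh.patch {d : ℕ} {Ω : Set (Pt d)} (T : Mesh Ω) : ℕ → Cell d → Set (Pt d)
  | 0, K => K.toSet
  | k + 1, K => ⋃ K' ∈ {K' : Cell d | K' ∈ T.cells ∧ (K'.toSet ∩ T.patch k K).Nonempty}, K'.toSet

/-- `C_ol`: the maximal number of elements in a `k`-layer patch. -/
def Mesh.overlap {d : ℕ} {Ω : Set (Pt d)} (T : Mesh Ω) (k : ℕ) : ℕ :=
  T.cells.sup fun K => Set.ncard {K' : Cell d | K' ∈ T.cells ∧ K'.toSet ⊆ T.patch k K}

theorem Cell.IsShape.add {d : ℕ} {K : Cell d} {g h : Pt d → ℝ} (hg : K.IsShape g)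
    (hh : K.IsShape h) : K.IsShape (fun x => g x + h x) := by
  cases K with
  | simplex P =>
    obtain ⟨c, hc⟩ := hg
    obtain ⟨e, he⟩ := hh
    refine ⟨c + e, fun t ht => ?_⟩
    simp only [hc t ht, he t ht, affineInterp, Pi.add_apply, smul_add, Finset.sum_add_distrib]
    ring
  | quad P =>
    obtain ⟨c, hc⟩ := hg
    obtain ⟨e, he⟩ := hh
    refine ⟨c + e, fun t ht => ?_⟩
    simp only [hc t ht, he t ht, cubeInterp, Pi.add_apply, smul_add, Finset.sum_add_distrib]

theorem Cell.IsShape.smul {d : ℕ} {K : Cell d} {g : Pt d → ℝ} (a : ℝ) (hg : K.IsShape g) :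
    K.IsShape (fun x => a * g x) := by
  cases K with
  | simplex P =>
    obtain ⟨c, hc⟩ := hg
    refine ⟨a • c, fun t ht => ?_⟩
    simp only [hc t ht, affineInterp, Pi.smul_apply, smul_eq_mul, mul_add, Finset.mul_sum]
    congr 1
    · ring
    · exact Finset.sum_congr rfl fun i _ => by ring
  | quad P =>
    obtain ⟨c, hc⟩ := hg
    refine ⟨a • c, fun t ht => ?_⟩
    simp only [hc t ht, cubeInterp, Pi.smul_apply, smul_eq_mul, Finset.mul_sum]
    exact Finset.sum_congr rfl fun i _ => by ring

/-- The lowest-order conforming finite element space `V_H ⊆ H¹₀(Ω)`: the functions of `H¹₀(Ω)` that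
coincide with a shape function on each element. -/
def Mesh.feSpace {d : ℕ} {Ω : Set (Pt d)} (T : Mesh Ω) : Submodule ℝ (H10 Ω) where
  carrier := {v | ∀ K ∈ T.cells, ∃ g : Pt d → ℝ, K.IsShape g ∧
    ∀ᵐ x ∂(volume.restrict Ω), x ∈ K.toSet → val v x = g x}
  add_mem' := by
    intro v w hv hw K hK
    obtain ⟨g, hg, hvg⟩ := hv K hK
    obtain ⟨h, hh, hwh⟩ := hw K hK
    refine ⟨_, hg.add hh, ?_⟩
    filter_upwards [hvg, hwh, Lp.coeFn_add (val v) (val w)] with x h1 h2 h3 hx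
    rw [← h1 hx, ← h2 hx]
    exact h3
  zero_mem' := by
    intro K hK
    refine ⟨fun _ => 0, ?_, ?_⟩
    · cases K with
      | simplex P => exact ⟨0, fun t _ => by simp [affineInterp]⟩
      | quad P => exact ⟨0, fun t _ => by simp [cubeInterp]⟩
    · filter_upwards [Lp.coeFn_zero ℝ 2 (volume.restrict Ω)] with x h1 _
      exact h1
  smul_mem' := by
    intro a v hv K hK
    obtain ⟨g, hg, hvg⟩ := hv K hK
    refine ⟨_, hg.smul a, ?_⟩
    filter_upwards [hvg, Lp.coeFn_smul a (val v)] with x h1 h2 hx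
    rw [← h1 hx]
    exact h2

/-- `I` is a local linear projection onto `V_H` with the stability and approximation properties,
with constant `κ`. -/
structure IsInterpolation {d : ℕ} {Ω : Set (Pt d)} (T : Mesh Ω) (κ : ℝ)
    (I : H10 Ω →ₗ[ℝ] H10 Ω) : Prop where
  mem : ∀ v, I v ∈ T.feSpace
  proj : ∀ v ∈ T.feSpace, I v = v
  stable : ∀ K ∈ T.cells, ∀ v, semiOn (I v) K.toSet ≤ κ * semiOn v (T.patch 1 K)
  approx : ∀ K ∈ T.cells, ∀ v,
    normOn (v - I v) K.toSet ≤ κ * T.size * semiOn v (T.patch 1 K)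

/-! ### The localized multiscale method -/

/-- The fine-scale functions `W(S)`: elements of `W = ker I` with support in the closed set `S`. -/
def fineSpace {d : ℕ} {Ω : Set (Pt d)} (I : H10 Ω →ₗ[ℝ] H10 Ω) (S : Set (Pt d)) : Set (H10 Ω) :=
  {w | w ∈ LinearMap.ker I ∧ ∀ᵐ x ∂(volume.restrict Ω), x ∉ S → val w x = 0}

/-- `Q K` is the `k`-layer correction operator `Q_{K,k} : V_H → W(N^k(K))` of every element `K`. -/
def IsCorrector {d : ℕ} {Ω : Set (Pt d)} (l : Linearization) (α : Coeff d) (p : H10 Ω)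
    (T : Mesh Ω) (I : H10 Ω →ₗ[ℝ] H10 Ω) (k : ℕ) (Q : Cell d → H10 Ω → H10 Ω) : Prop :=
  ∀ K ∈ T.cells, ∀ v ∈ T.feSpace, Q K v ∈ fineSpace I (T.patch k K) ∧
    ∀ w ∈ fineSpace I (T.patch k K),
      linForm l α p (T.patch k K) (Q K v) w = linForm l α p K.toSet v w

/-- The operator `id - Q^k` with `Q^k = ∑_K Q_{K,k}`. -/
def correct {d : ℕ} {Ω : Set (Pt d)} (T : Mesh Ω) (Q : Cell d → H10 Ω → H10 Ω) (v : H10 Ω) :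
    H10 Ω :=
  v - ∑ K ∈ T.cells, Q K v

/-- The localized multiscale space `V_{H,k} = (id - Q^k) V_H`. -/
def msSpace {d : ℕ} {Ω : Set (Pt d)} (T : Mesh Ω) (Q : Cell d → H10 Ω → H10 Ω) : Set (H10 Ω) :=
  correct T Q '' T.feSpace

/-- `y ∈ V_{H,k}` solves `𝒜(y; y, v) = (f, v)` for all `v ∈ V_{H,k}`. -/
def IsGalerkinSolution {d : ℕ} {Ω : Set (Pt d)} (α : Coeff d) (f : L2 Ω) (T : Mesh Ω)
    (Q : Cell d → H10 Ω → H10 Ω) (y : H10 Ω) : Prop :=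
  y ∈ msSpace T Q ∧ ∀ v ∈ msSpace T Q, form α y y v = load f v

/-- The right-hand side
`(H + C_ol^{1/2} ν^k) ‖f‖₀ + η(u) + G(u, y, p)`, where `G` uses `(id - Q^k) I u`. -/
def errorBound {d : ℕ} {Ω : Set (Pt d)} (l : Linearization) (α : Coeff d) (f : L2 Ω) (p : H10 Ω)
    (T : Mesh Ω) (I : H10 Ω →ₗ[ℝ] H10 Ω) (k : ℕ) (Q : Cell d → H10 Ω → H10 Ω) (ν : ℝ)
    (u y : H10 Ω) : ℝ :=
  (T.size + Real.sqrt (T.overlap k) * ν ^ k) * ‖f‖ + linError l α p u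
    + mismatch α p u y (correct T Q (I u))

end LOD

end

open LOD

/-! Write `B` for the linearized form, `A(q; ·, ·)` for the nonlinear form frozen at `q`, `y` for
the Galerkin solution and `z = (id - Q^k) I u`. The error is split as `(u - z) + (z - y)`.

The function `w = u - z = (u - I u) + Q^k I u` lies in `W = ker I`. There `‖w‖₀ ≲ H |w|₁`, and `B`
is coercive: by ellipticity for Kačanov, and for Fréchet because the smallness condition on `H`
absorbs the drift. Summing over the elements `K`, `B(w, w) = B(u, w) + ∑ [B(Q_K I u, w) - B_K(I u,
w)]`. The first term differs from `A(u; u, w) = (f, w) ≲ H ‖f‖₀ |w|₁` by at most `η(u) |w|₁`. The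
sum would vanish for correctors computed on all of `Ω`, so it measures the localization alone
(`semi_sub_correct_le`).

Localization is harmless because a corrector solves a homogeneous fine-scale problem away from its
element. Testing with `q - (id - I)(χ q)`, where `χ` is a cut-off, gives a Caccioppoli inequality
(`exterior_energy_le`), and hole filling turns it into geometric decay over layers
(`exterior_energy_le_decayRate`). The residual of one corrector sees only the outermost layers, so
it inherits the decay (`residual_sq_le`). Cauchy–Schwarz over the elements costs the square root of
the overlap (`abs_sum_residual_le`).

The function `z - y` belongs to the multiscale space, so the equations for `u` and for `y` can both
be tested with it. Ellipticity of `α(·, p)` then leaves the mismatch `G` and a multiple of `|u -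
z|₁` (`semi_sub_galerkin_le`).

The domain is an arbitrary bounded open set, so the cut-offs are built from the length of paths
inside `Ω`. A volume count bounds the number of elements near a point, and hence the number of
layers that a short path can cross (`subset_patch_of_isPreconnected`). -/

namespace LOD

section

open Filter Topology

/-! ### Square-integrable functions -/

section SquareIntegrable

variable {X E F : Type*} [MeasurableSpace X] {μ : Measure X} [NormedAddCommGroup E]
  [NormedAddCommGroup F]

theorem integral_norm_mul_norm_le {f : X → E} {g : X → F} (hf : MemLp f 2 μ) (hg : MemLp g 2 μ) :
    ∫ x, ‖f x‖ * ‖g x‖ ∂μ ≤ Real.sqrt (∫ x, ‖f x‖ ^ 2 ∂μ) * Real.sqrt (∫ x, ‖g x‖ ^ 2 ∂μ) := by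
  have h := integral_mul_le_Lp_mul_Lq_of_nonneg (μ := μ) (f := fun x => ‖f x‖)
    (g := fun x => ‖g x‖) (p := 2) (q := 2) Real.HolderConjugate.two_two
    (Eventually.of_forall fun x => norm_nonneg _) (Eventually.of_forall fun x => norm_nonneg _)
    (by simpa using hf.norm) (by simpa using hg.norm)
  simpa [Real.sqrt_eq_rpow] using h

theorem integrable_norm_mul_norm {f : X → E} {g : X → F} (hf : MemLp f 2 μ) (hg : MemLp g 2 μ) :
    Integrable (fun x => ‖f x‖ * ‖g x‖) μ :=
  hf.norm.integrable_mul hg.norm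

theorem integrable_inner_of_memLp [InnerProductSpace ℝ E] {f g : X → E} (hf : MemLp f 2 μ)
    (hg : MemLp g 2 μ) : Integrable (fun x => inner ℝ (f x) (g x)) μ :=
  (integrable_norm_mul_norm hf hg).mono (hf.1.inner hg.1)
    (Eventually.of_forall fun x => by simpa using abs_real_inner_le_norm (f x) (g x))

theorem abs_integral_inner_le [InnerProductSpace ℝ E] {f g : X → E} (hf : MemLp f 2 μ)
    (hg : MemLp g 2 μ) :
    |∫ x, inner ℝ (f x) (g x) ∂μ| ≤
      Real.sqrt (∫ x, ‖f x‖ ^ 2 ∂μ) * Real.sqrt (∫ x, ‖g x‖ ^ 2 ∂μ) := by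
  refine le_trans ?_ (integral_norm_mul_norm_le hf hg)
  refine (abs_integral_le_integral_abs).trans ?_
  exact integral_mono (integrable_inner_of_memLp hf hg).abs (integrable_norm_mul_norm hf hg)
    fun x => abs_real_inner_le_norm _ _

theorem integrable_norm_sq {f : X → E} (hf : MemLp f 2 μ) :
    Integrable (fun x => ‖f x‖ ^ 2) μ := by
  have := integrable_norm_mul_norm hf hf
  simpa [sq] using this

theorem norm_sq_eq_integral (f : Lp E 2 μ) : ‖f‖ ^ 2 = ∫ x, ‖f x‖ ^ 2 ∂μ := by
  rw [Lp.norm_def, (Lp.memLp f).eLpNorm_eq_integral_rpow_norm (by simp) (by simp),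
    ENNReal.toReal_ofReal (by positivity)]
  have h0 : 0 ≤ ∫ x, ‖f x‖ ^ 2 ∂μ := integral_nonneg fun x => by positivity
  simp only [ENNReal.toReal_ofNat, Real.rpow_ofNat]
  rw [← Real.rpow_natCast, ← Real.rpow_mul h0]
  norm_num

theorem norm_eq_sqrt_integral (f : Lp E 2 μ) : ‖f‖ = Real.sqrt (∫ x, ‖f x‖ ^ 2 ∂μ) := by
  rw [← norm_sq_eq_integral, Real.sqrt_sq (norm_nonneg _)]

end SquareIntegrable

variable {d : ℕ} {Ω : Set (Pt d)}

/-! ### The space `H¹₀(Ω)` -/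

theorem testPairs_zero : (0 : WithLp 2 (L2 Ω × L2vec Ω)) ∈ testPairs Ω := by
  refine ⟨fun _ => 0, contDiff_const, HasCompactSupport.zero, ?_, ?_, ?_⟩
  · simp [tsupport]
  · filter_upwards [Lp.coeFn_zero ℝ 2 (volume.restrict Ω)] with x hx
    exact hx
  · filter_upwards [Lp.coeFn_zero (Pt d) 2 (volume.restrict Ω)] with x hx
    rw [gradient_fun_const]
    exact hx

theorem gradient_add_apply {φ ψ : Pt d → ℝ} {x : Pt d} (hφ : DifferentiableAt ℝ φ x)
    (hψ : DifferentiableAt ℝ ψ x) :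
    gradient (fun x => φ x + ψ x) x = gradient φ x + gradient ψ x := by
  unfold gradient
  rw [fderiv_fun_add hφ hψ, map_add]

theorem gradient_const_mul_apply {φ : Pt d → ℝ} {x : Pt d} (hφ : DifferentiableAt ℝ φ x) (a : ℝ) :
    gradient (fun x => a * φ x) x = a • gradient φ x := by
  unfold gradient
  rw [fderiv_const_mul hφ]
  simp

theorem testPairs_add {z w : WithLp 2 (L2 Ω × L2vec Ω)} (hz : z ∈ testPairs Ω)
    (hw : w ∈ testPairs Ω) : z + w ∈ testPairs Ω := by
  obtain ⟨φ, h1, h2, h3, h4, h5⟩ := hz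
  obtain ⟨ψ, k1, k2, k3, k4, k5⟩ := hw
  refine ⟨fun x => φ x + ψ x, h1.add k1, h2.add k2, ?_, ?_, ?_⟩
  · exact (tsupport_add φ ψ).trans (Set.union_subset h3 k3)
  · filter_upwards [h4, k4, Lp.coeFn_add z.fst w.fst] with x h h' h''
    rw [WithLp.add_fst, h'', Pi.add_apply, h, h']
  · filter_upwards [h5, k5, Lp.coeFn_add z.snd w.snd] with x h h' h''
    rw [WithLp.add_snd, h'', Pi.add_apply, h, h',
      gradient_add_apply (h1.differentiable (by simp) x) (k1.differentiable (by simp) x)]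

theorem testPairs_smul {z : WithLp 2 (L2 Ω × L2vec Ω)} (a : ℝ) (hz : z ∈ testPairs Ω) :
    a • z ∈ testPairs Ω := by
  obtain ⟨φ, h1, h2, h3, h4, h5⟩ := hz
  refine ⟨fun x => a * φ x, contDiff_const.mul h1, h2.mul_left, ?_, ?_, ?_⟩
  · exact (tsupport_mul_subset_right).trans h3
  · filter_upwards [h4, Lp.coeFn_smul a z.fst] with x h h''
    rw [WithLp.smul_fst, h'', Pi.smul_apply, h, smul_eq_mul]
  · filter_upwards [h5, Lp.coeFn_smul a z.snd] with x h h''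
    rw [WithLp.smul_snd, h'', Pi.smul_apply, h,
      gradient_const_mul_apply (h1.differentiable (by simp) x)]

/-- The test pairs already form a subspace, so `H10 Ω` is their plain closure and a closed condition
need only be checked on smooth functions, whether or not it is linear. -/
theorem span_testPairs :
    (Submodule.span ℝ (testPairs Ω) : Set (WithLp 2 (L2 Ω × L2vec Ω))) = testPairs Ω := by
  refine Set.Subset.antisymm (fun z hz => ?_) Submodule.subset_span
  induction hz using Submodule.span_induction with
  | mem x hx => exact hx
  | zero => exact testPairs_zero
  | add x y _ _ hx hy => exact testPairs_add hx hy
  | smul a x _ hx => exact testPairs_smul a hx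

theorem coe_H10 : (H10 Ω : Set (WithLp 2 (L2 Ω × L2vec Ω))) = closure (testPairs Ω) := by
  rw [H10, Submodule.topologicalClosure_coe, span_testPairs]

/-- A closed condition that holds for the test functions holds on `H¹₀(Ω)`. -/
theorem H10_induction {P : WithLp 2 (L2 Ω × L2vec Ω) → Prop} (hP : IsClosed {z | P z})
    (h : ∀ z ∈ testPairs Ω, P z) (v : H10 Ω) : P v.1 := by
  have hv : v.1 ∈ closure (testPairs Ω) := by rw [← coe_H10]; exact v.2
  exact closure_minimal (fun z hz => h z hz) hP hv

/-- Membership in `H¹₀(Ω)` through a linear image of test functions. -/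
theorem mem_H10_of_continuousLinearMap
    (A : WithLp 2 (L2 Ω × L2vec Ω) →L[ℝ] WithLp 2 (L2 Ω × L2vec Ω))
    (h : ∀ z ∈ testPairs Ω, A z ∈ H10 Ω) (v : H10 Ω) : A v.1 ∈ H10 Ω := by
  refine H10_induction (P := fun z => A z ∈ H10 Ω) ?_ h v
  exact (Submodule.isClosed_topologicalClosure _).preimage A.continuous

/-! ### Friedrichs inequality and weak gradients -/

theorem norm_gradient (φ : Pt d → ℝ) (x : Pt d) : ‖gradient φ x‖ = ‖fderiv ℝ φ x‖ := by
  simp [gradient]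

theorem inner_gradient (φ : Pt d → ℝ) (x e : Pt d) : inner ℝ (gradient φ x) e = fderiv ℝ φ x e := by
  simp [gradient]

theorem setIntegral_eq_integral_of_tsupport_subset {g : Pt d → ℝ} {φ : Pt d → ℝ}
    (h : tsupport φ ⊆ Ω) (hg : ∀ x, x ∉ tsupport φ → g x = 0) : ∫ x in Ω, g x = ∫ x, g x :=
  setIntegral_eq_integral_of_forall_compl_eq_zero fun x hx => hg x fun hx' => hx (h hx')

/-- The Friedrichs inequality for test functions. -/
theorem friedrichs_testPairs (hd : 1 ≤ d) {R : ℝ} (hR : ∀ x ∈ Ω, ‖x‖ ≤ R)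
    {z : WithLp 2 (L2 Ω × L2vec Ω)} (hz : z ∈ testPairs Ω) :
    ‖z.fst‖ ≤ 2 * R * ‖z.snd‖ := by
  obtain ⟨φ, h1, h2, h3, h4, h5⟩ := hz
  let i : Fin d := ⟨0, hd⟩
  let e : Pt d := EuclideanSpace.single i 1
  have he : ‖e‖ = 1 := by simp [e]
  let ℓ : Pt d →L[ℝ] ℝ := EuclideanSpace.proj i
  have hℓe : ℓ e = 1 := by simp [ℓ, e]
  have hφd : Differentiable ℝ φ := h1.differentiable (by simp)
  have hφc : Continuous φ := h1.continuous
  have hdφ : Continuous (fun x => fderiv ℝ φ x e) :=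
    (h1.continuous_fderiv (by simp)).clm_apply continuous_const
  have hd2 : ∀ x, fderiv ℝ (fun x => φ x * φ x) x e = 2 * (φ x * fderiv ℝ φ x e) := by
    intro x
    rw [fderiv_fun_mul (hφd x) (hφd x)]
    simp; ring
  have hs1 : HasCompactSupport (fun x => φ x * fderiv ℝ φ x e) := h2.mul_right
  have hs2 : HasCompactSupport (fun x => φ x * φ x) := h2.mul_right
  -- With `ℓ` the first coordinate, `∂ₑℓ = 1` and hence `∫ φ² = -2 ∫ φ ∂ₑφ ℓ`. Since `|ℓ| ≤ R` on
  -- `Ω`, Cauchy–Schwarz gives the constant `2R`.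
  have key := integral_mul_fderiv_eq_neg_fderiv_mul_of_integrable (μ := (volume : Measure (Pt d)))
    (f := fun x => φ x * φ x) (g := fun x => ℓ x) (v := e) (𝕜 := ℝ)
    (by
      simp only [hd2]
      refine Continuous.integrable_of_hasCompactSupport (by fun_prop) ?_
      exact (hs1.mul_left (f := fun _ => (2 : ℝ))).mul_right)
    (by
      refine Continuous.integrable_of_hasCompactSupport ?_ ?_
      · simp only [ContinuousLinearMap.fderiv]; fun_prop
      · exact hs2.mul_right)
    (by
      refine Continuous.integrable_of_hasCompactSupport (by fun_prop) ?_
      exact hs2.mul_right)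
    (fun x _ => (hφd x).mul (hφd x)) (fun x _ => ℓ.differentiableAt)
  simp only [ContinuousLinearMap.fderiv, hℓe, mul_one, hd2] at key
  have hsupp : ∀ x, x ∉ tsupport φ → φ x = 0 := fun x hx => image_eq_zero_of_notMem_tsupport hx
  rw [← setIntegral_eq_integral_of_tsupport_subset h3 (fun x hx => by simp [hsupp x hx]),
    ← setIntegral_eq_integral_of_tsupport_subset h3 (fun x hx => by simp [hsupp x hx])] at key
  have hl : ∫ x in Ω, φ x * φ x = ‖z.fst‖ ^ 2 := by
    rw [norm_sq_eq_integral]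
    refine integral_congr_ae ?_
    filter_upwards [h4] with x hx
    rw [hx, Real.norm_eq_abs, sq_abs, sq]
  have hr : -∫ x in Ω, 2 * (φ x * fderiv ℝ φ x e) * ℓ x ≤
      2 * R * ∫ x in Ω, ‖z.fst x‖ * ‖z.snd x‖ := by
    have hΩR : ∀ᵐ x ∂(volume.restrict Ω), ‖z.fst x‖ = |φ x| ∧
        ‖z.snd x‖ = ‖fderiv ℝ φ x‖ ∧ (x ∈ tsupport φ → ‖x‖ ≤ R) := by
      filter_upwards [h4, h5] with x hx hx'
      exact ⟨by rw [hx, Real.norm_eq_abs], by rw [hx', norm_gradient], fun h => hR x (h3 h)⟩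
    rw [← integral_neg, ← integral_const_mul]
    refine integral_mono_ae ?_ ?_ ?_
    · refine (Continuous.integrable_of_hasCompactSupport (by fun_prop) ?_).neg.integrableOn
      exact (hs1.mul_left (f := fun _ => (2 : ℝ))).mul_right
    · exact (integrable_norm_mul_norm (Lp.memLp _) (Lp.memLp _)).const_mul _
    · filter_upwards [hΩR] with x ⟨hx1, hx2, hx3⟩
      rw [hx1, hx2]
      by_cases hx : x ∈ tsupport φ
      · have hn := hx3 hx
        have e1 : |fderiv ℝ φ x e| ≤ ‖fderiv ℝ φ x‖ := by
          simpa [he] using (fderiv ℝ φ x).le_opNorm e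
        have e2 : |ℓ x| ≤ R := by
          refine le_trans ?_ hn
          simpa [ℓ] using EuclideanSpace.norm_eq x ▸ PiLp.norm_apply_le x i
        have : -(2 * (φ x * fderiv ℝ φ x e) * ℓ x) ≤
            2 * (|φ x| * |fderiv ℝ φ x e|) * |ℓ x| := by
          refine (neg_le_abs _).trans (le_of_eq ?_)
          simp [abs_mul]
        refine this.trans ?_
        have : 2 * (|φ x| * |fderiv ℝ φ x e|) * |ℓ x| ≤ 2 * (|φ x| * ‖fderiv ℝ φ x‖) * R := by
          gcongr
        linarith
      · simp [hsupp x hx]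
  rw [hl, ← integral_neg] at key
  rw [← integral_neg] at hr
  have hcs := integral_norm_mul_norm_le (Lp.memLp z.fst) (Lp.memLp z.snd)
  rw [← norm_eq_sqrt_integral, ← norm_eq_sqrt_integral] at hcs
  -- One factor `‖φ‖` has to be cancelled, and `0 ≤ R` is known only once `Ω` has a point.
  by_cases hz0 : ‖z.fst‖ = 0
  · rw [hz0]
    by_cases hΩ : Ω.Nonempty
    · obtain ⟨x, hx⟩ := hΩ
      have := (norm_nonneg x).trans (hR x hx)
      positivity
    · rw [Set.not_nonempty_iff_eq_empty] at hΩ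
      have : ‖z.snd‖ = 0 := by
        rw [norm_eq_sqrt_integral]; simp [hΩ]
      simp [this]
  · have hpos : 0 < ‖z.fst‖ := lt_of_le_of_ne (norm_nonneg _) (Ne.symm hz0)
    have hΩ : Ω.Nonempty := by
      by_contra hΩ
      rw [Set.not_nonempty_iff_eq_empty] at hΩ
      exact hz0 (by rw [norm_eq_sqrt_integral]; simp [hΩ])
    obtain ⟨x, hx⟩ := hΩ
    have hR0 := (norm_nonneg x).trans (hR x hx)
    have : ‖z.fst‖ * ‖z.fst‖ ≤ 2 * R * ‖z.snd‖ * ‖z.fst‖ := by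
      have := key.le.trans hr
      have h3 : 2 * R * ∫ x in Ω, ‖z.fst x‖ * ‖z.snd x‖ ≤ 2 * R * (‖z.fst‖ * ‖z.snd‖) := by
        gcongr
      nlinarith
    exact le_of_mul_le_mul_right this hpos

/-- The Friedrichs inequality on `H¹₀(Ω)`. -/
theorem friedrichs (hd : 1 ≤ d) {R : ℝ} (hR : ∀ x ∈ Ω, ‖x‖ ≤ R) (v : H10 Ω) :
    ‖val v‖ ≤ 2 * R * semi v := by
  refine H10_induction (P := fun z => ‖z.fst‖ ≤ 2 * R * ‖z.snd‖) ?_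
    (fun z hz => friedrichs_testPairs hd hR hz) v
  refine isClosed_le ?_ ?_
  · exact continuous_norm.comp (WithLp.continuous_fst ..)
  · exact continuous_const.mul (continuous_norm.comp (WithLp.continuous_snd ..))

/-- The defining property of the weak gradient. -/
theorem integral_val_mul_fderiv (v : H10 Ω) {ψ : Pt d → ℝ} (hψ : ContDiff ℝ ∞ ψ)
    (hc : HasCompactSupport ψ) (e : Pt d) :
    ∫ x in Ω, val v x * fderiv ℝ ψ x e = -∫ x in Ω, inner ℝ (grad v x) e * ψ x := by
  have hdψ : Continuous (fun x => fderiv ℝ ψ x e) :=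
    (hψ.continuous_fderiv (by simp)).clm_apply continuous_const
  have hcd : HasCompactSupport (fun x => fderiv ℝ ψ x e) := by
    have := hc.fderiv (𝕜 := ℝ)
    exact this.comp_left (g := fun L : Pt d →L[ℝ] ℝ => L e) (by simp)
  have m1 : MemLp (fun x => fderiv ℝ ψ x e) 2 (volume.restrict Ω) :=
    (hdψ.memLp_of_hasCompactSupport hcd).restrict Ω
  have m2 : MemLp (fun x => ψ x • e) 2 (volume.restrict Ω) :=
    ((hψ.continuous.smul continuous_const).memLp_of_hasCompactSupport hc.smul_right).restrict Ω
  -- Both sides are written as inner products with fixed elements of `L²`, which makes the identity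
  -- a closed condition.
  let A : L2 Ω := m1.toLp
  let B : L2vec Ω := m2.toLp
  have hA : ∀ f : L2 Ω, inner ℝ f A = ∫ x in Ω, f x * fderiv ℝ ψ x e := by
    intro f
    rw [L2.inner_def]
    refine integral_congr_ae ?_
    filter_upwards [m1.coeFn_toLp] with x hx
    simp only [A, hx]
    simp [mul_comm]
  have hB : ∀ g : L2vec Ω, inner ℝ g B = ∫ x in Ω, inner ℝ (g x) e * ψ x := by
    intro g
    rw [L2.inner_def]
    refine integral_congr_ae ?_
    filter_upwards [m2.coeFn_toLp] with x hx
    simp only [B, hx]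
    rw [inner_smul_right, mul_comm]
  have key : inner ℝ (val v) A = - inner ℝ (grad v) B := by
    refine H10_induction (P := fun z => inner ℝ z.fst A = - inner ℝ z.snd B) ?_ ?_ v
    · refine isClosed_eq ?_ ?_
      · exact (WithLp.continuous_fst ..).inner continuous_const
      · exact ((WithLp.continuous_snd ..).inner continuous_const).neg
    · rintro z ⟨φ, h1, h2, h3, h4, h5⟩
      have hφd : Differentiable ℝ φ := h1.differentiable (by simp)
      have hψd : Differentiable ℝ ψ := hψ.differentiable (by simp)
      have hdφ : Continuous (fun x => fderiv ℝ φ x e) :=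
        (h1.continuous_fderiv (by simp)).clm_apply continuous_const
      have ibp := integral_mul_fderiv_eq_neg_fderiv_mul_of_integrable
        (μ := (volume : Measure (Pt d))) (f := φ) (g := ψ) (v := e) (𝕜 := ℝ)
        (Continuous.integrable_of_hasCompactSupport (by fun_prop) hc.mul_left)
        (Continuous.integrable_of_hasCompactSupport (by fun_prop) h2.mul_right)
        (Continuous.integrable_of_hasCompactSupport (by fun_prop) h2.mul_right)
        (fun x _ => hφd x) (fun x _ => hψd x)
      rw [hA, hB]
      have e1 : ∫ x in Ω, z.fst x * fderiv ℝ ψ x e = ∫ x, φ x * fderiv ℝ ψ x e := by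
        rw [← setIntegral_eq_integral_of_tsupport_subset h3 (fun x hx => by
          simp [image_eq_zero_of_notMem_tsupport hx])]
        refine integral_congr_ae ?_
        filter_upwards [h4] with x hx
        rw [hx]
      have e2 : ∫ x in Ω, inner ℝ (z.snd x) e * ψ x = ∫ x, fderiv ℝ φ x e * ψ x := by
        rw [← setIntegral_eq_integral_of_tsupport_subset h3 (fun x hx => by
          rw [fderiv_of_notMem_tsupport (𝕜 := ℝ) hx]; simp)]
        refine integral_congr_ae ?_
        filter_upwards [h5] with x hx
        rw [hx, inner_gradient]
      rw [e1, e2, ibp]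
  rw [hA, hB] at key
  exact key

/-- The weak gradient vanishes where the function vanishes, off a closed set. -/
theorem grad_eq_zero_of_val_eq_zero (hΩ : IsOpen Ω) {S : Set (Pt d)} (hS : IsClosed S) (v : H10 Ω)
    (hv : ∀ᵐ x ∂(volume.restrict Ω), x ∉ S → val v x = 0) :
    ∀ᵐ x ∂(volume.restrict Ω), x ∉ S → grad v x = 0 := by
  have hU : IsOpen (Ω \ S) := hΩ.sdiff hS
  -- Each component of the gradient integrates to zero against every test function supported in the
  -- open set `Ω \ S`, so it vanishes there almost everywhere.
  have comp : ∀ i : Fin d, ∀ᵐ x, x ∈ Ω \ S →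
      inner ℝ (grad v x) (EuclideanSpace.single i (1 : ℝ)) = 0 := by
    intro i
    set e : Pt d := EuclideanSpace.single i (1 : ℝ)
    refine hU.ae_eq_zero_of_integral_contDiff_smul_eq_zero ?_ ?_
    · have h0 : LocallyIntegrable (grad v) (volume.restrict Ω) :=
        (Lp.memLp (grad v)).locallyIntegrable (by norm_num)
      rw [locallyIntegrableOn_iff hU.isLocallyClosed]
      intro k hk hkc
      have h1 : IntegrableOn (grad v) k (volume.restrict Ω) :=
        h0.integrableOn_isCompact hkc
      have h2 : IntegrableOn (grad v) k volume := by
        rw [IntegrableOn, Measure.restrict_restrict hkc.measurableSet,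
          Set.inter_eq_left.2 (hk.trans Set.sdiff_subset)] at h1
        exact h1
      exact h2.inner_const e
    · intro ψ hψ hc hs
      have := integral_val_mul_fderiv v hψ hc e
      have hz : ∫ x in Ω, val v x * fderiv ℝ ψ x e = 0 := by
        refine integral_eq_zero_of_ae ?_
        filter_upwards [hv] with x hx
        by_cases hxt : x ∈ tsupport ψ
        · simp [hx (hs hxt).2]
        · rw [fderiv_of_notMem_tsupport (𝕜 := ℝ) hxt]; simp
      rw [hz, setIntegral_eq_integral_of_tsupport_subset (hs.trans Set.sdiff_subset) (fun x hx => by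
          simp [image_eq_zero_of_notMem_tsupport hx])] at this
      simp only [smul_eq_mul]
      simp only [mul_comm (ψ _)]
      linarith
  rw [ae_restrict_iff' hΩ.measurableSet]
  filter_upwards [ae_all_iff.2 comp] with x hx hxΩ hxS
  ext i
  have := hx i ⟨hxΩ, hxS⟩
  simpa [EuclideanSpace.inner_single_right] using this

end

section

open Filter Topology
open scoped Convolution NNReal ENNReal

variable {d : ℕ} {Ω : Set (Pt d)}

/-! ### Lipschitz functions in `H¹₀(Ω)` -/

/-- Dominated convergence; the measure is finite, so the constant `B ^ 2` is an integrable majorant.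
-/
theorem tendsto_Lp_of_ae_tendsto {X E : Type*} [MeasurableSpace X] {μ : Measure X}
    [IsFiniteMeasure μ] [NormedAddCommGroup E] {f : ℕ → Lp E 2 μ} {g : Lp E 2 μ} (B : ℝ)
    (hB : ∀ n, ∀ᵐ x ∂μ, ‖f n x - g x‖ ≤ B)
    (h : ∀ᵐ x ∂μ, Tendsto (fun n => f n x) atTop (𝓝 (g x))) : Tendsto f atTop (𝓝 g) := by
  rw [tendsto_iff_norm_sub_tendsto_zero]
  have h1 : ∀ n, ‖f n - g‖ = Real.sqrt (∫ x, ‖f n x - g x‖ ^ 2 ∂μ) := by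
    intro n
    rw [norm_eq_sqrt_integral]
    congr 1
    refine integral_congr_ae ?_
    filter_upwards [Lp.coeFn_sub (f n) g] with x hx
    rw [hx, Pi.sub_apply]
  simp only [h1]
  have h2 : Tendsto (fun n => ∫ x, ‖f n x - g x‖ ^ 2 ∂μ) atTop (𝓝 (∫ _, (0 : ℝ) ∂μ)) := by
    refine tendsto_integral_of_dominated_convergence (fun _ => B ^ 2) (fun n => ?_)
      (integrable_const _) (fun n => ?_) ?_
    · exact ((Lp.aestronglyMeasurable (f n)).sub (Lp.aestronglyMeasurable g)).norm.pow 2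
    · filter_upwards [hB n] with x hx
      rw [Real.norm_eq_abs, abs_of_nonneg (by positivity)]
      gcongr
    · filter_upwards [h] with x hx
      have := (tendsto_iff_norm_sub_tendsto_zero.1 hx).pow 2
      simpa using this
  have h3 := (Real.continuous_sqrt.tendsto _).comp h2
  simpa [Function.comp_def] using h3

/-- The derivative is moved onto the Lipschitz factor, so that the gradient of a mollification is
the mollified gradient. Rademacher's theorem differentiates the integrand for almost every `t`, and
the Lipschitz constant supplies the majorant `|ρ| C`. -/
theorem hasFDerivAt_convolution_of_lipschitz {ρ g : Pt d → ℝ} (hρ : Continuous ρ)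
    (hρc : HasCompactSupport ρ) {C : ℝ≥0} (hg : LipschitzWith C g) (x : Pt d) :
    HasFDerivAt (ρ ⋆[ContinuousLinearMap.lsmul ℝ ℝ, volume] g)
      ((ρ ⋆[ContinuousLinearMap.lsmul ℝ ℝ, volume] (fderiv ℝ g)) x) x := by
  have key := hasFDerivAt_integral_of_dominated_loc_of_lip (μ := (volume : Measure (Pt d)))
    (F := fun x t => ρ t • g (x - t)) (F' := fun t => ρ t • fderiv ℝ g (x - t)) (x₀ := x)
    (s := Set.univ) (bound := fun t => |ρ t| * C) (𝕜 := ℝ) Filter.univ_mem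
    (Eventually.of_forall fun y => by
      have := hg.continuous
      exact (show Continuous (fun t => ρ t • g (y - t)) by fun_prop).aestronglyMeasurable)
    (by
      have := hg.continuous
      exact (show Continuous (fun t => ρ t • g (x - t)) by fun_prop).integrable_of_hasCompactSupport
        hρc.smul_right)
    (by
      have h1 : Measurable (fun t => fderiv ℝ g (x - t)) :=
        (measurable_fderiv ℝ g).comp (measurable_const.sub measurable_id)
      exact hρ.aestronglyMeasurable.smul h1.aestronglyMeasurable)
    (Eventually.of_forall fun t => by
      rw [lipschitzOnWith_univ]
      refine LipschitzWith.of_dist_le_mul fun y z => ?_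
      rw [dist_eq_norm, ← smul_sub, norm_smul, Real.coe_nnabs, abs_mul, abs_abs, NNReal.abs_eq,
        mul_assoc, Real.norm_eq_abs]
      gcongr
      simpa [dist_eq_norm] using hg.dist_le_mul (y - t) (z - t))
    ((hρ.abs.integrable_of_hasCompactSupport (hρc.comp_left (g := fun r => |r|)
      (by simp))).mul_const _)
    (by
      have h1 : ∀ᵐ t : Pt d, DifferentiableAt ℝ g (x - t) :=
        (Measure.measurePreserving_sub_left volume x).quasiMeasurePreserving.ae hg.ae_differentiableAt
      filter_upwards [h1] with t ht
      have := ht.hasFDerivAt.comp x ((hasFDerivAt_id x).sub_const t)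
      exact this.const_smul (ρ t))
  exact key.2

/-- A Lipschitz function with compact support in `Ω`, with its gradient, lies in `H¹₀(Ω)`. -/
theorem mem_H10_of_lipschitz (hΩ : IsOpen Ω) (hΩb : Bornology.IsBounded Ω) {g : Pt d → ℝ} {C : ℝ≥0}
    (hg : LipschitzWith C g) (hgc : HasCompactSupport g) (hgs : tsupport g ⊆ Ω)
    {z : WithLp 2 (L2 Ω × L2vec Ω)} (h1 : ∀ᵐ x ∂(volume.restrict Ω), z.fst x = g x)
    (h2 : ∀ᵐ x ∂(volume.restrict Ω), z.snd x = gradient g x) : z ∈ H10 Ω := by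
  have : IsFiniteMeasure (volume.restrict Ω) := ⟨by simpa using hΩb.measure_lt_top⟩
  -- Mollification radii of at most `δ` keep the supports inside `Ω`.
  obtain ⟨δ, hδ, hδΩ⟩ := hgc.isCompact.exists_cthickening_subset_open hΩ hgs
  let φ : ℕ → ContDiffBump (0 : Pt d) := fun n =>
    { rIn := δ / (2 * (n + 1)), rOut := δ / (n + 1), rIn_pos := by positivity
      rIn_lt_rOut := by
        apply div_lt_div_of_pos_left hδ (by positivity)
        have : (0 : ℝ) < n + 1 := by positivity
        linarith }
  have hrle : ∀ n, (φ n).rOut ≤ δ := fun n => div_le_self hδ.le (by simp)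
  have hr0 : Tendsto (fun n => (φ n).rOut) atTop (𝓝 0) := by
    have := (tendsto_one_div_add_atTop_nhds_zero_nat (𝕜 := ℝ)).const_mul δ
    simpa [φ, div_eq_mul_inv] using this
  let ρ : ℕ → Pt d → ℝ := fun n => (φ n).normed volume
  have hρc : ∀ n, Continuous (ρ n) := fun n => (φ n).continuous_normed
  have hρs : ∀ n, HasCompactSupport (ρ n) := fun n => (φ n).hasCompactSupport_normed
  let G : ℕ → Pt d → ℝ := fun n => ρ n ⋆[ContinuousLinearMap.lsmul ℝ ℝ, volume] g
  let D : ℕ → Pt d → (Pt d →L[ℝ] ℝ) := fun n =>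
    ρ n ⋆[ContinuousLinearMap.lsmul ℝ ℝ, volume] (fderiv ℝ g)
  have hG : ∀ n x, HasFDerivAt (G n) (D n x) x := fun n x =>
    hasFDerivAt_convolution_of_lipschitz (hρc n) (hρs n) hg x
  have hGs : ∀ n, ContDiff ℝ ∞ (G n) := fun n =>
    (hρs n).contDiff_convolution_left (n := ⊤) _ (φ n).contDiff_normed
      hg.continuous.locallyIntegrable
  have hGt : ∀ n, tsupport (G n) ⊆ Metric.cthickening δ (tsupport g) := by
    intro n
    refine closure_minimal ?_ Metric.isClosed_cthickening
    refine (support_convolution_subset _).trans ?_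
    rintro _ ⟨a, ha, b, hb, rfl⟩
    have ha' : a ∈ Metric.ball (0 : Pt d) (φ n).rOut := by
      rw [← (φ n).support_normed_eq (μ := volume)]; exact ha
    refine Metric.mem_cthickening_of_dist_le _ b δ _ (subset_tsupport _ hb) ?_
    simp only [Metric.mem_ball, dist_zero_right] at ha'
    simpa [dist_eq_norm] using ha'.le.trans (hrle n)
  have hGc : ∀ n, HasCompactSupport (G n) := fun n =>
    HasCompactSupport.of_support_subset_isCompact hgc.isCompact.cthickening
      ((subset_tsupport _).trans (hGt n))
  have hgrad : ∀ n x, gradient (G n) x = (InnerProductSpace.toDual ℝ (Pt d)).symm (D n x) := by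
    intro n x
    rw [gradient, (hG n x).fderiv]
  have hgc' : ∀ n, Continuous (gradient (G n)) := fun n =>
    (LinearIsometryEquiv.continuous _).comp ((hGs n).continuous_fderiv (by simp))
  have m1 : ∀ n, MemLp (G n) 2 (volume.restrict Ω) := fun n =>
    ((hGs n).continuous.memLp_of_hasCompactSupport (hGc n)).restrict Ω
  have hgcs : ∀ n, HasCompactSupport (gradient (G n)) := fun n =>
    ((hGc n).fderiv (𝕜 := ℝ)).comp_left (g := (InnerProductSpace.toDual ℝ (Pt d)).symm)
      (map_zero _)
  have m2 : ∀ n, MemLp (gradient (G n)) 2 (volume.restrict Ω) := fun n =>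
    ((hgc' n).memLp_of_hasCompactSupport (hgcs n)).restrict Ω
  have hDb : ∀ n x, ‖D n x‖ ≤ C := by
    intro n x
    have hi : Integrable (fun t => ρ n t * (C : ℝ)) :=
      ((hρc n).integrable_of_hasCompactSupport (hρs n)).mul_const _
    have := norm_integral_le_of_norm_le (μ := volume)
      (f := fun t => ρ n t • fderiv ℝ g (x - t)) hi
      (Eventually.of_forall fun t => by
        rw [norm_smul, Real.norm_of_nonneg ((φ n).nonneg_normed t)]
        exact mul_le_mul_of_nonneg_left (norm_fderiv_le_of_lipschitz ℝ hg)
          ((φ n).nonneg_normed t))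
    rw [integral_mul_const, (φ n).integral_normed, one_mul] at this
    exact this
  have hGb : ∀ n x, ‖G n x - g x‖ ≤ C * (φ n).rOut := by
    intro n x
    rw [← dist_eq_norm]
    refine (φ n).dist_normed_convolution_le hg.continuous.aestronglyMeasurable fun y hy => ?_
    refine (hg.dist_le_mul y x).trans ?_
    gcongr
    exact (Metric.mem_ball.1 hy).le
  have hli : LocallyIntegrable (fderiv ℝ g) (volume : Measure (Pt d)) := by
    intro x
    refine ⟨Metric.ball x 1, Metric.ball_mem_nhds x one_pos, ?_⟩
    refine Measure.integrableOn_of_bounded (M := (C : ℝ)) Metric.isBounded_ball.measure_lt_top.ne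
      (measurable_fderiv ℝ g).aestronglyMeasurable
      (Eventually.of_forall fun y => norm_fderiv_le_of_lipschitz ℝ hg)
  -- Lebesgue differentiation; the bumps do not degenerate, since `rOut = 2 * rIn` for all of them.
  have hDt : ∀ᵐ x, Tendsto (fun n => D n x) atTop (𝓝 (fderiv ℝ g x)) :=
    ContDiffBump.ae_convolution_tendsto_right_of_locallyIntegrable (K := 2) hr0
      (Eventually.of_forall fun n => le_of_eq (by simp [φ]; field_simp)) hli
  let w : ℕ → WithLp 2 (L2 Ω × L2vec Ω) := fun n =>
    WithLp.toLp 2 ((m1 n).toLp, (m2 n).toLp)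
  have hw : ∀ n, w n ∈ H10 Ω := by
    intro n
    refine Submodule.le_topologicalClosure _ (Submodule.subset_span ?_)
    exact ⟨G n, hGs n, hGc n, (hGt n).trans hδΩ, (m1 n).coeFn_toLp, (m2 n).coeFn_toLp⟩
  have hlim : Tendsto w atTop (𝓝 z) := by
    have t1 : Tendsto (fun n => (m1 n).toLp) atTop (𝓝 z.fst) := by
      refine tendsto_Lp_of_ae_tendsto (C * δ) (fun n => ?_) ?_
      · filter_upwards [(m1 n).coeFn_toLp, h1] with x hx hx'
        rw [hx, hx']
        exact (hGb n x).trans (by gcongr; exact hrle n)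
      · filter_upwards [ae_all_iff.2 fun n => (m1 n).coeFn_toLp, h1] with x hx hx'
        simp only [hx, hx']
        rw [tendsto_iff_norm_sub_tendsto_zero]
        refine squeeze_zero (fun n => norm_nonneg _) (fun n => hGb n x) ?_
        simpa using hr0.const_mul (C : ℝ)
    have t2 : Tendsto (fun n => (m2 n).toLp) atTop (𝓝 z.snd) := by
      refine tendsto_Lp_of_ae_tendsto (C + C) (fun n => ?_) ?_
      · filter_upwards [(m2 n).coeFn_toLp, h2] with x hx hx'
        rw [hx, hx']
        refine (norm_sub_le _ _).trans (add_le_add ?_ ?_)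
        · rw [hgrad]; simpa using hDb n x
        · rw [norm_gradient]; exact norm_fderiv_le_of_lipschitz ℝ hg
      · filter_upwards [ae_all_iff.2 fun n => (m2 n).coeFn_toLp, h2,
          ae_restrict_of_ae (s := Ω) hDt] with x hx hx' hx''
        simp only [hx, hx', hgrad]
        exact ((LinearIsometryEquiv.continuous _).tendsto _).comp hx''
    have := ((WithLp.prod_continuous_toLp 2 (L2 Ω) (L2vec Ω)).tendsto (z.fst, z.snd)).comp
      (t1.prodMk_nhds t2)
    exact this
  exact (Submodule.isClosed_topologicalClosure _).mem_of_tendsto hlim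
    (Eventually.of_forall hw)

/-! ### Multiplication by cut-off functions -/

/-- `χ` is Lipschitz along every segment contained in `Ω`. -/
def LipschitzAlong (Ω : Set (Pt d)) (L : ℝ) (χ : Pt d → ℝ) : Prop :=
  ∀ x y : Pt d, segment ℝ x y ⊆ Ω → |χ x - χ y| ≤ L * ‖x - y‖

theorem LipschitzAlong.lipschitzOnWith {L : ℝ≥0} {χ : Pt d → ℝ} (h : LipschitzAlong Ω L χ)
    {x : Pt d} {r : ℝ} (hr : Metric.ball x r ⊆ Ω) : LipschitzOnWith L χ (Metric.ball x r) := by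
  refine LipschitzOnWith.of_dist_le_mul fun y hy z hz => ?_
  rw [Real.dist_eq, dist_eq_norm]
  exact h y z (((convex_ball x r).segment_subset hy hz).trans hr)

theorem LipschitzAlong.continuousOn (hΩ : IsOpen Ω) {L : ℝ≥0} {χ : Pt d → ℝ}
    (h : LipschitzAlong Ω L χ) : ContinuousOn χ Ω := by
  intro x hx
  obtain ⟨r, hr, hrΩ⟩ := Metric.isOpen_iff.1 hΩ x hx
  exact ((h.lipschitzOnWith hrΩ).continuousOn.continuousAt
    (Metric.ball_mem_nhds x hr)).continuousWithinAt

theorem LipschitzAlong.norm_gradient_le (hΩ : IsOpen Ω) {L : ℝ≥0} {χ : Pt d → ℝ}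
    (h : LipschitzAlong Ω L χ) {x : Pt d} (hx : x ∈ Ω) : ‖gradient χ x‖ ≤ L := by
  obtain ⟨r, hr, hrΩ⟩ := Metric.isOpen_iff.1 hΩ x hx
  rw [norm_gradient]
  exact norm_fderiv_le_of_lipschitzOn ℝ (Metric.ball_mem_nhds x hr) (h.lipschitzOnWith hrΩ)

/-- Balls in `Ω` are convex, so Rademacher's theorem applies on each of them; a locally null set is
null. -/
theorem LipschitzAlong.ae_differentiableAt (hΩ : IsOpen Ω) {L : ℝ≥0} {χ : Pt d → ℝ}
    (h : LipschitzAlong Ω L χ) : ∀ᵐ x ∂(volume.restrict Ω), DifferentiableAt ℝ χ x := by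
  rw [ae_restrict_iff' hΩ.measurableSet, ae_iff]
  refine measure_null_of_locally_null _ fun x hx => ?_
  simp only [Set.mem_ofPred_eq, Classical.not_imp] at hx
  obtain ⟨r, hr, hrΩ⟩ := Metric.isOpen_iff.1 hΩ x hx.1
  have hae := (h.lipschitzOnWith hrΩ).ae_differentiableWithinAt_of_mem (μ := volume)
  refine ⟨_, inter_mem (mem_nhdsWithin_of_mem_nhds (Metric.ball_mem_nhds x hr))
    self_mem_nhdsWithin, ?_⟩
  rw [ae_iff] at hae
  refine measure_mono_null ?_ hae
  rintro y ⟨hy, hy'⟩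
  simp only [Set.mem_ofPred_eq, Classical.not_imp] at hy' ⊢
  exact ⟨hy, fun hd => hy'.2 (hd.differentiableAt (Metric.isOpen_ball.mem_nhds hy))⟩

/-- A segment of length at most `δ` with an end in the support of `φ` stays in `Ω`, where `χ` is
Lipschitz. For points farther apart than `δ`, boundedness of the product suffices and contributes `2
* B / δ`. -/
theorem exists_lipschitzWith_mul (hΩ : IsOpen Ω) {L : ℝ≥0} {χ : Pt d → ℝ}
    (h : LipschitzAlong Ω L χ) (hχ : ∀ x, |χ x| ≤ 1) {φ : Pt d → ℝ} (hφ : ContDiff ℝ ∞ φ)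
    (hc : HasCompactSupport φ) (hs : tsupport φ ⊆ Ω) :
    ∃ C : ℝ≥0, LipschitzWith C (fun x => χ x * φ x) := by
  obtain ⟨K, hK⟩ := (hφ.of_le (m := 1) (by simp)).lipschitzWith_of_hasCompactSupport hc one_ne_zero
  obtain ⟨B, hB⟩ := hc.exists_bound_of_continuous hφ.continuous
  have hB0 : 0 ≤ B := (norm_nonneg _).trans (hB 0)
  obtain ⟨δ, hδ, hδΩ⟩ := hc.isCompact.exists_cthickening_subset_open hΩ hs
  refine ⟨Real.toNNReal (L * B + K + 2 * B / δ), LipschitzWith.of_dist_le_mul fun x y => ?_⟩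
  rw [Real.coe_toNNReal _ (by positivity), Real.dist_eq, dist_eq_norm]
  have hBx : ∀ x, |χ x * φ x| ≤ B := fun x => by
    rw [abs_mul]
    calc |χ x| * |φ x| ≤ 1 * B := by
          gcongr
          · exact hχ x
          · exact hB x
      _ = B := one_mul B
  by_cases hxy : ‖x - y‖ ≤ δ
  · have near : ∀ a b : Pt d, a ∈ tsupport φ → ‖a - b‖ ≤ δ → segment ℝ a b ⊆ Ω := by
      intro a b ha hab
      have hsub : Metric.closedBall a δ ⊆ Ω :=
        (Metric.closedBall_subset_cthickening ha δ).trans hδΩ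
      refine ((convex_closedBall a δ).segment_subset (Metric.mem_closedBall_self hδ.le) ?_).trans
        hsub
      rwa [Metric.mem_closedBall, dist_comm, dist_eq_norm]
    by_cases hout : x ∈ tsupport φ ∨ y ∈ tsupport φ
    · have hseg : segment ℝ x y ⊆ Ω := by
        rcases hout with hx | hy
        · exact near x y hx hxy
        · rw [segment_symm]
          exact near y x hy (by rwa [norm_sub_rev])
      have e : χ x * φ x - χ y * φ y = (χ x - χ y) * φ x + χ y * (φ x - φ y) := by ring
      rw [e]
      have a1 : |(χ x - χ y) * φ x| ≤ L * ‖x - y‖ * B := by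
        rw [abs_mul]
        gcongr
        · exact h x y hseg
        · exact hB x
      have a2 : |χ y * (φ x - φ y)| ≤ 1 * (K * ‖x - y‖) := by
        rw [abs_mul]
        gcongr
        · exact hχ y
        · simpa [Real.dist_eq, dist_eq_norm] using hK.dist_le_mul x y
      have a3 : 0 ≤ 2 * B / δ * ‖x - y‖ := by positivity
      calc _ ≤ _ := abs_add_le _ _
        _ ≤ (L * B + K + 2 * B / δ) * ‖x - y‖ := by nlinarith
    · push Not at hout
      rw [image_eq_zero_of_notMem_tsupport hout.1, image_eq_zero_of_notMem_tsupport hout.2]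
      simp only [mul_zero, sub_zero, abs_zero]
      positivity
  · push Not at hxy
    have a1 : |χ x * φ x - χ y * φ y| ≤ 2 * B := by
      refine (abs_sub _ _).trans ?_
      linarith [hBx x, hBx y]
    have a2 : 2 * B ≤ 2 * B / δ * ‖x - y‖ := by
      rw [div_mul_eq_mul_div, le_div_iff₀ hδ]
      gcongr
    have a3 : 0 ≤ (L * B + K) * ‖x - y‖ := by positivity
    linarith

/-- The product of an element of `H¹₀(Ω)` with a cut-off function, and its gradient. -/
theorem exists_cutoff_mul (hΩ : IsOpen Ω) (hΩb : Bornology.IsBounded Ω) {L : ℝ≥0} {χ : Pt d → ℝ}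
    (h : LipschitzAlong Ω L χ) (hχ : ∀ x, |χ x| ≤ 1) (v : H10 Ω) :
    ∃ v' : H10 Ω, (∀ᵐ x ∂(volume.restrict Ω), val v' x = χ x * val v x) ∧
      (∀ᵐ x ∂(volume.restrict Ω), grad v' x = χ x • grad v x + val v x • gradient χ x) := by
  have mχ : MemLp χ ∞ (volume.restrict Ω) :=
    memLp_top_of_bound ((h.continuousOn hΩ).aestronglyMeasurable hΩ.measurableSet) 1
      (Eventually.of_forall hχ)
  have mG : MemLp (gradient χ) ∞ (volume.restrict Ω) := by
    refine memLp_top_of_bound ?_ L ?_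
    · exact ((LinearIsometryEquiv.continuous _).measurable.comp
        (measurable_fderiv ℝ χ)).aestronglyMeasurable
    · filter_upwards [ae_restrict_mem hΩ.measurableSet] with x hx using h.norm_gradient_le hΩ hx
  -- The product rule is realized by bounded operators on `L²`: multiplication by `χ` and by its
  -- gradient. It then suffices to treat test functions, whose products with `χ` are Lipschitz.
  let A1 : L2 Ω →L[ℝ] L2 Ω :=
    (ContinuousLinearMap.lsmul ℝ ℝ).holderL (volume.restrict Ω) ∞ 2 2 mχ.toLp
  let A2 : L2vec Ω →L[ℝ] L2vec Ω :=
    (ContinuousLinearMap.lsmul ℝ ℝ).holderL (volume.restrict Ω) ∞ 2 2 mχ.toLp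
  let A3 : L2 Ω →L[ℝ] L2vec Ω :=
    (ContinuousLinearMap.lsmul ℝ ℝ).flip.holderL (volume.restrict Ω) ∞ 2 2 mG.toLp
  have e1 : ∀ f : L2 Ω, ∀ᵐ x ∂(volume.restrict Ω), A1 f x = χ x * f x := by
    intro f
    filter_upwards [(ContinuousLinearMap.lsmul ℝ ℝ).coeFn_holder (r := 2) mχ.toLp f,
      mχ.coeFn_toLp] with x hx hx'
    change (ContinuousLinearMap.lsmul ℝ ℝ).holder 2 mχ.toLp f x = _
    rw [hx, hx']; rfl
  have e2 : ∀ f : L2vec Ω, ∀ᵐ x ∂(volume.restrict Ω), A2 f x = χ x • f x := by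
    intro f
    filter_upwards [(ContinuousLinearMap.lsmul ℝ ℝ).coeFn_holder (r := 2) mχ.toLp f,
      mχ.coeFn_toLp] with x hx hx'
    change (ContinuousLinearMap.lsmul ℝ ℝ).holder 2 mχ.toLp f x = _
    rw [hx, hx']; rfl
  have e3 : ∀ f : L2 Ω, ∀ᵐ x ∂(volume.restrict Ω), A3 f x = f x • gradient χ x := by
    intro f
    filter_upwards [(ContinuousLinearMap.lsmul ℝ ℝ).flip.coeFn_holder (r := 2) mG.toLp f,
      mG.coeFn_toLp] with x hx hx'
    change (ContinuousLinearMap.lsmul ℝ ℝ).flip.holder 2 mG.toLp f x = _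
    rw [hx, hx']; rfl
  let pr1 : WithLp 2 (L2 Ω × L2vec Ω) →L[ℝ] L2 Ω :=
    (ContinuousLinearMap.fst ℝ _ _).comp
      (WithLp.prodContinuousLinearEquiv 2 ℝ (L2 Ω) (L2vec Ω)).toContinuousLinearMap
  let pr2 : WithLp 2 (L2 Ω × L2vec Ω) →L[ℝ] L2vec Ω :=
    (ContinuousLinearMap.snd ℝ _ _).comp
      (WithLp.prodContinuousLinearEquiv 2 ℝ (L2 Ω) (L2vec Ω)).toContinuousLinearMap
  let A : WithLp 2 (L2 Ω × L2vec Ω) →L[ℝ] WithLp 2 (L2 Ω × L2vec Ω) :=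
    (WithLp.prodContinuousLinearEquiv 2 ℝ (L2 Ω) (L2vec Ω)).symm.toContinuousLinearMap.comp
      ((A1.comp pr1).prod (A2.comp pr2 + A3.comp pr1))
  have f1 : ∀ z, (A z).fst = A1 z.fst := fun z => rfl
  have f2 : ∀ z, (A z).snd = A2 z.snd + A3 z.fst := fun z => rfl
  have g1 : ∀ z, ∀ᵐ x ∂(volume.restrict Ω), (A z).fst x = χ x * z.fst x := fun z => by
    rw [f1]; exact e1 _
  have g2 : ∀ z, ∀ᵐ x ∂(volume.restrict Ω),
      (A z).snd x = χ x • z.snd x + z.fst x • gradient χ x := fun z => by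
    rw [f2]
    filter_upwards [Lp.coeFn_add (A2 z.snd) (A3 z.fst), e2 z.snd, e3 z.fst] with x hx hx1 hx2
    rw [hx, Pi.add_apply, hx1, hx2]
  refine ⟨⟨A v.1, mem_H10_of_continuousLinearMap A ?_ v⟩, g1 v.1, g2 v.1⟩
  rintro z ⟨φ, hφ, hc, hs, hz1, hz2⟩
  obtain ⟨C, hC⟩ := exists_lipschitzWith_mul hΩ h hχ hφ hc hs
  refine mem_H10_of_lipschitz hΩ hΩb hC hc.mul_left
    (tsupport_mul_subset_right.trans hs) ?_ ?_
  · filter_upwards [g1 z, hz1] with x hx hx'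
    rw [hx, hx']
  · filter_upwards [g2 z, hz1, hz2, h.ae_differentiableAt hΩ] with x hx hx1 hx2 hd
    rw [hx, hx1, hx2, gradient, gradient, gradient,
      fderiv_fun_mul hd (hφ.differentiable (by simp) x)]
    simp

end

section

open Filter Topology
open scoped NNReal ENNReal

variable {d : ℕ} {Ω : Set (Pt d)}

/-! ### Measurability of the coefficients -/

/-- Carathéodory's argument: for simple `q` the composition is a finite sum of coefficients on level
sets, and continuity in `s` passes to the limit. -/
theorem CoeffAssumption.aestronglyMeasurable_comp (hΩ : IsOpen Ω) {lam Lam0 Lam1 : ℝ} {α : Coeff d}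
    (hα : CoeffAssumption Ω lam Lam0 Lam1 α) {q : Pt d → ℝ}
    (hq : AEStronglyMeasurable q (volume.restrict Ω)) :
    AEStronglyMeasurable (fun x => α x (q x)) (volume.restrict Ω) := by
  have hsimple : ∀ s : SimpleFunc (Pt d) ℝ,
      AEStronglyMeasurable (fun x => α x (s x)) (volume.restrict Ω) := by
    intro s
    have e : (fun x => α x (s x)) =
        fun x => ∑ c ∈ s.range, (s ⁻¹' {c}).indicator (fun x => α x c) x := by
      funext x
      rw [Finset.sum_eq_single (s x)]
      · simp
      · intro c _ hc
        exact Set.indicator_of_notMem (by simpa using Ne.symm hc) _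
      · intro h
        exact absurd (s.mem_range_self x) h
    rw [e]
    exact Finset.aestronglyMeasurable_fun_sum _ fun c _ =>
      (hα.measurable c).indicator (s.measurableSet_fiber c)
  refine aestronglyMeasurable_of_tendsto_ae atTop
    (f := fun n x => α x (hq.stronglyMeasurable_mk.approx n x)) (fun n => hsimple _) ?_
  filter_upwards [hq.ae_eq_mk, ae_restrict_mem hΩ.measurableSet] with x hx hxΩ
  rw [hx, tendsto_iff_norm_sub_tendsto_zero]
  have ht := tendsto_iff_norm_sub_tendsto_zero.1 (hq.stronglyMeasurable_mk.tendsto_approx x)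
  refine squeeze_zero (fun _ => norm_nonneg _) (fun n => hα.lipschitz x hxΩ _ _) ?_
  simpa using ht.const_mul Lam0

theorem CoeffAssumption.aestronglyMeasurable_drift (hΩ : IsOpen Ω) {lam Lam0 Lam1 : ℝ}
    {α : Coeff d} (hα : CoeffAssumption Ω lam Lam0 Lam1 α) (hd : TwiceDifferentiable Ω α)
    (p : H10 Ω) : AEStronglyMeasurable (drift .frechet α p) (volume.restrict Ω) := by
  have hp : AEStronglyMeasurable (val p) (volume.restrict Ω) := Lp.aestronglyMeasurable _
  -- The derivative is the limit of the difference quotients with step `1 / (n + 1)`, each of which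
  -- is measurable.
  have hder : AEStronglyMeasurable (fun x => deriv (α x) (val p x)) (volume.restrict Ω) := by
    refine aestronglyMeasurable_of_tendsto_ae atTop
      (f := fun (n : ℕ) x => ((n : ℝ) + 1) •
        (α x (val p x + ((n : ℝ) + 1)⁻¹) - α x (val p x))) (fun n => ?_) ?_
    · have h1 := hα.aestronglyMeasurable_comp hΩ
        (hp.add (aestronglyMeasurable_const (b := ((n : ℝ) + 1)⁻¹)))
      exact (h1.sub (hα.aestronglyMeasurable_comp hΩ hp)).const_smul ((n : ℝ) + 1)
    · filter_upwards [ae_restrict_mem hΩ.measurableSet] with x hx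
      have h1 := ((hd x hx).1 (val p x)).hasDerivAt.tendsto_slope_zero
      have h2 : Tendsto (fun n : ℕ => ((n : ℝ) + 1)⁻¹) atTop (𝓝[≠] 0) := by
        refine tendsto_nhdsWithin_iff.2 ⟨?_, Eventually.of_forall fun n => ?_⟩
        · simpa using tendsto_one_div_add_atTop_nhds_zero_nat (𝕜 := ℝ)
        · have : (0 : ℝ) < (n : ℝ) + 1 := by positivity
          simp [this.ne']
      have h3 := h1.comp h2
      simpa [Function.comp_def] using h3
  exact (isBoundedBilinearMap_apply (𝕜 := ℝ)).continuous.comp_aestronglyMeasurable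
    (hder.prodMk (Lp.aestronglyMeasurable (grad p)))

/-! ### The linearized form -/

/-- The square of the seminorm `|v|₁` over `Ω ∩ S`. -/
noncomputable def energyOn (v : H10 Ω) (S : Set (Pt d)) : ℝ :=
  ∫ x in S, ‖grad v x‖ ^ 2 ∂(volume.restrict Ω)

/-- The square of the norm `‖v‖₀` over `Ω ∩ S`. -/
noncomputable def massOn (v : H10 Ω) (S : Set (Pt d)) : ℝ :=
  ∫ x in S, (val v x) ^ 2 ∂(volume.restrict Ω)

theorem energyOn_nonneg (v : H10 Ω) (S : Set (Pt d)) : 0 ≤ energyOn v S :=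
  integral_nonneg fun x => by positivity

theorem massOn_nonneg (v : H10 Ω) (S : Set (Pt d)) : 0 ≤ massOn v S :=
  integral_nonneg fun x => by positivity

theorem integrable_energy (v : H10 Ω) :
    Integrable (fun x => ‖grad v x‖ ^ 2) (volume.restrict Ω) :=
  integrable_norm_sq (Lp.memLp _)

theorem integrable_mass (v : H10 Ω) :
    Integrable (fun x => (val v x) ^ 2) (volume.restrict Ω) := by
  simpa using integrable_norm_sq (Lp.memLp (val v))

theorem energyOn_univ (v : H10 Ω) : energyOn v Set.univ = semi v ^ 2 := by
  rw [semi, norm_sq_eq_integral, energyOn, setIntegral_univ]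

theorem massOn_univ (v : H10 Ω) : massOn v Set.univ = ‖val v‖ ^ 2 := by
  rw [norm_sq_eq_integral, massOn, setIntegral_univ]
  simp

theorem val_add_ae (v w : H10 Ω) :
    ∀ᵐ x ∂(volume.restrict Ω), val (v + w) x = val v x + val w x :=
  Lp.coeFn_add (val v) (val w)

theorem grad_add_ae (v w : H10 Ω) :
    ∀ᵐ x ∂(volume.restrict Ω), grad (v + w) x = grad v x + grad w x :=
  Lp.coeFn_add (grad v) (grad w)

theorem val_sub_ae (v w : H10 Ω) :
    ∀ᵐ x ∂(volume.restrict Ω), val (v - w) x = val v x - val w x :=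
  Lp.coeFn_sub (val v) (val w)

theorem grad_sub_ae (v w : H10 Ω) :
    ∀ᵐ x ∂(volume.restrict Ω), grad (v - w) x = grad v x - grad w x :=
  Lp.coeFn_sub (grad v) (grad w)

theorem val_smul_ae (a : ℝ) (v : H10 Ω) :
    ∀ᵐ x ∂(volume.restrict Ω), val (a • v) x = a * val v x :=
  Lp.coeFn_smul a (val v)

theorem grad_smul_ae (a : ℝ) (v : H10 Ω) :
    ∀ᵐ x ∂(volume.restrict Ω), grad (a • v) x = a • grad v x :=
  Lp.coeFn_smul a (grad v)

theorem energyOn_sub_le (v w : H10 Ω) (S : Set (Pt d)) :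
    energyOn (v - w) S ≤ 2 * energyOn v S + 2 * energyOn w S := by
  rw [energyOn, energyOn, energyOn, ← integral_const_mul, ← integral_const_mul, ← integral_add
    ((integrable_energy v).restrict.const_mul 2) ((integrable_energy w).restrict.const_mul 2)]
  refine integral_mono_ae (integrable_energy _).restrict
    (((integrable_energy v).restrict.const_mul 2).add
      ((integrable_energy w).restrict.const_mul 2)) ?_
  filter_upwards [ae_restrict_of_ae (grad_sub_ae v w)] with x hx
  rw [hx]
  have h1 := norm_sub_le (grad v x) (grad w x)
  have h2 := norm_nonneg (grad v x - grad w x)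
  nlinarith [sq_nonneg (‖grad v x‖ - ‖grad w x‖)]

theorem semi_nonneg (v : H10 Ω) : 0 ≤ semi v := norm_nonneg _

theorem semi_add_le (v w : H10 Ω) : semi (v + w) ≤ semi v + semi w :=
  norm_add_le (grad v) (grad w)

theorem semi_smul (a : ℝ) (v : H10 Ω) : semi (a • v) = |a| * semi v :=
  norm_smul a (grad v)

theorem eq_zero_of_semi_eq_zero (hd : 1 ≤ d) (hΩb : Bornology.IsBounded Ω) {v : H10 Ω}
    (hv : semi v = 0) : v = 0 := by
  obtain ⟨R, hR⟩ := hΩb.exists_norm_le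
  have h := friedrichs hd hR v
  rw [hv, mul_zero] at h
  have h1 : val v = 0 := norm_le_zero_iff.1 h
  have h2 : grad v = 0 := norm_eq_zero.1 hv
  have : v.1 = 0 := by
    rw [← WithLp.toLp_ofLp (p := 2) v.1]
    have : (WithLp.ofLp v.1) = (0, 0) := Prod.ext h1 h2
    rw [this]; rfl
  exact Subtype.ext this

/-- The data of a linearized flux with bounded coefficients. -/
structure BoundedFlux (l : Linearization) (α : Coeff d) (p : H10 Ω) (Lam1 Cp : ℝ) : Prop where
  measurable_coeff : AEStronglyMeasurable (fun x => α x (val p x)) (volume.restrict Ω)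
  bound_coeff : ∀ᵐ x ∂(volume.restrict Ω), ∀ ψ, ‖α x (val p x) ψ‖ ≤ Lam1 * ‖ψ‖
  measurable_drift : AEStronglyMeasurable (drift l α p) (volume.restrict Ω)
  bound_drift : ∀ᵐ x ∂(volume.restrict Ω), ‖drift l α p x‖ ≤ Cp

theorem CoeffAssumption.boundedFlux_kacanov (hΩ : IsOpen Ω) {lam Lam0 Lam1 : ℝ} {α : Coeff d}
    (hα : CoeffAssumption Ω lam Lam0 Lam1 α) (p : H10 Ω) :
    BoundedFlux .kacanov α p Lam1 0 where
  measurable_coeff := hα.aestronglyMeasurable_comp hΩ (Lp.aestronglyMeasurable _)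
  bound_coeff := by
    filter_upwards [ae_restrict_mem hΩ.measurableSet] with x hx using hα.bounded x hx _
  measurable_drift := aestronglyMeasurable_const
  bound_drift := Eventually.of_forall fun x => by simp [drift]

theorem CoeffAssumption.boundedFlux_frechet (hΩ : IsOpen Ω) {lam Lam0 Lam1 : ℝ} {α : Coeff d}
    (hα : CoeffAssumption Ω lam Lam0 Lam1 α) (hd : TwiceDifferentiable Ω α) (p : H10 Ω) {Cp : ℝ}
    (hp : ∀ᵐ x ∂(volume.restrict Ω), ‖deriv (α x) (val p x) (grad p x)‖ ≤ Cp) :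
    BoundedFlux .frechet α p Lam1 Cp where
  measurable_coeff := hα.aestronglyMeasurable_comp hΩ (Lp.aestronglyMeasurable _)
  bound_coeff := by
    filter_upwards [ae_restrict_mem hΩ.measurableSet] with x hx using hα.bounded x hx _
  measurable_drift := hα.aestronglyMeasurable_drift hΩ hd p
  bound_drift := hp

namespace BoundedFlux

variable {l : Linearization} {α : Coeff d} {p : H10 Ω} {Lam1 Cp : ℝ}

theorem norm_linFlux_sq_le (h : BoundedFlux l α p Lam1 Cp) (v : H10 Ω) :
    ∀ᵐ x ∂(volume.restrict Ω), ‖linFlux l α p v x‖ ^ 2 ≤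
      2 * (Lam1 ^ 2 + Cp ^ 2) * (‖grad v x‖ ^ 2 + (val v x) ^ 2) := by
  filter_upwards [h.bound_coeff, h.bound_drift] with x h1 h2
  have a1 := h1 (grad v x)
  have a2 : ‖val v x • drift l α p x‖ ≤ Cp * |val v x| := by
    rw [norm_smul, mul_comm, Real.norm_eq_abs]
    gcongr
  have a3 : ‖linFlux l α p v x‖ ≤ Lam1 * ‖grad v x‖ + Cp * |val v x| :=
    (norm_add_le _ _).trans (add_le_add a1 a2)
  have a4 : ‖linFlux l α p v x‖ ^ 2 ≤ (Lam1 * ‖grad v x‖ + Cp * |val v x|) ^ 2 := by gcongr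
  refine a4.trans ?_
  rw [← sq_abs (val v x)]
  have b1 : (Lam1 * ‖grad v x‖ + Cp * |val v x|) ^ 2 ≤
      2 * (Lam1 * ‖grad v x‖) ^ 2 + 2 * (Cp * |val v x|) ^ 2 := by
    nlinarith [sq_nonneg (Lam1 * ‖grad v x‖ - Cp * |val v x|)]
  have b2 : 0 ≤ (Lam1 * |val v x|) ^ 2 := sq_nonneg _
  have b3 : 0 ≤ (Cp * ‖grad v x‖) ^ 2 := sq_nonneg _
  nlinarith

theorem memLp_linFlux (h : BoundedFlux l α p Lam1 Cp) (v : H10 Ω) :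
    MemLp (linFlux l α p v) 2 (volume.restrict Ω) := by
  have hm : AEStronglyMeasurable (linFlux l α p v) (volume.restrict Ω) :=
    ((isBoundedBilinearMap_apply (𝕜 := ℝ)).continuous.comp_aestronglyMeasurable
      (h.measurable_coeff.prodMk (Lp.aestronglyMeasurable (grad v)))).add
      ((Lp.aestronglyMeasurable (val v)).smul h.measurable_drift)
  rw [memLp_two_iff_integrable_sq_norm hm]
  refine (((integrable_energy v).add (integrable_mass v)).const_mul
    (2 * (Lam1 ^ 2 + Cp ^ 2))).mono (hm.norm.pow 2) ?_
  filter_upwards [h.norm_linFlux_sq_le v] with x hx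
  rw [Real.norm_of_nonneg (by positivity)]
  exact hx.trans (le_abs_self _)

theorem integrable_inner (h : BoundedFlux l α p Lam1 Cp) (v w : H10 Ω) :
    Integrable (fun x => inner ℝ (linFlux l α p v x) (grad w x)) (volume.restrict Ω) :=
  integrable_inner_of_memLp (h.memLp_linFlux v) (Lp.memLp _)

theorem linFlux_add (v v' : H10 Ω) : ∀ᵐ x ∂(volume.restrict Ω),
    linFlux l α p (v + v') x = linFlux l α p v x + linFlux l α p v' x := by
  filter_upwards [val_add_ae v v', grad_add_ae v v'] with x h1 h2
  simp only [linFlux, h1, h2, map_add, add_smul]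
  abel

theorem linFlux_smul (a : ℝ) (v : H10 Ω) : ∀ᵐ x ∂(volume.restrict Ω),
    linFlux l α p (a • v) x = a • linFlux l α p v x := by
  filter_upwards [val_smul_ae a v, grad_smul_ae a v] with x h1 h2
  simp only [linFlux, h1, h2, map_smul, mul_smul, smul_add]

/-- The linearized form as a bilinear map. -/
noncomputable def bilin (h : BoundedFlux l α p Lam1 Cp) (S : Set (Pt d)) :
    H10 Ω →ₗ[ℝ] H10 Ω →ₗ[ℝ] ℝ :=
  LinearMap.mk₂ ℝ (linForm l α p S)
    (by
      intro v v' w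
      rw [linForm, linForm, linForm, ← integral_add (h.integrable_inner v w).restrict
        (h.integrable_inner v' w).restrict]
      refine integral_congr_ae (ae_restrict_of_ae ?_)
      filter_upwards [linFlux_add (l := l) (α := α) (p := p) v v'] with x hx
      rw [hx, inner_add_left])
    (by
      intro a v w
      rw [linForm, linForm, smul_eq_mul, ← integral_const_mul]
      refine integral_congr_ae (ae_restrict_of_ae ?_)
      filter_upwards [linFlux_smul (l := l) (α := α) (p := p) a v] with x hx
      rw [hx, real_inner_smul_left])
    (by
      intro v w w'
      rw [linForm, linForm, linForm, ← integral_add (h.integrable_inner v w).restrict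
        (h.integrable_inner v w').restrict]
      refine integral_congr_ae (ae_restrict_of_ae ?_)
      filter_upwards [grad_add_ae w w'] with x hx
      rw [hx, inner_add_right])
    (by
      intro a v w
      rw [linForm, linForm, smul_eq_mul, ← integral_const_mul]
      refine integral_congr_ae (ae_restrict_of_ae ?_)
      filter_upwards [grad_smul_ae a w] with x hx
      rw [hx, real_inner_smul_right])

theorem bilin_apply (h : BoundedFlux l α p Lam1 Cp) (S : Set (Pt d)) (v w : H10 Ω) :
    h.bilin S v w = linForm l α p S v w := rfl

theorem abs_linForm_le (h : BoundedFlux l α p Lam1 Cp) (S : Set (Pt d)) (v w : H10 Ω) :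
    |linForm l α p S v w| ≤ Real.sqrt (2 * (Lam1 ^ 2 + Cp ^ 2)) *
      (Real.sqrt (energyOn v S + massOn v S) * Real.sqrt (energyOn w S)) := by
  refine (abs_integral_inner_le ((h.memLp_linFlux v).restrict S)
    ((Lp.memLp (grad w)).restrict S)).trans ?_
  have key : ∫ x in S, ‖linFlux l α p v x‖ ^ 2 ∂(volume.restrict Ω) ≤
      2 * (Lam1 ^ 2 + Cp ^ 2) * (energyOn v S + massOn v S) := by
    rw [energyOn, massOn, ← integral_add (integrable_energy v).restrict
      (integrable_mass v).restrict, ← integral_const_mul]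
    refine integral_mono_ae (integrable_norm_sq ((h.memLp_linFlux v).restrict S))
      (((integrable_energy v).add (integrable_mass v)).const_mul _).restrict ?_
    exact ae_restrict_of_ae (h.norm_linFlux_sq_le v)
  rw [← mul_assoc, ← Real.sqrt_mul (by positivity) (energyOn v S + massOn v S)]
  exact mul_le_mul_of_nonneg_right (Real.sqrt_le_sqrt key) (Real.sqrt_nonneg _)

end BoundedFlux

/-- The part of the form outside of the support of the test function vanishes. -/
theorem linForm_eq_univ_of_grad {l : Linearization} {α : Coeff d} {p : H10 Ω} {S : Set (Pt d)} (v w : H10 Ω)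
    (hw : ∀ᵐ x ∂(volume.restrict Ω), x ∉ S → grad w x = 0) :
    linForm l α p S v w = linForm l α p Set.univ v w := by
  rw [linForm, linForm, setIntegral_univ]
  refine setIntegral_eq_integral_of_ae_compl_eq_zero ?_
  filter_upwards [hw] with x hx hxS
  rw [hx hxS, inner_zero_right]

/-- Freezing the nonlinear form at `q` gives a Kačanov form, so bilinearity, continuity and
coercivity need only be proved for linearized forms. -/
theorem form_eq_linForm (α : Coeff d) (q v w : H10 Ω) :
    form α q v w = linForm .kacanov α q Set.univ v w := by
  rw [form, linForm, setIntegral_univ]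
  simp [linFlux, drift]

end

section

open Filter Topology
open scoped NNReal ENNReal

variable {d : ℕ} {Ω : Set (Pt d)}

/-! ### Elements -/

theorem continuous_affineInterp (c : Fin (d + 1) → Pt d) : Continuous (affineInterp c) := by
  unfold affineInterp
  fun_prop

theorem continuous_cubeInterp (c : (Fin d → Bool) → Pt d) : Continuous (cubeInterp c) := by
  unfold cubeInterp
  refine continuous_finsetSum _ fun b _ => ?_
  have h : Continuous fun t : Pt d => ∏ i, (if b i then t i else 1 - t i) := by
    refine continuous_finsetProd _ fun i _ => ?_
    split_ifs <;> fun_prop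
  exact h.smul continuous_const

theorem Cell.continuous_param (K : Cell d) : Continuous K.param := by
  cases K with
  | simplex P => exact continuous_affineInterp P
  | quad P => exact continuous_cubeInterp P

theorem isCompact_unitCube : IsCompact {t : Pt d | ∀ i, 0 ≤ t i ∧ t i ≤ 1} := by
  have h : IsCompact (Set.Icc (0 : Fin d → ℝ) 1) := isCompact_Icc
  convert h.image (PiLp.continuous_toLp 2 (fun _ : Fin d => ℝ)) using 1
  ext t
  constructor
  · intro ht
    exact ⟨WithLp.ofLp t, ⟨fun i => (ht i).1, fun i => (ht i).2⟩, rfl⟩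
  · rintro ⟨s, hs, rfl⟩ i
    exact ⟨hs.1 i, hs.2 i⟩

theorem Cell.isCompact_ref (K : Cell d) : IsCompact K.ref := by
  cases K with
  | quad P => exact isCompact_unitCube
  | simplex P =>
    refine isCompact_unitCube.of_isClosed_subset ?_ ?_
    · have e : (Cell.simplex P).ref = (⋂ i, {t : Pt d | 0 ≤ t i}) ∩ {t : Pt d | ∑ i, t i ≤ 1} := by
        ext t; simp [Cell.ref]
      rw [e]
      refine (isClosed_iInter fun i => isClosed_le (by fun_prop) (by fun_prop)).inter
        (isClosed_le (by fun_prop) (by fun_prop))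
    · intro t ht i
      exact ⟨ht.1 i, (Finset.single_le_sum (fun j _ => ht.1 j) (Finset.mem_univ i)).trans ht.2⟩

theorem Cell.isCompact_toSet (K : Cell d) : IsCompact K.toSet :=
  K.isCompact_ref.image K.continuous_param

/-- One open cube fits into both reference elements, so the volume bound needs no distinction
between simplices and quadrilaterals. -/
theorem Cell.core_subset_ref (K : Cell d) :
    {t : Pt d | ∀ i, 0 < t i ∧ t i < 1 / ((d : ℝ) + 1)} ⊆ K.ref := by
  intro t ht
  have hd : (0 : ℝ) < (d : ℝ) + 1 := by positivity
  cases K with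
  | quad P =>
    intro i
    refine ⟨(ht i).1.le, (ht i).2.le.trans ?_⟩
    rw [div_le_one hd]
    linarith [(Nat.cast_nonneg d : (0 : ℝ) ≤ d)]
  | simplex P =>
    refine ⟨fun i => (ht i).1.le, ?_⟩
    calc ∑ i, t i ≤ ∑ _i : Fin d, 1 / ((d : ℝ) + 1) :=
          Finset.sum_le_sum fun i _ => (ht i).2.le
      _ = d / ((d : ℝ) + 1) := by simp [div_eq_mul_inv]
      _ ≤ 1 := by rw [div_le_one hd]; linarith

theorem isOpen_core : IsOpen {t : Pt d | ∀ i, 0 < t i ∧ t i < 1 / ((d : ℝ) + 1)} := by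
  have e : {t : Pt d | ∀ i, 0 < t i ∧ t i < 1 / ((d : ℝ) + 1)} =
      ⋂ i, ({t : Pt d | 0 < t i} ∩ {t : Pt d | t i < 1 / ((d : ℝ) + 1)}) := by
    ext t; simp
  rw [e]
  exact isOpen_iInter_of_finite fun i => (isOpen_lt (by fun_prop) (by fun_prop)).inter
    (isOpen_lt (by fun_prop) (by fun_prop))

theorem core_nonempty : {t : Pt d | ∀ i, 0 < t i ∧ t i < 1 / ((d : ℝ) + 1)}.Nonempty := by
  refine ⟨WithLp.toLp 2 fun _ => 1 / (2 * ((d : ℝ) + 1)), fun i => ?_⟩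
  have hd : (0 : ℝ) < (d : ℝ) + 1 := by positivity
  refine ⟨by simp only; positivity, ?_⟩
  simp only
  exact one_div_lt_one_div_of_lt hd (by linarith)

theorem Cell.toSet_nonempty (K : Cell d) : K.toSet.Nonempty :=
  (core_nonempty.mono K.core_subset_ref).image _

/-- Shape-regular elements have volume comparable to a power of the diameter. -/
theorem exists_volume_lower_bound (d : ℕ) {γ : ℝ} (hγ : 0 < γ) :
    ∃ c : ℝ, 0 < c ∧ ∀ K : Cell d, K.ShapeRegular γ →
      c * K.diam ^ d ≤ (volume K.toSet).toReal := by
  set U : Set (Pt d) := {t : Pt d | ∀ i, 0 < t i ∧ t i < 1 / ((d : ℝ) + 1)} with hU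
  -- The inverse parametrization is Lipschitz with constant `γ / K.diam` and maps the element onto a
  -- set containing the core `U`. Hausdorff measure controls Lipschitz images; it is a multiple `s`
  -- of Lebesgue measure, and `s` cancels.
  have hUpos : 0 < Measure.hausdorffMeasure (d : ℝ) U :=
    isOpen_core.measure_pos _ core_nonempty
  obtain ⟨s, hs⟩ : ∃ s : ℝ≥0, (Measure.hausdorffMeasure (d : ℝ) : Measure (Pt d)) = s • volume :=
    ⟨_, Measure.isAddLeftInvariant_eq_smul _ _⟩
  have hUv : Measure.hausdorffMeasure (d : ℝ) U = s * volume U := by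
    rw [hs, Measure.smul_apply, ENNReal.smul_def, smul_eq_mul]
  have hs0 : s ≠ 0 := by
    rintro rfl
    simp [hUv] at hUpos
  have hvU : volume U ≠ 0 := fun h => by simp [hUv, h] at hUpos
  have hUb : Bornology.IsBounded U := by
    refine isCompact_unitCube.isBounded.subset ?_
    exact (Cell.quad (fun _ => (0 : Pt d))).core_subset_ref
  have hvU' : volume U ≠ ⊤ := hUb.measure_lt_top.ne
  have hpos : 0 < (volume U).toReal := ENNReal.toReal_pos hvU hvU'
  refine ⟨(volume U).toReal / γ ^ d, by positivity, fun K hK => ?_⟩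
  obtain ⟨hdiam, hreg⟩ := hK
  have hinj : Set.InjOn K.param K.ref := by
    intro a ha b hb hab
    have := (hreg a ha b hb).2
    rw [hab, sub_self, norm_zero, mul_zero] at this
    have h0 : ‖a - b‖ ≤ 0 := by
      by_contra hcon
      push Not at hcon
      exact absurd this (not_le.2 (mul_pos hdiam hcon))
    exact sub_eq_zero.1 (norm_le_zero_iff.1 h0)
  have hlip : LipschitzOnWith (Real.toNNReal (γ / K.diam)) (Function.invFunOn K.param K.ref)
      K.toSet := by
    refine LipschitzOnWith.of_dist_le_mul ?_
    rintro _ ⟨a, ha, rfl⟩ _ ⟨b, hb, rfl⟩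
    rw [hinj.leftInvOn_invFunOn ha, hinj.leftInvOn_invFunOn hb, dist_eq_norm, dist_eq_norm,
      Real.coe_toNNReal _ (by positivity), div_mul_eq_mul_div, le_div_iff₀ hdiam, mul_comm]
    exact (hreg a ha b hb).2
  have him : U ⊆ Function.invFunOn K.param K.ref '' K.toSet := by
    intro t ht
    have htr := K.core_subset_ref ht
    exact ⟨K.param t, ⟨t, htr, rfl⟩, hinj.leftInvOn_invFunOn htr⟩
  have h1 := (measure_mono him).trans
    (hlip.hausdorffMeasure_image_le (d := (d : ℝ)) (Nat.cast_nonneg d))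
  rw [hs, Measure.smul_apply, Measure.smul_apply, ENNReal.smul_def, smul_eq_mul,
    ENNReal.smul_def, smul_eq_mul, ENNReal.rpow_natCast, mul_left_comm] at h1
  have h2 : volume U ≤ (Real.toNNReal (γ / K.diam) : ℝ≥0∞) ^ d * volume K.toSet :=
    (ENNReal.mul_le_mul_iff_right (by simpa using hs0) ENNReal.coe_ne_top).1 h1
  have h3 := ENNReal.toReal_mono (ENNReal.mul_ne_top (by finiteness)
    K.isCompact_toSet.measure_lt_top.ne) h2
  rw [ENNReal.toReal_mul, ENNReal.toReal_pow, ENNReal.coe_toReal,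
    Real.coe_toNNReal _ (by positivity), div_pow, div_mul_eq_mul_div,
    le_div_iff₀ (by positivity)] at h3
  rw [div_mul_eq_mul_div, div_le_iff₀ (by positivity)]
  linarith

/-! ### Layers of a mesh -/

namespace Mesh

open Classical in
/-- The elements of the `k`-layer patch of `K`. -/
noncomputable def layer (T : Mesh Ω) : ℕ → Cell d → Finset (Cell d)
  | 0, K => {K}
  | k + 1, K => T.cells.filter fun K' => ∃ K'' ∈ T.layer k K, (K'.toSet ∩ K''.toSet).Nonempty

/-- Links the patches, which are point sets, to finite families of elements, on which all counting
and summation takes place. -/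
theorem patch_eq (T : Mesh Ω) (k : ℕ) (K : Cell d) :
    T.patch k K = ⋃ K' ∈ T.layer k K, K'.toSet := by
  induction k with
  | zero => simp [patch, layer]
  | succ k ih =>
    ext x
    simp only [patch, layer, Set.mem_iUnion, Finset.mem_filter, ih, exists_prop]
    refine exists_congr fun K' => and_congr_left fun _ => and_congr_right fun _ => ?_
    constructor
    · rintro ⟨y, hy, hy'⟩
      simp only [Set.mem_iUnion, exists_prop] at hy'
      obtain ⟨K'', hK'', hy''⟩ := hy'
      exact ⟨K'', hK'', y, hy, hy''⟩
    · rintro ⟨K'', hK'', y, hy, hy'⟩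
      refine ⟨y, hy, ?_⟩
      simp only [Set.mem_iUnion, exists_prop]
      exact ⟨K'', hK'', hy'⟩

theorem mem_layer_succ {T : Mesh Ω} {k : ℕ} {K K' : Cell d} :
    K' ∈ T.layer (k + 1) K ↔
      K' ∈ T.cells ∧ ∃ K'' ∈ T.layer k K, (K'.toSet ∩ K''.toSet).Nonempty := by
  simp [layer]

theorem mem_layer_one {T : Mesh Ω} {K K' : Cell d} :
    K' ∈ T.layer 1 K ↔ K' ∈ T.cells ∧ (K'.toSet ∩ K.toSet).Nonempty := by
  rw [mem_layer_succ]
  simp [layer]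

theorem layer_subset {T : Mesh Ω} {K : Cell d} (hK : K ∈ T.cells) (k : ℕ) :
    T.layer k K ⊆ T.cells := by
  cases k with
  | zero => simpa [layer] using hK
  | succ k => exact fun K' hK' => (mem_layer_succ.1 hK').1

theorem layer_subset_succ {T : Mesh Ω} {K : Cell d} (hK : K ∈ T.cells) (k : ℕ) :
    T.layer k K ⊆ T.layer (k + 1) K := by
  intro K' hK'
  exact mem_layer_succ.2 ⟨layer_subset hK k hK', K', hK', by simpa using K'.toSet_nonempty⟩

theorem layer_mono {T : Mesh Ω} {K : Cell d} (hK : K ∈ T.cells) {i j : ℕ} (h : i ≤ j) :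
    T.layer i K ⊆ T.layer j K :=
  monotone_nat_of_le_succ (f := fun k => T.layer k K) (layer_subset_succ hK) h

theorem self_mem_layer {T : Mesh Ω} {K : Cell d} (hK : K ∈ T.cells) (k : ℕ) : K ∈ T.layer k K :=
  layer_mono hK (Nat.zero_le k) (by simp [layer])

theorem mem_layer_one_symm {T : Mesh Ω} {K K' : Cell d} (hK : K ∈ T.cells)
    (h : K' ∈ T.layer 1 K) : K ∈ T.layer 1 K' := by
  rw [mem_layer_one] at h ⊢
  exact ⟨hK, by rw [Set.inter_comm]; exact h.2⟩

theorem layer_one_subset {T : Mesh Ω} {K K' : Cell d} {k : ℕ} (h : K' ∈ T.layer k K) :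
    T.layer 1 K' ⊆ T.layer (k + 1) K := by
  intro K'' hK''
  rw [mem_layer_one] at hK''
  exact mem_layer_succ.2 ⟨hK''.1, K', h, hK''.2⟩

/-- A chain of elements may equally be extended at its starting end; this is what makes the layer
relation symmetric. -/
theorem mem_layer_succ' {T : Mesh Ω} {K K' : Cell d} {k : ℕ} :
    K' ∈ T.layer (k + 1) K ↔ ∃ K'' ∈ T.layer 1 K, K' ∈ T.layer k K'' := by
  induction k generalizing K' with
  | zero => simp [layer]
  | succ k ih =>
    rw [mem_layer_succ]
    constructor
    · rintro ⟨h1, K3, h3, h4⟩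
      obtain ⟨K2, h5, h6⟩ := ih.1 h3
      exact ⟨K2, h5, mem_layer_succ.2 ⟨h1, K3, h6, h4⟩⟩
    · rintro ⟨K2, h1, h2⟩
      obtain ⟨h3, K3, h4, h5⟩ := mem_layer_succ.1 h2
      exact ⟨h3, K3, ih.2 ⟨K2, h1, h4⟩, h5⟩

theorem mem_layer_symm {T : Mesh Ω} {K K' : Cell d} (hK : K ∈ T.cells) {k : ℕ}
    (h : K' ∈ T.layer k K) : K ∈ T.layer k K' := by
  induction k generalizing K K' with
  | zero => simpa [layer, eq_comm] using h
  | succ k ih =>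
    obtain ⟨h1, K2, h2, h3⟩ := mem_layer_succ.1 h
    refine mem_layer_succ'.2 ⟨K2, ?_, ih hK h2⟩
    exact mem_layer_one.2 ⟨layer_subset hK k h2, by rwa [Set.inter_comm]⟩

theorem diam_le_size {T : Mesh Ω} {K : Cell d} (hK : K ∈ T.cells) : K.diam ≤ T.size :=
  le_ciSup (f := fun K : T.cells => K.1.diam) (Set.finite_range _).bddAbove ⟨K, hK⟩

theorem toSet_subset_closure {T : Mesh Ω} {K : Cell d} (hK : K ∈ T.cells) :
    K.toSet ⊆ closure Ω := by
  rw [← T.cover]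
  exact Set.subset_biUnion_of_mem (u := fun K : Cell d => K.toSet) hK

theorem size_nonneg (T : Mesh Ω) : 0 ≤ T.size := Real.iSup_nonneg fun _ => Metric.diam_nonneg

/-- Allows constants containing `H` to be replaced by constants of `Ω`. -/
theorem size_le (hΩb : Bornology.IsBounded Ω) (T : Mesh Ω) : T.size ≤ Metric.diam (closure Ω) :=
  Real.iSup_le (fun K => Metric.diam_mono (toSet_subset_closure K.2) hΩb.closure)
    Metric.diam_nonneg

theorem Regular.size_pos {T : Mesh Ω} {γ : ℝ} (hT : T.Regular γ) {K : Cell d} (hK : K ∈ T.cells) :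
    0 < T.size :=
  (hT K hK).1.1.trans_le (diam_le_size hK)

theorem isClosed_patch (T : Mesh Ω) (k : ℕ) (K : Cell d) : IsClosed (T.patch k K) := by
  rw [patch_eq]
  exact (T.layer k K).finite_toSet.isClosed_biUnion fun K' _ => K'.isCompact_toSet.isClosed

theorem dist_le_size {T : Mesh Ω} {K : Cell d} (hK : K ∈ T.cells) {x y : Pt d} (hx : x ∈ K.toSet)
    (hy : y ∈ K.toSet) : dist x y ≤ T.size :=
  (Metric.dist_le_diam_of_mem K.isCompact_toSet.isBounded hx hy).trans (diam_le_size hK)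

theorem pairwise_aedisjoint (T : Mesh Ω) {𝒮 : Finset (Cell d)} (h𝒮 : 𝒮 ⊆ T.cells) :
    (𝒮 : Set (Cell d)).Pairwise (Function.onFun (AEDisjoint volume) fun K => K.toSet) :=
  fun K hK K' hK' hne => T.nonoverlapping K (h𝒮 hK) K' (h𝒮 hK') hne

end Mesh

/-! ### Packing of elements near a point -/

open Classical in
/-- In a regular mesh, the number of elements near a point is bounded. -/
theorem exists_card_le (d : ℕ) {γ : ℝ} (hγ : 0 < γ) :
    ∃ M : ℕ, ∀ (Ω : Set (Pt d)) (T : Mesh Ω), T.Regular γ → ∀ a : Pt d,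
      (T.cells.filter fun K => (K.toSet ∩ Metric.closedBall a T.size).Nonempty).card ≤ M := by
  obtain ⟨c, hc, hvol⟩ := exists_volume_lower_bound d hγ
  set b : ℝ := (volume (Metric.ball (0 : Pt d) 1)).toReal with hb
  refine ⟨⌈2 ^ d * b * γ ^ d / c⌉₊, fun Ω T hT a => ?_⟩
  set 𝒮 := T.cells.filter fun K => (K.toSet ∩ Metric.closedBall a T.size).Nonempty with h𝒮
  rcases 𝒮.eq_empty_or_nonempty with he | ⟨K0, hK0⟩
  · simp [he]
  have hsub : 𝒮 ⊆ T.cells := Finset.filter_subset _ _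
  have hH : 0 < T.size := hT.size_pos (hsub hK0)
  -- The elements have diameter at most `H`, so they lie in a ball of radius `2H`. Their volumes are
  -- at least of order `H ^ d` and add up, which bounds their number independently of `H`.
  have hball : (⋃ K ∈ 𝒮, K.toSet) ⊆ Metric.closedBall a (2 * T.size) := by
    intro x hx
    simp only [Set.mem_iUnion, exists_prop] at hx
    obtain ⟨K, hK, hxK⟩ := hx
    obtain ⟨hK1, y, hy, hya⟩ := Finset.mem_filter.1 hK
    have h1 := Mesh.dist_le_size hK1 hxK hy
    have h2 := Metric.mem_closedBall.1 hya
    rw [Metric.mem_closedBall]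
    linarith [dist_triangle x y a]
  have h1 := measure_mono (μ := volume) hball
  rw [measure_biUnion_finset₀ (T.pairwise_aedisjoint hsub)
    (fun K _ => K.isCompact_toSet.measurableSet.nullMeasurableSet),
    Measure.addHaar_closedBall _ _ (by positivity), finrank_euclideanSpace_fin] at h1
  have h2 := ENNReal.toReal_mono (by finiteness) h1
  rw [ENNReal.toReal_sum fun K _ => K.isCompact_toSet.measure_lt_top.ne, ENNReal.toReal_mul,
    ENNReal.toReal_ofReal (by positivity), ← hb] at h2
  have h3 : ∀ K ∈ 𝒮, c * (T.size / γ) ^ d ≤ (volume K.toSet).toReal := by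
    intro K hK
    obtain ⟨hr, hs⟩ := hT K (hsub hK)
    refine le_trans ?_ (hvol K hr)
    have : T.size / γ ≤ K.diam := by rw [div_le_iff₀ hγ]; linarith
    gcongr
  have h4 := (Finset.card_nsmul_le_sum 𝒮 _ _ h3).trans h2
  rw [nsmul_eq_mul, div_pow, mul_pow] at h4
  have h5 : (𝒮.card : ℝ) ≤ 2 ^ d * b * γ ^ d / c := by
    rw [le_div_iff₀ hc]
    have hp : 0 < T.size ^ d := by positivity
    have hg : 0 < γ ^ d := by positivity
    have e : (𝒮.card : ℝ) * (c * (T.size ^ d / γ ^ d)) = 𝒮.card * c * T.size ^ d / γ ^ d := by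
      ring
    rw [e, div_le_iff₀ hg] at h4
    refine le_of_mul_le_mul_right ?_ hp
    linarith
  exact_mod_cast h5.trans (Nat.le_ceil _)

/-! ### Cut-off functions from path lengths -/

/-- `x` is reached from `A` by a polygonal path of length `r` inside `Ω`. -/
inductive Reach (Ω A : Set (Pt d)) : Pt d → ℝ → Prop
  | base {x : Pt d} (hx : x ∈ Ω) (hA : x ∈ A) : Reach Ω A x 0
  | step {x y : Pt d} {r : ℝ} (h : Reach Ω A x r) (hs : segment ℝ x y ⊆ Ω) :
      Reach Ω A y (r + ‖x - y‖)

theorem Reach.nonneg {A : Set (Pt d)} {x : Pt d} {r : ℝ} (h : Reach Ω A x r) : 0 ≤ r := by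
  induction h with
  | base => exact le_rfl
  | step _ _ ih => positivity

/-- The set is the trace of the path: connected, inside `Ω`, and no farther from its starting point
than the length of the path. -/
theorem Reach.exists_isPreconnected {A : Set (Pt d)} {x : Pt d} {r : ℝ} (h : Reach Ω A x r) :
    ∃ a ∈ A, ∃ C : Set (Pt d), IsPreconnected C ∧ C ⊆ Ω ∧ C ⊆ Metric.closedBall a r ∧ a ∈ C ∧
      x ∈ C := by
  induction h with
  | @base x hx hA =>
    exact ⟨x, hA, {x}, isPreconnected_singleton, by simpa using hx, by simp, rfl, rfl⟩
  | @step x y r h hs ih =>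
    obtain ⟨a, ha, C, h1, h2, h3, h4, h5⟩ := ih
    refine ⟨a, ha, C ∪ segment ℝ x y, h1.union x h5 (left_mem_segment ℝ x y)
      (convex_segment x y).isPreconnected, Set.union_subset h2 hs, Set.union_subset ?_ ?_,
      Or.inl h4, Or.inr (right_mem_segment ℝ x y)⟩
    · exact h3.trans (Metric.closedBall_subset_closedBall (by simp))
    · have hx := Metric.mem_closedBall.1 (h3 h5)
      refine (convex_closedBall a _).segment_subset ?_ ?_
      · rw [Metric.mem_closedBall]
        linarith [norm_nonneg (x - y)]
      · rw [Metric.mem_closedBall]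
        have : dist y x = ‖x - y‖ := by rw [dist_comm, dist_eq_norm]
        linarith [dist_triangle y x a]

/-- The distance to `A` inside `Ω`, truncated at `H`. -/
noncomputable def pathDist (Ω A : Set (Pt d)) (H : ℝ) (x : Pt d) : ℝ :=
  sInf (insert H {r | Reach Ω A x r})

section PathDist

variable {A : Set (Pt d)} {H : ℝ}

theorem bddBelow_pathDist (hH : 0 ≤ H) (x : Pt d) :
    BddBelow (insert H {r | Reach Ω A x r}) :=
  ⟨0, by rintro r (rfl | hr); exacts [hH, hr.nonneg]⟩

theorem pathDist_nonneg (hH : 0 ≤ H) (x : Pt d) : 0 ≤ pathDist Ω A H x :=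
  le_csInf ⟨H, Or.inl rfl⟩ (by rintro r (rfl | hr); exacts [hH, hr.nonneg])

theorem pathDist_le (hH : 0 ≤ H) (x : Pt d) : pathDist Ω A H x ≤ H :=
  csInf_le (bddBelow_pathDist hH x) (Or.inl rfl)

/-- A path to `x` is prolonged by the segment to `y`. This is the Lipschitz bound of the cut-off,
and it needs no regularity of `Ω`. -/
theorem pathDist_le_add (hH : 0 ≤ H) {x y : Pt d} (h : segment ℝ x y ⊆ Ω) :
    pathDist Ω A H y ≤ pathDist Ω A H x + ‖x - y‖ := by
  rw [← sub_le_iff_le_add]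
  refine le_csInf ⟨H, Or.inl rfl⟩ ?_
  rintro r (rfl | hr)
  · linarith [pathDist_le (Ω := Ω) (A := A) hH y, norm_nonneg (x - y)]
  · rw [sub_le_iff_le_add]
    exact csInf_le (bddBelow_pathDist hH y) (Or.inr (Reach.step hr h))

theorem pathDist_eq_zero (hH : 0 ≤ H) {x : Pt d} (hx : x ∈ Ω) (hA : x ∈ A) :
    pathDist Ω A H x = 0 :=
  le_antisymm (csInf_le (bddBelow_pathDist hH x) (Or.inr (Reach.base hx hA)))
    (pathDist_nonneg hH x)

theorem pathDist_eq (hH : 0 ≤ H) {x : Pt d} (h : ∀ r, Reach Ω A x r → H ≤ r) :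
    pathDist Ω A H x = H :=
  le_antisymm (pathDist_le hH x) (le_csInf ⟨H, Or.inl rfl⟩
    (by rintro r (rfl | hr); exacts [le_rfl, h r hr]))

end PathDist

/-- A small connected set that meets a patch is contained in a slightly larger patch. -/
theorem Mesh.subset_patch_of_isPreconnected {T : Mesh Ω} {M : ℕ} {a : Pt d}
    (hM : ∀ 𝒟 : Finset (Cell d), 𝒟 ⊆ T.cells →
      (∀ K ∈ 𝒟, (K.toSet ∩ Metric.closedBall a T.size).Nonempty) → 𝒟.card ≤ M)
    {K0 : Cell d} (hK0 : K0 ∈ T.cells) {j : ℕ} {C : Set (Pt d)} (hC : IsPreconnected C)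
    (hCΩ : C ⊆ Ω) (hCa : C ⊆ Metric.closedBall a T.size) (haC : a ∈ C)
    (ha : a ∈ T.patch j K0) : C ⊆ T.patch (j + M) K0 := by
  classical
  set 𝒟 := T.cells.filter fun K => (K.toSet ∩ C).Nonempty with h𝒟
  have h𝒟M : 𝒟.card ≤ M := hM 𝒟 (Finset.filter_subset _ _) fun K hK => by
    obtain ⟨y, hy, hyC⟩ := (Finset.mem_filter.1 hK).2
    exact ⟨y, hy, hCa hyC⟩
  have hmono : ∀ i, T.patch i K0 ⊆ T.patch (i + 1) K0 := by
    intro i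
    rw [patch_eq, patch_eq]
    exact Set.biUnion_subset_biUnion_left (layer_subset_succ hK0 i)
  have haj : ∀ i, a ∈ T.patch (j + i) K0 := by
    intro i
    induction i with
    | zero => exact ha
    | succ i ih => exact hmono _ ih
  by_contra hcon
  -- As long as `C` is not exhausted, each further layer contains a new element that meets `C`.
  -- After `M` layers this would be `M + 1` elements, more than the packing allows.
  have claim : ∀ i, ¬ C ⊆ T.patch (j + i) K0 → i + 1 ≤ (𝒟 ∩ T.layer (j + i) K0).card := by
    intro i
    induction i with
    | zero =>
      intro _
      rw [zero_add, Nat.one_le_iff_ne_zero, Finset.card_ne_zero]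
      have := haj 0
      rw [patch_eq] at this
      simp only [Set.mem_iUnion, exists_prop] at this
      obtain ⟨K, hK, haK⟩ := this
      exact ⟨K, Finset.mem_inter.2
        ⟨Finset.mem_filter.2 ⟨layer_subset hK0 _ hK, a, haK, haC⟩, hK⟩⟩
    | succ i ih =>
      intro hni
      have hni' : ¬ C ⊆ T.patch (j + i) K0 := fun h => hni (h.trans (hmono _))
      refine Nat.succ_le_of_lt ((ih hni').trans_lt (Finset.card_lt_card ?_))
      have hle : 𝒟 ∩ T.layer (j + i) K0 ⊆ 𝒟 ∩ T.layer (j + (i + 1)) K0 :=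
        Finset.inter_subset_inter_left (layer_subset_succ hK0 _)
      rw [Finset.ssubset_iff_of_subset hle]
      set Q : Set (Pt d) := ⋃ K ∈ 𝒟 \ T.layer (j + i) K0, K.toSet with hQ
      have hQc : IsClosed Q :=
        (𝒟 \ T.layer (j + i) K0).finite_toSet.isClosed_biUnion
          fun K _ => K.isCompact_toSet.isClosed
      have hcov : C ⊆ T.patch (j + i) K0 ∪ Q := by
        intro x hx
        have hx' : x ∈ closure Ω := subset_closure (hCΩ hx)
        rw [← T.cover] at hx'
        simp only [Set.mem_iUnion, exists_prop] at hx'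
        obtain ⟨K, hK, hxK⟩ := hx'
        by_cases hl : K ∈ T.layer (j + i) K0
        · left
          rw [patch_eq]
          exact Set.mem_biUnion hl hxK
        · right
          exact Set.mem_biUnion (Finset.mem_coe.2 (Finset.mem_sdiff.2
            ⟨Finset.mem_filter.2 ⟨hK, x, hxK, hx⟩, hl⟩)) hxK
      obtain ⟨x, hxC, hxP⟩ := Set.not_subset.1 hni'
      have hxQ : x ∈ Q := (hcov hxC).resolve_left hxP
      -- The patch and the union `Q` of the remaining elements are closed, cover the connected set
      -- `C` and both meet it. At a common point an element of `Q` touches the patch, so it belongs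
      -- to the next layer.
      obtain ⟨z, hzC, hzP, hzQ⟩ := isPreconnected_closed_iff.1 hC _ _ (T.isClosed_patch _ _) hQc
        hcov ⟨a, haC, haj i⟩ ⟨x, hxC, hxQ⟩
      simp only [hQ, Set.mem_iUnion, exists_prop] at hzQ
      obtain ⟨K, hK, hzK⟩ := hzQ
      rw [Finset.mem_sdiff] at hK
      rw [patch_eq] at hzP
      simp only [Set.mem_iUnion, exists_prop] at hzP
      obtain ⟨K', hK', hzK'⟩ := hzP
      refine ⟨K, Finset.mem_inter.2 ⟨hK.1, mem_layer_succ.2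
        ⟨(Finset.mem_filter.1 hK.1).1, K', hK', z, hzK, hzK'⟩⟩, fun h => hK.2 ?_⟩
      exact (Finset.mem_inter.1 h).2
  have h1 := (claim M hcon).trans (Finset.card_le_card Finset.inter_subset_left)
  omega

/-- Cut-off functions between patches. -/
theorem Mesh.Regular.exists_cutoff {T : Mesh Ω} {γ : ℝ} (hT : T.Regular γ) {M : ℕ}
    (hM : ∀ (a : Pt d) (𝒟 : Finset (Cell d)), 𝒟 ⊆ T.cells →
      (∀ K ∈ 𝒟, (K.toSet ∩ Metric.closedBall a T.size).Nonempty) → 𝒟.card ≤ M)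
    {K0 : Cell d} (hK0 : K0 ∈ T.cells) (j : ℕ) :
    ∃ χ : Pt d → ℝ, LipschitzAlong Ω T.size⁻¹ χ ∧ (∀ x, 0 ≤ χ x ∧ χ x ≤ 1) ∧
      (∀ x ∈ Ω, x ∈ T.patch j K0 → χ x = 1) ∧
      (∀ x ∈ Ω, x ∉ T.patch (j + M) K0 → χ x = 0) := by
  have hH := hT.size_pos hK0
  set H := T.size
  set A := T.patch j K0
  -- Path length is used because elements on the two sides of a thin gap in `Ω` can be close in
  -- `ℝ^d` while many layers apart.
  refine ⟨fun x => 1 - pathDist Ω A H x / H, fun x y hxy => ?_, fun x => ⟨?_, ?_⟩,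
    fun x hx hA => ?_, fun x hx hA => ?_⟩
  · have h1 := pathDist_le_add (A := A) hH.le hxy
    have h2 := pathDist_le_add (A := A) (x := y) (y := x) (Ω := Ω) hH.le (by rwa [segment_symm])
    rw [norm_sub_rev] at h2
    have e : 1 - pathDist Ω A H x / H - (1 - pathDist Ω A H y / H) =
        H⁻¹ * (pathDist Ω A H y - pathDist Ω A H x) := by ring
    simp only
    rw [e, abs_mul, abs_of_pos (inv_pos.2 hH)]
    have : |pathDist Ω A H y - pathDist Ω A H x| ≤ ‖x - y‖ := by
      rw [abs_le]; constructor <;> linarith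
    gcongr
  · have := (div_le_one hH).2 (pathDist_le (Ω := Ω) (A := A) hH.le x)
    linarith
  · have := div_nonneg (pathDist_nonneg (Ω := Ω) (A := A) hH.le x) hH.le
    linarith
  · simp only
    rw [pathDist_eq_zero hH.le hx hA]; simp
  · simp only
    rw [pathDist_eq hH.le, div_self hH.ne', sub_self]
    -- A path from the patch to `x` that is shorter than `H` would cross at most `M` layers,
    -- contrary to `x` lying outside the larger patch.
    intro r hr
    by_contra hcon
    push Not at hcon
    obtain ⟨a, ha, C, h1, h2, h3, h4, h5⟩ := hr.exists_isPreconnected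
    exact hA (Mesh.subset_patch_of_isPreconnected (hM a) hK0 h1 h2
      (h3.trans (Metric.closedBall_subset_closedBall hcon.le)) h4 ha h5)

end

section

open Filter Topology
open scoped NNReal ENNReal

variable {d : ℕ} {Ω : Set (Pt d)}

/-! ### Sums over the elements -/

namespace Mesh

theorem sum_setIntegral (T : Mesh Ω) {𝒮 : Finset (Cell d)} (h𝒮 : 𝒮 ⊆ T.cells) {f : Pt d → ℝ}
    (hf : Integrable f (volume.restrict Ω)) :
    ∑ K ∈ 𝒮, ∫ x in K.toSet, f x ∂(volume.restrict Ω) =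
      ∫ x in ⋃ K ∈ 𝒮, K.toSet, f x ∂(volume.restrict Ω) := by
  have e : (⋃ K ∈ 𝒮, K.toSet) = ⋃ K : (𝒮 : Set (Cell d)), K.1.toSet := by
    ext x
    simp
  rw [← Finset.sum_coe_sort 𝒮 (fun K => ∫ x in K.toSet, f x ∂(volume.restrict Ω)), e]
  have hd : Pairwise (Function.onFun (AEDisjoint (volume.restrict Ω))
      fun K : (𝒮 : Set (Cell d)) => K.1.toSet) := fun K K' hne =>
    Measure.restrict_le_self.absolutelyContinuous
      (T.pairwise_aedisjoint h𝒮 K.2 K'.2 fun h => hne (Subtype.ext h))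
  rw [integral_iUnion_ae (fun K => K.1.isCompact_toSet.measurableSet.nullMeasurableSet) hd
    hf.integrableOn, tsum_fintype]
  rfl

theorem sum_setIntegral_cells (T : Mesh Ω) (hΩ : IsOpen Ω) {f : Pt d → ℝ}
    (hf : Integrable f (volume.restrict Ω)) :
    ∑ K ∈ T.cells, ∫ x in K.toSet, f x ∂(volume.restrict Ω) = ∫ x in Ω, f x := by
  rw [T.sum_setIntegral Finset.Subset.rfl hf]
  refine setIntegral_eq_integral_of_ae_compl_eq_zero ?_
  filter_upwards [ae_restrict_mem hΩ.measurableSet] with x hx hx'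
  rw [T.cover] at hx'
  exact absurd (subset_closure hx) hx'

theorem sum_energyOn (T : Mesh Ω) (hΩ : IsOpen Ω) (v : H10 Ω) :
    ∑ K ∈ T.cells, energyOn v K.toSet = semi v ^ 2 := by
  rw [← energyOn_univ, energyOn, setIntegral_univ]
  exact T.sum_setIntegral_cells hΩ (integrable_energy v)

theorem sum_massOn (T : Mesh Ω) (hΩ : IsOpen Ω) (v : H10 Ω) :
    ∑ K ∈ T.cells, massOn v K.toSet = ‖val v‖ ^ 2 := by
  rw [← massOn_univ, massOn, setIntegral_univ]
  exact T.sum_setIntegral_cells hΩ (integrable_mass v)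

theorem sum_energyOn_le (T : Mesh Ω) (hΩ : IsOpen Ω) (v : H10 Ω) {𝒮 : Finset (Cell d)}
    (h𝒮 : 𝒮 ⊆ T.cells) : ∑ K ∈ 𝒮, energyOn v K.toSet ≤ semi v ^ 2 := by
  rw [← T.sum_energyOn hΩ]
  exact Finset.sum_le_sum_of_subset_of_nonneg h𝒮 fun K _ _ => energyOn_nonneg _ _

theorem energyOn_patch (T : Mesh Ω) {K : Cell d} (hK : K ∈ T.cells) (k : ℕ) (v : H10 Ω) :
    energyOn v (T.patch k K) = ∑ K' ∈ T.layer k K, energyOn v K'.toSet := by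
  rw [energyOn, patch_eq]
  exact (T.sum_setIntegral (layer_subset hK k) (integrable_energy v)).symm

/-- The number of elements near a point is at most `M`. -/
def IsPacked (T : Mesh Ω) (M : ℕ) : Prop :=
  ∀ (a : Pt d) (𝒟 : Finset (Cell d)), 𝒟 ⊆ T.cells →
    (∀ K ∈ 𝒟, (K.toSet ∩ Metric.closedBall a T.size).Nonempty) → 𝒟.card ≤ M

theorem exists_isPacked (d : ℕ) {γ : ℝ} (hγ : 0 < γ) :
    ∃ M : ℕ, ∀ (Ω : Set (Pt d)) (T : Mesh Ω), T.Regular γ → T.IsPacked M := by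
  classical
  obtain ⟨M, hM⟩ := exists_card_le d hγ
  refine ⟨M, fun Ω T hT a 𝒟 h𝒟 h => le_trans (Finset.card_le_card fun K hK => ?_) (hM Ω T hT a)⟩
  exact Finset.mem_filter.2 ⟨h𝒟 hK, h K hK⟩

/-- All neighbours of `K` meet the ball of radius `H` about any point of `K`. -/
theorem IsPacked.card_layer_one_le {T : Mesh Ω} {M : ℕ} (hM : T.IsPacked M) {K : Cell d}
    (hK : K ∈ T.cells) : (T.layer 1 K).card ≤ M := by
  obtain ⟨a, ha⟩ := K.toSet_nonempty
  refine hM a _ (layer_subset hK 1) fun K' hK' => ?_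
  obtain ⟨-, y, hy, hy'⟩ := mem_layer_one.1 hK'
  exact ⟨y, hy, dist_le_size hK hy' ha⟩

theorem IsPacked.card_layer_succ_le {T : Mesh Ω} {M : ℕ} (hM : T.IsPacked M) {K : Cell d}
    (hK : K ∈ T.cells) (k : ℕ) : (T.layer (k + 1) K).card ≤ M * (T.layer k K).card := by
  classical
  have hsub : T.layer (k + 1) K ⊆ (T.layer k K).biUnion fun K' => T.layer 1 K' := by
    intro K' hK'
    obtain ⟨h1, K2, h2, h3⟩ := mem_layer_succ.1 hK'
    exact Finset.mem_biUnion.2 ⟨K2, h2, mem_layer_one.2 ⟨h1, h3⟩⟩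
  refine (Finset.card_le_card hsub).trans ?_
  rw [mul_comm]
  exact Finset.card_biUnion_le_card_mul _ _ _ fun K' hK' =>
    hM.card_layer_one_le (layer_subset hK k hK')

theorem card_layer_le_overlap {T : Mesh Ω} {K : Cell d} (hK : K ∈ T.cells) (k : ℕ) :
    (T.layer k K).card ≤ T.overlap k := by
  refine le_trans ?_ (Finset.le_sup (f := fun K => Set.ncard
    {K' : Cell d | K' ∈ T.cells ∧ K'.toSet ⊆ T.patch k K}) hK)
  rw [← Set.ncard_coe_finset]
  refine Set.ncard_le_ncard (fun K' hK' => ⟨layer_subset hK k hK', ?_⟩)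
    (T.cells.finite_toSet.subset fun K' hK' => hK'.1)
  rw [patch_eq]
  exact Set.subset_biUnion_of_mem (u := fun K : Cell d => K.toSet) hK'

/-- The sum of `g` over the neighbours of an element. -/
noncomputable def nbSum (T : Mesh Ω) (g : Cell d → ℝ) (K : Cell d) : ℝ := ∑ K' ∈ T.layer 1 K, g K'

theorem nbSum_nonneg (T : Mesh Ω) {g : Cell d → ℝ} (hg : ∀ K, 0 ≤ g K) (K : Cell d) :
    0 ≤ T.nbSum g K :=
  Finset.sum_nonneg fun K _ => hg K

theorem le_nbSum {T : Mesh Ω} {g : Cell d → ℝ} (hg : ∀ K, 0 ≤ g K) {K : Cell d}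
    (hK : K ∈ T.cells) : g K ≤ T.nbSum g K :=
  Finset.single_le_sum (fun K _ => hg K) (self_mem_layer hK 1)

theorem nbSum_mono {T : Mesh Ω} {g h : Cell d → ℝ} {K : Cell d} (hK : K ∈ T.cells)
    (hgh : ∀ K ∈ T.cells, g K ≤ h K) : T.nbSum g K ≤ T.nbSum h K :=
  Finset.sum_le_sum fun K' hK' => hgh K' (layer_subset hK 1 hK')

theorem nbSum_const_mul (T : Mesh Ω) (a : ℝ) (g : Cell d → ℝ) (K : Cell d) :
    T.nbSum (fun K => a * g K) K = a * T.nbSum g K :=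
  (Finset.mul_sum _ _ _).symm

/-- After exchanging the sums, each element is counted once for each neighbour in `𝒮`. The price of
local stability over neighbours is thus a factor `M` and one more layer. -/
theorem IsPacked.sum_nbSum_le {T : Mesh Ω} {M : ℕ} (hM : T.IsPacked M) {g : Cell d → ℝ}
    (hg : ∀ K, 0 ≤ g K) {𝒮 𝒮' : Finset (Cell d)} (h𝒮 : 𝒮 ⊆ T.cells) (h𝒮' : 𝒮' ⊆ T.cells)
    (h : ∀ K ∈ 𝒮, T.layer 1 K ⊆ 𝒮') : ∑ K ∈ 𝒮, T.nbSum g K ≤ M * ∑ K ∈ 𝒮', g K := by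
  classical
  unfold nbSum
  rw [Finset.sum_comm' (t' := 𝒮') (s' := fun K' => 𝒮.filter fun K => K' ∈ T.layer 1 K)
    (fun K K' => by
      rw [Finset.mem_filter]
      exact ⟨fun hx => ⟨⟨hx.1, hx.2⟩, h K hx.1 hx.2⟩, fun hx => hx.1⟩), Finset.mul_sum]
  refine Finset.sum_le_sum fun K' hK' => ?_
  rw [Finset.sum_const, nsmul_eq_mul]
  refine mul_le_mul_of_nonneg_right ?_ (hg K')
  have : (𝒮.filter fun K => K' ∈ T.layer 1 K).card ≤ M := by
    refine le_trans (Finset.card_le_card fun K hK => ?_) (hM.card_layer_one_le (h𝒮' hK'))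
    rw [Finset.mem_filter] at hK
    exact mem_layer_one_symm (h𝒮 hK.1) hK.2
  exact_mod_cast this

open Classical in
/-- The elements of the `j`-layer patch outside of the `i`-layer patch. -/
noncomputable def ring (T : Mesh Ω) (i j : ℕ) (K : Cell d) : Finset (Cell d) :=
  T.layer j K \ T.layer i K

open Classical in
/-- The elements outside of the `i`-layer patch. -/
noncomputable def exterior (T : Mesh Ω) (i : ℕ) (K : Cell d) : Finset (Cell d) :=
  T.cells \ T.layer i K

theorem mem_ring {T : Mesh Ω} {i j : ℕ} {K K' : Cell d} :
    K' ∈ T.ring i j K ↔ K' ∈ T.layer j K ∧ K' ∉ T.layer i K := by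
  simp [ring]

theorem mem_exterior {T : Mesh Ω} {i : ℕ} {K K' : Cell d} :
    K' ∈ T.exterior i K ↔ K' ∈ T.cells ∧ K' ∉ T.layer i K := by
  simp [exterior]

theorem exterior_subset (T : Mesh Ω) (i : ℕ) (K : Cell d) : T.exterior i K ⊆ T.cells :=
  fun _ h => (mem_exterior.1 h).1

theorem ring_subset {T : Mesh Ω} {K : Cell d} (hK : K ∈ T.cells) (i j : ℕ) :
    T.ring i j K ⊆ T.cells :=
  fun _ h => layer_subset hK j (mem_ring.1 h).1

theorem notMem_layer_of_mem_layer_one {T : Mesh Ω} {i : ℕ} {K K1 K2 : Cell d} (hK1 : K1 ∈ T.cells)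
    (h1 : K1 ∉ T.layer (i + 1) K) (h2 : K2 ∈ T.layer 1 K1) : K2 ∉ T.layer i K := fun h =>
  h1 (layer_one_subset h (mem_layer_one_symm hK1 h2))

theorem layer_one_subset_exterior {T : Mesh Ω} {i : ℕ} {K K' : Cell d}
    (h : K' ∈ T.exterior (i + 1) K) : T.layer 1 K' ⊆ T.exterior i K := fun K2 h2 => by
  rw [mem_exterior] at h ⊢
  exact ⟨layer_subset h.1 1 h2, notMem_layer_of_mem_layer_one h.1 h.2 h2⟩

theorem layer_one_subset_ring {T : Mesh Ω} {i j : ℕ} {K K' : Cell d} (hK : K ∈ T.cells)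
    (h : K' ∈ T.ring (i + 1) j K) : T.layer 1 K' ⊆ T.ring i (j + 1) K := fun K2 h2 => by
  rw [mem_ring] at h ⊢
  exact ⟨layer_one_subset h.1 h2,
    notMem_layer_of_mem_layer_one (layer_subset hK j h.1) h.2 h2⟩

theorem sum_ring_add_exterior {T : Mesh Ω} {K : Cell d} (hK : K ∈ T.cells) {i j : ℕ} (hij : i ≤ j)
    (g : Cell d → ℝ) :
    ∑ K' ∈ T.ring i j K, g K' + ∑ K' ∈ T.exterior j K, g K' = ∑ K' ∈ T.exterior i K, g K' := by
  classical
  rw [← Finset.sum_union]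
  · congr 1
    ext K'
    rw [Finset.mem_union, mem_ring, mem_exterior, mem_exterior]
    constructor
    · rintro (h | h)
      · exact ⟨layer_subset hK j h.1, h.2⟩
      · exact ⟨h.1, fun h' => h.2 (layer_mono hK hij h')⟩
    · intro h
      by_cases h' : K' ∈ T.layer j K
      · exact Or.inl ⟨h', h.2⟩
      · exact Or.inr ⟨h.1, h'⟩
  · rw [Finset.disjoint_left]
    intro K' h h'
    exact (mem_exterior.1 h').2 (mem_ring.1 h).1

end Mesh

/-! ### Localization of the interpolation operator -/

/-- The square of the `H¹`-norm on an element. -/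
noncomputable def cellNormSq (v : H10 Ω) (K : Cell d) : ℝ :=
  energyOn v K.toSet + massOn v K.toSet

theorem cellNormSq_nonneg (v : H10 Ω) (K : Cell d) : 0 ≤ cellNormSq v K :=
  add_nonneg (energyOn_nonneg _ _) (massOn_nonneg _ _)

theorem energyOn_le_cellNormSq (v : H10 Ω) (K : Cell d) : energyOn v K.toSet ≤ cellNormSq v K :=
  le_add_of_nonneg_right (massOn_nonneg _ _)

theorem energyOn_eq_zero {v : H10 Ω} {S : Set (Pt d)} (hS : MeasurableSet S)
    (h : ∀ᵐ x ∂(volume.restrict Ω), x ∈ S → grad v x = 0) : energyOn v S = 0 := by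
  refine integral_eq_zero_of_ae ?_
  rw [EventuallyEq, ae_restrict_iff' hS]
  filter_upwards [h] with x hx hxS
  simp [hx hxS]

theorem massOn_eq_zero_iff {v : H10 Ω} {S : Set (Pt d)} (hS : MeasurableSet S) :
    massOn v S = 0 ↔ ∀ᵐ x ∂(volume.restrict Ω), x ∈ S → val v x = 0 := by
  rw [massOn, setIntegral_eq_zero_iff_of_nonneg_ae (Eventually.of_forall fun x => sq_nonneg _)
    (integrable_mass v).integrableOn, EventuallyEq, ae_restrict_iff' hS]
  simp

theorem energyOn_neg (v : H10 Ω) (S : Set (Pt d)) : energyOn (-v) S = energyOn v S := by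
  refine integral_congr_ae (ae_restrict_of_ae ?_)
  filter_upwards [Lp.coeFn_neg (grad v)] with x hx
  change ‖(-grad v : L2vec Ω) x‖ ^ 2 = _
  rw [hx, Pi.neg_apply, norm_neg]

theorem energyOn_add_le (v w : H10 Ω) (S : Set (Pt d)) :
    energyOn (v + w) S ≤ 2 * energyOn v S + 2 * energyOn w S := by
  have := energyOn_sub_le v (-w) S
  rwa [sub_neg_eq_add, energyOn_neg] at this

namespace IsInterpolation

variable {T : Mesh Ω} {κ : ℝ} {I : H10 Ω →ₗ[ℝ] H10 Ω}

theorem energyOn_le (hI : IsInterpolation T κ I) {K : Cell d} (hK : K ∈ T.cells)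
    (v : H10 Ω) :
    energyOn (I v) K.toSet ≤ κ ^ 2 * T.nbSum (fun K => energyOn v K.toSet) K := by
  have h := hI.stable K hK v
  change Real.sqrt (energyOn (I v) K.toSet) ≤ κ * Real.sqrt (energyOn v (T.patch 1 K)) at h
  rw [T.energyOn_patch hK] at h
  have h0 : 0 ≤ T.nbSum (fun K => energyOn v K.toSet) K :=
    T.nbSum_nonneg (fun K => energyOn_nonneg _ _) K
  rw [Mesh.nbSum] at h0 ⊢
  have h2 := pow_le_pow_left₀ (Real.sqrt_nonneg _) h 2
  rwa [mul_pow, Real.sq_sqrt (energyOn_nonneg _ _), Real.sq_sqrt h0] at h2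

theorem massOn_sub_le (hI : IsInterpolation T κ I) {K : Cell d} (hK : K ∈ T.cells)
    (v : H10 Ω) :
    massOn (v - I v) K.toSet ≤
      κ ^ 2 * T.size ^ 2 * T.nbSum (fun K => energyOn v K.toSet) K := by
  have h := hI.approx K hK v
  change Real.sqrt (massOn (v - I v) K.toSet) ≤
    κ * T.size * Real.sqrt (energyOn v (T.patch 1 K)) at h
  rw [T.energyOn_patch hK] at h
  have h0 : 0 ≤ T.nbSum (fun K => energyOn v K.toSet) K :=
    T.nbSum_nonneg (fun K => energyOn_nonneg _ _) K
  rw [Mesh.nbSum] at h0 ⊢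
  have h2 := pow_le_pow_left₀ (Real.sqrt_nonneg _) h 2
  rwa [mul_pow, mul_pow, Real.sq_sqrt (massOn_nonneg _ _), Real.sq_sqrt h0] at h2

theorem energyOn_sub_le (hI : IsInterpolation T κ I) {K : Cell d} (hK : K ∈ T.cells)
    (v : H10 Ω) :
    energyOn (v - I v) K.toSet ≤ (2 + 2 * κ ^ 2) * T.nbSum (fun K => energyOn v K.toSet) K := by
  have h1 := LOD.energyOn_sub_le v (I v) K.toSet
  have h2 := hI.energyOn_le hK v
  have h3 : energyOn v K.toSet ≤ _ :=
    Mesh.le_nbSum (g := fun K => energyOn v K.toSet) (fun K => energyOn_nonneg _ _) hK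
  nlinarith

theorem cellNormSq_sub_le (hI : IsInterpolation T κ I) {D : ℝ} (hD : T.size ≤ D)
    {K : Cell d} (hK : K ∈ T.cells) (v : H10 Ω) :
    cellNormSq (v - I v) K ≤
      (2 + 2 * κ ^ 2 + κ ^ 2 * D ^ 2) * T.nbSum (fun K => energyOn v K.toSet) K := by
  have h1 := hI.energyOn_sub_le hK v
  have h2 := hI.massOn_sub_le hK v
  have h0 : 0 ≤ T.nbSum (fun K => energyOn v K.toSet) K :=
    T.nbSum_nonneg (fun K => energyOn_nonneg _ _) K
  have h3 : T.size ^ 2 ≤ D ^ 2 := pow_le_pow_left₀ T.size_nonneg hD 2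
  have h4 : κ ^ 2 * T.size ^ 2 * T.nbSum (fun K => energyOn v K.toSet) K ≤
      κ ^ 2 * D ^ 2 * T.nbSum (fun K => energyOn v K.toSet) K := by gcongr
  rw [cellNormSq]
  linarith

theorem sub_mem_ker (hI : IsInterpolation T κ I) (v : H10 Ω) : v - I v ∈ LinearMap.ker I := by
  rw [LinearMap.mem_ker, map_sub, hI.proj _ (hI.mem v), sub_self]

/-- On `W` the approximation property becomes a local Poincaré inequality with factor `H`. -/
theorem massOn_le_of_mem_ker (hI : IsInterpolation T κ I) {K : Cell d}
    (hK : K ∈ T.cells) {w : H10 Ω} (hw : w ∈ LinearMap.ker I) :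
    massOn w K.toSet ≤ κ ^ 2 * T.size ^ 2 * T.nbSum (fun K => energyOn w K.toSet) K := by
  have := hI.massOn_sub_le hK w
  rwa [LinearMap.mem_ker.1 hw, sub_zero] at this

theorem cellNormSq_le_of_mem_ker (hI : IsInterpolation T κ I) {D : ℝ}
    (hD : T.size ≤ D) {K : Cell d} (hK : K ∈ T.cells) {w : H10 Ω} (hw : w ∈ LinearMap.ker I) :
    cellNormSq w K ≤
      (2 + 2 * κ ^ 2 + κ ^ 2 * D ^ 2) * T.nbSum (fun K => energyOn w K.toSet) K := by
  have := hI.cellNormSq_sub_le hD hK w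
  rwa [LinearMap.mem_ker.1 hw, sub_zero] at this

theorem norm_val_le_of_mem_ker (hI : IsInterpolation T κ I) (hΩ : IsOpen Ω) (hκ : 0 ≤ κ) {M : ℕ}
    (hM : T.IsPacked M) {w : H10 Ω} (hw : w ∈ LinearMap.ker I) :
    ‖val w‖ ≤ κ * Real.sqrt M * T.size * semi w := by
  have h1 : ‖val w‖ ^ 2 ≤ (κ * Real.sqrt M * T.size * semi w) ^ 2 := by
    rw [← T.sum_massOn hΩ]
    refine (Finset.sum_le_sum fun K hK => hI.massOn_le_of_mem_ker hK hw).trans ?_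
    rw [← Finset.mul_sum]
    have := hM.sum_nbSum_le (g := fun K => energyOn w K.toSet) (fun K => energyOn_nonneg _ _)
      Finset.Subset.rfl Finset.Subset.rfl (fun K hK => Mesh.layer_subset hK 1)
    rw [T.sum_energyOn hΩ] at this
    calc κ ^ 2 * T.size ^ 2 * ∑ K ∈ T.cells, T.nbSum (fun K => energyOn w K.toSet) K
        ≤ κ ^ 2 * T.size ^ 2 * (M * semi w ^ 2) := by gcongr
      _ = (κ * Real.sqrt M * T.size * semi w) ^ 2 := by
        rw [mul_pow, mul_pow, mul_pow, Real.sq_sqrt (Nat.cast_nonneg _)]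
        ring
  exact le_of_sq_le_sq h1 (mul_nonneg (mul_nonneg (mul_nonneg hκ (Real.sqrt_nonneg _))
    T.size_nonneg) (semi_nonneg _))

theorem semi_le (hI : IsInterpolation T κ I) (hΩ : IsOpen Ω) (hκ : 0 ≤ κ) {M : ℕ}
    (hM : T.IsPacked M) (v : H10 Ω) : semi (I v) ≤ κ * Real.sqrt M * semi v := by
  have h1 : semi (I v) ^ 2 ≤ (κ * Real.sqrt M * semi v) ^ 2 := by
    rw [← T.sum_energyOn hΩ]
    refine (Finset.sum_le_sum fun K hK => hI.energyOn_le hK v).trans ?_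
    rw [← Finset.mul_sum]
    have := hM.sum_nbSum_le (g := fun K => energyOn v K.toSet) (fun K => energyOn_nonneg _ _)
      Finset.Subset.rfl Finset.Subset.rfl (fun K hK => Mesh.layer_subset hK 1)
    rw [T.sum_energyOn hΩ] at this
    calc κ ^ 2 * ∑ K ∈ T.cells, T.nbSum (fun K => energyOn v K.toSet) K
        ≤ κ ^ 2 * (M * semi v ^ 2) := by gcongr
      _ = (κ * Real.sqrt M * semi v) ^ 2 := by
        rw [mul_pow, mul_pow, Real.sq_sqrt (Nat.cast_nonneg _)]
        ring
  exact le_of_sq_le_sq h1 (mul_nonneg (mul_nonneg hκ (Real.sqrt_nonneg _)) (semi_nonneg _))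

end IsInterpolation

/-! ### Supports in patches -/

theorem Mesh.ae_notMem_patch {T : Mesh Ω} {k : ℕ} {K0 K : Cell d} (hK0 : K0 ∈ T.cells)
    (hK : K ∈ T.exterior k K0) :
    ∀ᵐ x ∂(volume.restrict Ω), x ∈ K.toSet → x ∉ T.patch k K0 := by
  refine ae_restrict_of_ae ?_
  have h : ∀ K' ∈ T.layer k K0, ∀ᵐ x : Pt d, x ∈ K.toSet → x ∉ K'.toSet := by
    intro K' hK'
    have hne : K ≠ K' := by
      rintro rfl
      exact (mem_exterior.1 hK).2 hK'
    have h0 := T.nonoverlapping K (mem_exterior.1 hK).1 K' (layer_subset hK0 k hK') hne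
    have h1 := measure_eq_zero_iff_ae_notMem.1 h0
    filter_upwards [h1] with x hx h1 h2 using hx ⟨h1, h2⟩
  have h2 := (ae_ball_iff (T.layer k K0).countable_toSet).2 h
  filter_upwards [h2] with x hx hxK
  rw [patch_eq]
  simp only [Set.mem_iUnion, exists_prop, not_exists, not_and]
  exact fun K' hK' => hx K' hK' hxK

theorem cellNormSq_eq_zero_of_mem_fineSpace (hΩ : IsOpen Ω) {T : Mesh Ω}
    {I : H10 Ω →ₗ[ℝ] H10 Ω} {k : ℕ} {K0 K : Cell d} (hK0 : K0 ∈ T.cells) {w : H10 Ω}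
    (hw : w ∈ fineSpace I (T.patch k K0)) (hK : K ∈ T.exterior k K0) : cellNormSq w K = 0 := by
  have h1 : massOn w K.toSet = 0 := by
    rw [massOn_eq_zero_iff K.isCompact_toSet.measurableSet]
    filter_upwards [hw.2, T.ae_notMem_patch hK0 hK] with x h1 h2 hx
    exact h1 (h2 hx)
  have h2 : energyOn w K.toSet = 0 := by
    refine energyOn_eq_zero K.isCompact_toSet.measurableSet ?_
    filter_upwards [grad_eq_zero_of_val_eq_zero hΩ (T.isClosed_patch k K0) w hw.2,
      T.ae_notMem_patch hK0 hK] with x h1 h2 hx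
    exact h1 (h2 hx)
  rw [cellNormSq, h1, h2, add_zero]

theorem mem_fineSpace_of_cellNormSq (hΩ : IsOpen Ω) {T : Mesh Ω} {I : H10 Ω →ₗ[ℝ] H10 Ω} {k : ℕ}
    {K0 : Cell d} {w : H10 Ω} (hw : w ∈ LinearMap.ker I)
    (h : ∀ K ∈ T.exterior k K0, cellNormSq w K = 0) : w ∈ fineSpace I (T.patch k K0) := by
  refine ⟨hw, ?_⟩
  have h1 : ∀ K ∈ T.exterior k K0, ∀ᵐ x ∂(volume.restrict Ω), x ∈ K.toSet → val w x = 0 := by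
    intro K hK
    rw [← massOn_eq_zero_iff K.isCompact_toSet.measurableSet]
    have h2 := h K hK
    rw [cellNormSq] at h2
    linarith [energyOn_nonneg w K.toSet, massOn_nonneg w K.toSet]
  filter_upwards [(ae_ball_iff (T.exterior k K0).countable_toSet).2 h1,
    ae_restrict_mem hΩ.measurableSet] with x hx hxΩ hxp
  have hx' : x ∈ closure Ω := subset_closure hxΩ
  rw [← T.cover] at hx'
  simp only [Set.mem_iUnion, exists_prop] at hx'
  obtain ⟨K, hK, hxK⟩ := hx'
  refine hx K (Mesh.mem_exterior.2 ⟨hK, fun hl => hxp ?_⟩) hxK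
  rw [Mesh.patch_eq]
  exact Set.mem_biUnion hl hxK

theorem fineSpace_sub {I : H10 Ω →ₗ[ℝ] H10 Ω} {S : Set (Pt d)} {v w : H10 Ω}
    (hv : v ∈ fineSpace I S) (hw : w ∈ fineSpace I S) : v - w ∈ fineSpace I S := by
  refine ⟨Submodule.sub_mem _ hv.1 hw.1, ?_⟩
  filter_upwards [hv.2, hw.2, val_sub_ae v w] with x h1 h2 h3 hx
  rw [h3, h1 hx, h2 hx, sub_zero]

/-! ### Cut-off of fine-scale functions -/

/-- The cut-off of a function of `H¹₀(Ω)` between two patches. -/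
theorem exists_cutoff (hΩ : IsOpen Ω) (hΩb : Bornology.IsBounded Ω) {T : Mesh Ω} {γ : ℝ}
    (hT : T.Regular γ) {M : ℕ} (hM : T.IsPacked M) {K0 : Cell d} (hK0 : K0 ∈ T.cells) (j : ℕ)
    (v : H10 Ω) :
    ∃ v' : H10 Ω,
      (∀ K : Cell d, energyOn v' K.toSet ≤
        2 * energyOn v K.toSet + 2 * (T.size⁻¹ ^ 2 * massOn v K.toSet)) ∧
      (∀ K ∈ T.layer j K0, energyOn (v - v') K.toSet = 0) ∧
      (∀ K ∈ T.exterior (j + M) K0, energyOn v' K.toSet = 0) := by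
  obtain ⟨χ, hL, h01, h1, h0⟩ := hT.exists_cutoff hM hK0 j
  have hs := inv_nonneg.2 T.size_nonneg
  lift T.size⁻¹ to ℝ≥0 using hs with L
  have hχ : ∀ x, |χ x| ≤ 1 := fun x => abs_le.2 ⟨by linarith [(h01 x).1], (h01 x).2⟩
  obtain ⟨v', hv, hg⟩ := exists_cutoff_mul hΩ hΩb hL hχ v
  -- The values `1` and `0` are extremal for `χ`, so its gradient vanishes at every point where they
  -- are attained.
  have hmax : ∀ x ∈ Ω, χ x = 1 → gradient χ x = 0 := by
    intro x _ hx
    have : IsLocalMax χ x := Eventually.of_forall fun y => by rw [hx]; exact (h01 y).2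
    rw [gradient, this.fderiv_eq_zero, map_zero]
  have hmin : ∀ x ∈ Ω, χ x = 0 → gradient χ x = 0 := by
    intro x _ hx
    have : IsLocalMin χ x := Eventually.of_forall fun y => by rw [hx]; exact (h01 y).1
    rw [gradient, this.fderiv_eq_zero, map_zero]
  refine ⟨v', fun K => ?_, fun K hK => ?_, fun K hK => ?_⟩
  · have e : 2 * energyOn v K.toSet + 2 * ((L : ℝ) ^ 2 * massOn v K.toSet) =
        ∫ x in K.toSet, (2 * ‖grad v x‖ ^ 2 + 2 * ((L : ℝ) ^ 2 * (val v x) ^ 2))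
          ∂(volume.restrict Ω) := by
      rw [integral_add ((integrable_energy v).restrict.const_mul 2)
        (((integrable_mass v).restrict.const_mul _).const_mul _), integral_const_mul,
        integral_const_mul, integral_const_mul]
      rfl
    rw [e]
    refine integral_mono_ae (integrable_energy v').restrict
      (((integrable_energy v).restrict.const_mul 2).add
        (((integrable_mass v).restrict.const_mul _).const_mul _)) (ae_restrict_of_ae ?_)
    filter_upwards [hg, ae_restrict_mem hΩ.measurableSet] with x hx hxΩ
    have a1 : ‖χ x • grad v x‖ ≤ ‖grad v x‖ := by
      rw [norm_smul]
      exact mul_le_of_le_one_left (norm_nonneg _) (hχ x)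
    have a2 : ‖val v x • gradient χ x‖ ≤ L * |val v x| := by
      rw [norm_smul, mul_comm, Real.norm_eq_abs]
      gcongr
      exact hL.norm_gradient_le hΩ hxΩ
    have a3 : ‖grad v' x‖ ≤ ‖grad v x‖ + L * |val v x| := by
      rw [hx]
      exact (norm_add_le _ _).trans (add_le_add a1 a2)
    have a4 := pow_le_pow_left₀ (norm_nonneg _) a3 2
    have a5 : (L : ℝ) ^ 2 * (val v x) ^ 2 = (L * |val v x|) ^ 2 := by rw [mul_pow, sq_abs]
    rw [a5]
    nlinarith [sq_nonneg (‖grad v x‖ - L * |val v x|)]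
  · refine energyOn_eq_zero K.isCompact_toSet.measurableSet ?_
    filter_upwards [hg, grad_sub_ae v v', ae_restrict_mem hΩ.measurableSet] with x hx hx' hxΩ hxK
    have hp : x ∈ T.patch j K0 := by
      rw [Mesh.patch_eq]
      exact Set.mem_biUnion hK hxK
    have hx1 := h1 x hxΩ hp
    rw [hx', hx, hmax x hxΩ hx1, hx1]
    simp
  · refine energyOn_eq_zero K.isCompact_toSet.measurableSet ?_
    filter_upwards [hg, T.ae_notMem_patch hK0 hK, ae_restrict_mem hΩ.measurableSet]
      with x hx hx' hxΩ hxK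
    have hx0 := h0 x hxΩ (hx' hxK)
    rw [hx, hmin x hxΩ hx0, hx0]
    simp

/-- The cut-off of a fine-scale function, corrected to be a fine-scale function again. -/
theorem IsInterpolation.exists_fine_cutoff (hΩ : IsOpen Ω) (hΩb : Bornology.IsBounded Ω)
    {T : Mesh Ω} {γ κ D : ℝ} (hT : T.Regular γ) {M : ℕ} (hM : T.IsPacked M)
    (hD : T.size ≤ D) {I : H10 Ω →ₗ[ℝ] H10 Ω} (hI : IsInterpolation T κ I) {K0 : Cell d}
    (hK0 : K0 ∈ T.cells) (i : ℕ) {w : H10 Ω} (hw : w ∈ LinearMap.ker I) :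
    ∃ r ∈ LinearMap.ker I,
      (∀ K ∈ T.cells, cellNormSq r K ≤ (2 + 2 * κ ^ 2 + κ ^ 2 * D ^ 2) * (2 + 2 * κ ^ 2) *
        T.nbSum (T.nbSum fun K => energyOn w K.toSet) K) ∧
      (∀ K ∈ T.layer i K0, cellNormSq (w - r) K = 0) ∧
      (∀ K ∈ T.exterior (i + (M + 2)) K0, cellNormSq r K = 0) := by
  -- Multiplication by a cut-off leaves `W`, and `w' - I w'` returns to it. As `I` looks one layer
  -- further, the transition zone is widened by one layer at either end: `M + 2 = 1 + M + 1`.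
  obtain ⟨w', h1, h2, h3⟩ := LOD.exists_cutoff hΩ hΩb hT hM hK0 (i + 1) w
  have hzero : ∀ K ∈ T.cells, ∀ v : H10 Ω,
      (∀ K' ∈ T.layer 1 K, energyOn v K'.toSet = 0) → cellNormSq (v - I v) K = 0 := by
    intro K hK v hv
    have h := hI.cellNormSq_sub_le hD hK v
    have h0 : T.nbSum (fun K => energyOn v K.toSet) K = 0 := Finset.sum_eq_zero hv
    rw [h0, mul_zero] at h
    exact le_antisymm h (cellNormSq_nonneg _ _)
  refine ⟨w' - I w', hI.sub_mem_ker w', fun K hK => ?_, fun K hK => ?_, fun K hK => ?_⟩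
  · refine (hI.cellNormSq_sub_le hD hK w').trans ?_
    rw [mul_assoc, ← T.nbSum_const_mul (2 + 2 * κ ^ 2)]
    refine mul_le_mul_of_nonneg_left (Mesh.nbSum_mono hK fun K' hK' => ?_) (by positivity)
    have hH := hT.size_pos hK'
    have a1 := hI.massOn_le_of_mem_ker hK' hw
    have a2 : energyOn w K'.toSet ≤ _ :=
      Mesh.le_nbSum (g := fun K => energyOn w K.toSet) (fun K => energyOn_nonneg _ _) hK'
    -- The factor `H⁻²` from the gradient of the cut-off is cancelled by the Poincaré inequality on
    -- `W`.
    have a3 : T.size⁻¹ ^ 2 * massOn w K'.toSet ≤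
        κ ^ 2 * T.nbSum (fun K => energyOn w K.toSet) K' := by
      calc T.size⁻¹ ^ 2 * massOn w K'.toSet
          ≤ T.size⁻¹ ^ 2 * (κ ^ 2 * T.size ^ 2 * T.nbSum (fun K => energyOn w K.toSet) K') := by
            gcongr
        _ = κ ^ 2 * T.nbSum (fun K => energyOn w K.toSet) K' := by field_simp
    linarith [h1 K']
  · have hK' := Mesh.layer_subset hK0 i hK
    have e : w - (w' - I w') = (w - w') - I (w - w') := by
      rw [map_sub, LinearMap.mem_ker.1 hw]
      abel
    rw [e]
    exact hzero K hK' _ fun K2 h => h2 K2 (Mesh.layer_one_subset hK h)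
  · refine hzero K (Mesh.mem_exterior.1 hK).1 _ fun K2 h => h3 K2 ?_
    have : i + (M + 2) = (i + 1 + M) + 1 := by ring
    rw [this] at hK
    exact Mesh.layer_one_subset_exterior hK h

/-! ### The form as a sum over elements -/

theorem BoundedFlux.sum_linForm (hΩ : IsOpen Ω) {l : Linearization} {α : Coeff d} {p : H10 Ω}
    {Lam1 Cp : ℝ} (h : BoundedFlux l α p Lam1 Cp) (T : Mesh Ω) (v w : H10 Ω) :
    ∑ K ∈ T.cells, linForm l α p K.toSet v w = linForm l α p Set.univ v w := by
  rw [linForm, setIntegral_univ]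
  exact T.sum_setIntegral_cells hΩ (h.integrable_inner v w)

theorem BoundedFlux.abs_linForm_univ_le (hΩ : IsOpen Ω) {l : Linearization} {α : Coeff d}
    {p : H10 Ω} {Lam1 Cp : ℝ} (h : BoundedFlux l α p Lam1 Cp) (T : Mesh Ω) (v w : H10 Ω)
    {𝒮 : Finset (Cell d)} (h𝒮 : 𝒮 ⊆ T.cells)
    (hz : ∀ K ∈ T.cells, K ∉ 𝒮 → cellNormSq v K = 0 ∨ energyOn w K.toSet = 0) :
    |linForm l α p Set.univ v w| ≤ Real.sqrt (2 * (Lam1 ^ 2 + Cp ^ 2)) *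
      (Real.sqrt (∑ K ∈ 𝒮, cellNormSq v K) * Real.sqrt (∑ K ∈ 𝒮, energyOn w K.toSet)) := by
  rw [← h.sum_linForm hΩ T]
  have hsub : ∑ K ∈ T.cells, linForm l α p K.toSet v w =
      ∑ K ∈ 𝒮, linForm l α p K.toSet v w := by
    refine (Finset.sum_subset h𝒮 fun K hK hK' => ?_).symm
    have h1 := h.abs_linForm_le K.toSet v w
    change _ ≤ _ * (Real.sqrt (cellNormSq v K) * _) at h1
    rcases hz K hK hK' with h0 | h0 <;>
    · rw [h0] at h1
      simpa using h1
  rw [hsub]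
  refine (Finset.abs_sum_le_sum_abs _ _).trans ?_
  refine (Finset.sum_le_sum fun K _ => h.abs_linForm_le K.toSet v w).trans ?_
  rw [← Finset.mul_sum]
  refine mul_le_mul_of_nonneg_left ?_ (Real.sqrt_nonneg _)
  exact Real.sum_sqrt_mul_sqrt_le 𝒮 (fun K => cellNormSq_nonneg v K)
    (fun K => energyOn_nonneg w K.toSet)

end

section

open Filter Topology
open scoped NNReal ENNReal

variable {d : ℕ} {Ω : Set (Pt d)}

/-! ### Decay of the correctors -/

theorem le_div_of_mul_sq_le {μ a b : ℝ} (hμ : 0 < μ) (ha : 0 ≤ a) (hb : 0 ≤ b)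
    (h : μ * a ^ 2 ≤ b * a) : a ≤ b / μ := by
  rw [le_div_iff₀ hμ]
  rcases ha.eq_or_lt with h0 | h0
  · rw [← h0]; simpa using hb
  · refine le_of_mul_le_mul_right ?_ h0
    linarith

/-- The fine-scale problem: a bounded flux whose form is coercive on the kernel of a local
interpolation operator. -/
structure FineScale (l : Linearization) (α : Coeff d) (p : H10 Ω) (T : Mesh Ω)
    (I : H10 Ω →ₗ[ℝ] H10 Ω) (M : ℕ) (κ D CF μ Lam1 Cp : ℝ) : Prop where
  isOpen : IsOpen Ω
  isBounded : Bornology.IsBounded Ω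
  one_le : 1 ≤ d
  regular : ∃ γ, T.Regular γ
  packed : T.IsPacked M
  size_le : T.size ≤ D
  kappa_nonneg : 0 ≤ κ
  interp : IsInterpolation T κ I
  flux : BoundedFlux l α p Lam1 Cp
  friedrichs : ∀ v : H10 Ω, ‖val v‖ ≤ CF * semi v
  pos : 0 < μ
  coercive : ∀ w ∈ LinearMap.ker I, μ * semi w ^ 2 ≤ linForm l α p Set.univ w w

/-- The continuity constant of the form. -/
noncomputable def fluxConst (Lam1 Cp : ℝ) : ℝ := Real.sqrt (2 * (Lam1 ^ 2 + Cp ^ 2))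

/-- The local stability constant of `id - I`. -/
noncomputable def localConst (κ D : ℝ) : ℝ := 2 + 2 * κ ^ 2 + κ ^ 2 * D ^ 2

/-- The stability constant of the cut-off of fine-scale functions. -/
noncomputable def cutoffConst (κ D : ℝ) : ℝ := localConst κ D * (2 + 2 * κ ^ 2)

/-- The constant of the Caccioppoli-type inequality for correctors. -/
noncomputable def caccioppoliConst (M : ℕ) (κ D μ Lam1 Cp : ℝ) : ℝ :=
  2 * ((fluxConst Lam1 Cp / μ) ^ 2 * (cutoffConst κ D * (M * M)))

/-- The factor by which the energy of a corrector decays over `M + 6` layers. -/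
noncomputable def decayRate (M : ℕ) (κ D μ Lam1 Cp : ℝ) : ℝ :=
  (1 + caccioppoliConst M κ D μ Lam1 Cp) / (2 + caccioppoliConst M κ D μ Lam1 Cp)

theorem localConst_pos (κ D : ℝ) : 0 < localConst κ D := by unfold localConst; positivity

theorem cutoffConst_pos (κ D : ℝ) : 0 < cutoffConst κ D :=
  mul_pos (localConst_pos κ D) (by positivity)

theorem fluxConst_nonneg (Lam1 Cp : ℝ) : 0 ≤ fluxConst Lam1 Cp := Real.sqrt_nonneg _

theorem caccioppoliConst_nonneg (M : ℕ) (κ D μ Lam1 Cp : ℝ) :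
    0 ≤ caccioppoliConst M κ D μ Lam1 Cp := by
  have := cutoffConst_pos κ D
  unfold caccioppoliConst
  positivity

theorem decayRate_pos (M : ℕ) (κ D μ Lam1 Cp : ℝ) : 0 < decayRate M κ D μ Lam1 Cp := by
  have := caccioppoliConst_nonneg M κ D μ Lam1 Cp
  unfold decayRate
  positivity

theorem decayRate_lt_one (M : ℕ) (κ D μ Lam1 Cp : ℝ) : decayRate M κ D μ Lam1 Cp < 1 := by
  have := caccioppoliConst_nonneg M κ D μ Lam1 Cp
  unfold decayRate
  rw [div_lt_one (by positivity)]
  linarith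

namespace FineScale

variable {l : Linearization} {α : Coeff d} {p : H10 Ω} {T : Mesh Ω} {I : H10 Ω →ₗ[ℝ] H10 Ω} {M : ℕ}
  {κ D CF μ Lam1 Cp : ℝ}

theorem abs_linForm_le (S : FineScale l α p T I M κ D CF μ Lam1 Cp) {v w : H10 Ω}
    {𝒮 : Finset (Cell d)} (h𝒮 : 𝒮 ⊆ T.cells)
    (hz : ∀ K ∈ T.cells, K ∉ 𝒮 → cellNormSq v K = 0 ∨ cellNormSq w K = 0) :
    |linForm l α p Set.univ v w| ≤ fluxConst Lam1 Cp *
      (Real.sqrt (∑ K ∈ 𝒮, cellNormSq v K) * Real.sqrt (∑ K ∈ 𝒮, energyOn w K.toSet)) := by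
  refine S.flux.abs_linForm_univ_le S.isOpen T v w h𝒮 fun K hK hK' => ?_
  refine (hz K hK hK').imp_right fun h => ?_
  exact le_antisymm (h ▸ energyOn_le_cellNormSq w K) (energyOn_nonneg _ _)

theorem abs_linForm_cell_le (S : FineScale l α p T I M κ D CF μ Lam1 Cp) (v w : H10 Ω)
    (K : Cell d) : |linForm l α p K.toSet v w| ≤
      fluxConst Lam1 Cp * (Real.sqrt (cellNormSq v K) * Real.sqrt (energyOn w K.toSet)) :=
  S.flux.abs_linForm_le K.toSet v w

theorem linForm_cell_eq_zero (S : FineScale l α p T I M κ D CF μ Lam1 Cp) (v : H10 Ω) {w : H10 Ω}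
    {K : Cell d} (h : cellNormSq w K = 0) : linForm l α p K.toSet v w = 0 := by
  have h1 := S.abs_linForm_cell_le v w K
  have h2 : energyOn w K.toSet = 0 :=
    le_antisymm (h ▸ energyOn_le_cellNormSq w K) (energyOn_nonneg _ _)
  rw [h2] at h1
  simpa using h1

theorem sum_nbSum_nbSum_le (S : FineScale l α p T I M κ D CF μ Lam1 Cp) (w : H10 Ω)
    {𝒮 𝒮' 𝒮'' : Finset (Cell d)} (h : 𝒮 ⊆ T.cells) (h' : 𝒮' ⊆ T.cells) (h'' : 𝒮'' ⊆ T.cells)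
    (h1 : ∀ K ∈ 𝒮, T.layer 1 K ⊆ 𝒮') (h2 : ∀ K ∈ 𝒮', T.layer 1 K ⊆ 𝒮'') :
    ∑ K ∈ 𝒮, T.nbSum (T.nbSum fun K => energyOn w K.toSet) K ≤
      (M * M) * ∑ K ∈ 𝒮'', energyOn w K.toSet := by
  refine (S.packed.sum_nbSum_le (fun K => T.nbSum_nonneg (fun K => energyOn_nonneg _ _) K)
    h h' h1).trans ?_
  rw [mul_assoc]
  exact mul_le_mul_of_nonneg_left (S.packed.sum_nbSum_le (fun K => energyOn_nonneg _ _)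
    h' h'' h2) (Nat.cast_nonneg _)

theorem exists_fine_cutoff (S : FineScale l α p T I M κ D CF μ Lam1 Cp) {K0 : Cell d}
    (hK0 : K0 ∈ T.cells) (i : ℕ) {w : H10 Ω} (hw : w ∈ LinearMap.ker I) :
    ∃ r ∈ LinearMap.ker I,
      (∀ K ∈ T.cells, cellNormSq r K ≤ cutoffConst κ D *
        T.nbSum (T.nbSum fun K => energyOn w K.toSet) K) ∧
      (∀ K ∈ T.layer i K0, cellNormSq (w - r) K = 0) ∧
      (∀ K ∈ T.exterior (i + (M + 2)) K0, cellNormSq r K = 0) := by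
  obtain ⟨γ, hT⟩ := S.regular
  exact S.interp.exists_fine_cutoff S.isOpen S.isBounded hT S.packed S.size_le hK0 i hw

section Corrector

variable {K0 : Cell d} {k : ℕ} {v q : H10 Ω}

/-- A Caccioppoli inequality: away from `K0` the corrector solves a homogeneous problem in `W`, so
its exterior energy is controlled by the energy in a ring. -/
theorem exterior_energy_le (S : FineScale l α p T I M κ D CF μ Lam1 Cp) (hK0 : K0 ∈ T.cells)
    (hq : q ∈ fineSpace I (T.patch k K0))
    (hqv : ∀ w ∈ fineSpace I (T.patch k K0),
      linForm l α p Set.univ q w = linForm l α p K0.toSet v w)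
    {i : ℕ} (hi : i + (M + 4) ≤ k) :
    ∑ K ∈ T.exterior (i + (M + 6)) K0, energyOn q K.toSet ≤
      caccioppoliConst M κ D μ Lam1 Cp * ∑ K ∈ T.ring i (i + (M + 6)) K0, energyOn q K.toSet := by
  -- The bound on `r` involves two successive sums over neighbours; starting at layer `i + 2` keeps
  -- them outside of layer `i`. The cut-off ends at layer `i + M + 4`, and the same two sums account
  -- for `M + 6`.
  obtain ⟨r, hr, hr1, hr2, hr3⟩ := S.exists_fine_cutoff hK0 (i + 2) hq.1
  have hidx : i + 2 + (M + 2) = i + (M + 4) := by ring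
  rw [hidx] at hr3
  have hrf : r ∈ fineSpace I (T.patch k K0) :=
    mem_fineSpace_of_cellNormSq S.isOpen hr fun K hK => hr3 K (by
      rw [Mesh.mem_exterior] at hK ⊢
      exact ⟨hK.1, fun h => hK.2 (Mesh.layer_mono hK0 hi h)⟩)
  have hwf : q - r ∈ fineSpace I (T.patch k K0) := fineSpace_sub hq hrf
  -- The test function `q - r` is admissible and vanishes on `K0`, so the right-hand side of the
  -- corrector problem drops out. What remains lives on the ring where neither `r` nor `q - r`
  -- vanishes.
  have hB : linForm l α p Set.univ (q - r) (q - r) = -linForm l α p Set.univ r (q - r) := by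
    have h1 : linForm l α p Set.univ q (q - r) = 0 := by
      rw [hqv _ hwf]
      exact S.linForm_cell_eq_zero v (hr2 K0 (Mesh.self_mem_layer hK0 _))
    have h2 := (S.flux.bilin Set.univ).map_sub₂ q r (q - r)
    simp only [BoundedFlux.bilin_apply] at h2
    rw [h2, h1, zero_sub]
  have hring := Mesh.ring_subset hK0 (i + 2) (i + (M + 4)) (T := T)
  have h3 := S.abs_linForm_le (v := r) (w := q - r) hring (fun K hK hK' => by
    rw [Mesh.mem_ring, not_and, not_not] at hK'
    by_cases hl : K ∈ T.layer (i + (M + 4)) K0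
    · exact Or.inr (hr2 K (hK' hl))
    · exact Or.inl (hr3 K (Mesh.mem_exterior.2 ⟨hK, hl⟩)))
  set X := ∑ K ∈ T.ring (i + 2) (i + (M + 4)) K0, cellNormSq r K with hX
  set Y := ∑ K ∈ T.ring i (i + (M + 6)) K0, energyOn q K.toSet with hY
  have hX0 : 0 ≤ X := Finset.sum_nonneg fun K _ => cellNormSq_nonneg _ _
  have hXY : X ≤ cutoffConst κ D * (M * M) * Y := by
    refine (Finset.sum_le_sum fun K hK => hr1 K (hring hK)).trans ?_
    rw [← Finset.mul_sum, mul_assoc]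
    refine mul_le_mul_of_nonneg_left ?_ (cutoffConst_pos _ _).le
    exact S.sum_nbSum_nbSum_le q hring (Mesh.ring_subset hK0 (i + 1) (i + (M + 5)))
      (Mesh.ring_subset hK0 _ _) (fun K hK => Mesh.layer_one_subset_ring hK0 hK)
      (fun K hK => Mesh.layer_one_subset_ring hK0 hK)
  have h4 : Real.sqrt (∑ K ∈ T.ring (i + 2) (i + (M + 4)) K0, energyOn (q - r) K.toSet) ≤
      semi (q - r) :=
    Real.sqrt_le_iff.2 ⟨semi_nonneg _, T.sum_energyOn_le S.isOpen _ hring⟩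
  have h5 : μ * semi (q - r) ^ 2 ≤ (fluxConst Lam1 Cp * Real.sqrt X) * semi (q - r) := by
    refine (S.coercive _ hwf.1).trans ?_
    rw [hB, mul_assoc]
    exact (neg_le_abs _).trans (h3.trans (mul_le_mul_of_nonneg_left
      (mul_le_mul_of_nonneg_left h4 (Real.sqrt_nonneg _)) (fluxConst_nonneg Lam1 Cp)))
  have h6 := le_div_of_mul_sq_le S.pos (semi_nonneg _)
    (mul_nonneg (fluxConst_nonneg _ _) (Real.sqrt_nonneg _)) h5
  have h7 : semi (q - r) ^ 2 ≤ (fluxConst Lam1 Cp / μ) ^ 2 * X := by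
    refine (pow_le_pow_left₀ (semi_nonneg _) h6 2).trans (le_of_eq ?_)
    rw [div_pow, mul_pow, Real.sq_sqrt hX0]
    ring
  have h8 : ∑ K ∈ T.exterior (i + (M + 6)) K0, energyOn q K.toSet ≤ 2 * semi (q - r) ^ 2 := by
    calc ∑ K ∈ T.exterior (i + (M + 6)) K0, energyOn q K.toSet
        ≤ ∑ K ∈ T.exterior (i + (M + 6)) K0, 2 * energyOn (q - r) K.toSet := by
          refine Finset.sum_le_sum fun K hK => ?_
          have a1 := energyOn_add_le (q - r) r K.toSet
          have a2 : cellNormSq r K = 0 := hr3 K (by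
            rw [Mesh.mem_exterior] at hK ⊢
            exact ⟨hK.1, fun h => hK.2 (Mesh.layer_mono hK0 (by omega) h)⟩)
          have a3 := energyOn_le_cellNormSq r K
          rw [sub_add_cancel] at a1
          linarith
      _ = 2 * ∑ K ∈ T.exterior (i + (M + 6)) K0, energyOn (q - r) K.toSet :=
          (Finset.mul_sum _ _ _).symm
      _ ≤ 2 * semi (q - r) ^ 2 := by
          gcongr
          exact T.sum_energyOn_le S.isOpen _ (T.exterior_subset _ _)
  calc _ ≤ 2 * semi (q - r) ^ 2 := h8
    _ ≤ 2 * ((fluxConst Lam1 Cp / μ) ^ 2 * (cutoffConst κ D * (M * M) * Y)) := by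
        have : 0 ≤ (fluxConst Lam1 Cp / μ) ^ 2 := sq_nonneg _
        have := mul_le_mul_of_nonneg_left hXY this
        linarith
    _ = caccioppoliConst M κ D μ Lam1 Cp * Y := by unfold caccioppoliConst; ring

/-- Hole filling: the ring energy is the difference of two exterior energies, so the Caccioppoli
inequality contracts the exterior energy once every `M + 6` layers. -/
theorem exterior_energy_le_decayRate (S : FineScale l α p T I M κ D CF μ Lam1 Cp)
    (hK0 : K0 ∈ T.cells) (hq : q ∈ fineSpace I (T.patch k K0))
    (hqv : ∀ w ∈ fineSpace I (T.patch k K0),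
      linForm l α p Set.univ q w = linForm l α p K0.toSet v w) (n : ℕ)
    (hn : n * (M + 6) ≤ k) :
    ∑ K ∈ T.exterior (n * (M + 6)) K0, energyOn q K.toSet ≤
      decayRate M κ D μ Lam1 Cp ^ n * semi q ^ 2 := by
  induction n with
  | zero =>
    rw [pow_zero, one_mul]
    exact T.sum_energyOn_le S.isOpen _ (T.exterior_subset _ _)
  | succ n ih =>
    have e : (n + 1) * (M + 6) = n * (M + 6) + (M + 6) := by ring
    rw [e] at hn ⊢
    have h1 := S.exterior_energy_le hK0 hq hqv (i := n * (M + 6)) (by omega)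
    have h2 := T.sum_ring_add_exterior hK0 (Nat.le_add_right (n * (M + 6)) (M + 6))
      (fun K => energyOn q K.toSet)
    have h3 := ih (by omega)
    set c := caccioppoliConst M κ D μ Lam1 Cp with hc
    have hc0 : 0 ≤ c := caccioppoliConst_nonneg _ _ _ _ _ _
    set a := ∑ K ∈ T.exterior (n * (M + 6) + (M + 6)) K0, energyOn q K.toSet
    set b := ∑ K ∈ T.exterior (n * (M + 6)) K0, energyOn q K.toSet
    have hb : 0 ≤ b := Finset.sum_nonneg fun K _ => energyOn_nonneg _ _
    have ha : 0 ≤ a := Finset.sum_nonneg fun K _ => energyOn_nonneg _ _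
    have hring0 : 0 ≤ ∑ K ∈ T.ring (n * (M + 6)) (n * (M + 6) + (M + 6)) K0,
        energyOn q K.toSet := Finset.sum_nonneg fun K _ => energyOn_nonneg _ _
    -- From `a ≤ c * (b - a)` the rate `c / (1 + c)` would follow. The larger `(1 + c) / (2 + c)` is
    -- obtained by adding `a ≤ b`, and stays positive even if `c = 0`.
    have h4 : a ≤ decayRate M κ D μ Lam1 Cp * b := by
      rw [decayRate, ← hc, div_mul_eq_mul_div, le_div_iff₀ (by positivity)]
      nlinarith
    calc a ≤ decayRate M κ D μ Lam1 Cp * b := h4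
      _ ≤ decayRate M κ D μ Lam1 Cp * (decayRate M κ D μ Lam1 Cp ^ n * semi q ^ 2) :=
          mul_le_mul_of_nonneg_left h3 (decayRate_pos _ _ _ _ _ _).le
      _ = _ := by ring

/-- The corrector is tested with itself; the source sees only `K0`. -/
theorem semi_corrector_sq_le (S : FineScale l α p T I M κ D CF μ Lam1 Cp) (hK0 : K0 ∈ T.cells)
    (hq : q ∈ fineSpace I (T.patch k K0))
    (hqv : ∀ w ∈ fineSpace I (T.patch k K0),
      linForm l α p Set.univ q w = linForm l α p K0.toSet v w) :
    semi q ^ 2 ≤ (fluxConst Lam1 Cp / μ) ^ 2 * cellNormSq v K0 := by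
  have h1 := S.abs_linForm_cell_le v q K0
  have h2 : Real.sqrt (energyOn q K0.toSet) ≤ semi q := by
    refine Real.sqrt_le_iff.2 ⟨semi_nonneg _, ?_⟩
    have := T.sum_energyOn_le S.isOpen q (Finset.singleton_subset_iff.2 hK0)
    simpa using this
  have h3 : μ * semi q ^ 2 ≤ (fluxConst Lam1 Cp * Real.sqrt (cellNormSq v K0)) * semi q := by
    refine (S.coercive _ hq.1).trans ?_
    rw [hqv q hq, mul_assoc]
    refine (le_abs_self _).trans (h1.trans ?_)
    have := fluxConst_nonneg Lam1 Cp
    gcongr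
  have h4 := le_div_of_mul_sq_le S.pos (semi_nonneg _)
    (mul_nonneg (fluxConst_nonneg _ _) (Real.sqrt_nonneg _)) h3
  refine (pow_le_pow_left₀ (semi_nonneg _) h4 2).trans (le_of_eq ?_)
  rw [div_pow, mul_pow, Real.sq_sqrt (cellNormSq_nonneg _ _)]
  ring

/-- The constant of the localization error of one corrector. -/
noncomputable def residualConst (M : ℕ) (κ D CF μ Lam1 Cp : ℝ) : ℝ :=
  2 * fluxConst Lam1 Cp ^ 2 * ((1 + CF ^ 2) * (fluxConst Lam1 Cp / μ) ^ 2 + 1) +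
    fluxConst Lam1 Cp ^ 2 * (localConst κ D * M * ((decayRate M κ D μ Lam1 Cp)⁻¹ *
      (fluxConst Lam1 Cp / μ) ^ 2)) * (2 + 2 * (cutoffConst κ D * (M * M)))

theorem sum_cellNormSq_le (S : FineScale l α p T I M κ D CF μ Lam1 Cp) (v : H10 Ω)
    {𝒮 : Finset (Cell d)} (h𝒮 : 𝒮 ⊆ T.cells) :
    ∑ K ∈ 𝒮, cellNormSq v K ≤ (1 + CF ^ 2) * semi v ^ 2 := by
  refine (Finset.sum_le_sum_of_subset_of_nonneg h𝒮 fun K _ _ => cellNormSq_nonneg _ _).trans ?_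
  unfold cellNormSq
  rw [Finset.sum_add_distrib, T.sum_energyOn S.isOpen, T.sum_massOn S.isOpen]
  have := pow_le_pow_left₀ (norm_nonneg _) (S.friedrichs v) 2
  rw [mul_pow] at this
  linarith

/-- The residual of a localized corrector, tested with a fine-scale function. -/
theorem residual_sq_le (S : FineScale l α p T I M κ D CF μ Lam1 Cp) (hK0 : K0 ∈ T.cells)
    (hq : q ∈ fineSpace I (T.patch k K0))
    (hqv : ∀ w ∈ fineSpace I (T.patch k K0),
      linForm l α p Set.univ q w = linForm l α p K0.toSet v w) {w : H10 Ω}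
    (hw : w ∈ LinearMap.ker I) :
    (linForm l α p Set.univ q w - linForm l α p K0.toSet v w) ^ 2 ≤
      residualConst M κ D CF μ Lam1 Cp * decayRate M κ D μ Lam1 Cp ^ (k / (M + 6)) *
        cellNormSq v K0 * ∑ K ∈ T.layer (k + 2) K0, energyOn w K.toSet := by
  set b := fluxConst Lam1 Cp with hb
  set ϑ := decayRate M κ D μ Lam1 Cp with hϑ
  have hϑ0 : 0 < ϑ := decayRate_pos _ _ _ _ _ _
  have hb0 : 0 ≤ b := fluxConst_nonneg _ _
  have hL0 := localConst_pos κ D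
  have hC0 := cutoffConst_pos κ D
  set N := cellNormSq v K0 with hN
  have hN0 : 0 ≤ N := cellNormSq_nonneg _ _
  set Z := ∑ K ∈ T.layer (k + 2) K0, energyOn w K.toSet with hZ
  have hZ0 : 0 ≤ Z := Finset.sum_nonneg fun K _ => energyOn_nonneg _ _
  have hsemi := S.semi_corrector_sq_le hK0 hq hqv
  rw [← hb, ← hN] at hsemi
  -- `A1` serves patches with fewer than `M + 6` layers, where stability suffices; `A2` serves the
  -- regime of decay.
  set A1 := 2 * b ^ 2 * ((1 + CF ^ 2) * (b / μ) ^ 2 + 1) with hA1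
  set A2 := b ^ 2 * (localConst κ D * M * (ϑ⁻¹ * (b / μ) ^ 2)) *
    (2 + 2 * (cutoffConst κ D * (M * M))) with hA2
  have hA10 : 0 ≤ A1 := by positivity
  have hA20 : 0 ≤ A2 := by positivity
  have hres : residualConst M κ D CF μ Lam1 Cp = A1 + A2 := rfl
  rw [hres]
  rcases Nat.eq_zero_or_pos (k / (M + 6)) with hn | hn
  · rw [hn, pow_zero, mul_one]
    have h1 := S.abs_linForm_le (v := q) (w := w) (Mesh.layer_subset hK0 k) (fun K hK hK' =>
      Or.inl (cellNormSq_eq_zero_of_mem_fineSpace S.isOpen hK0 hq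
        (Mesh.mem_exterior.2 ⟨hK, hK'⟩)))
    have h2 := S.abs_linForm_cell_le v w K0
    rw [← hb] at h1 h2
    have z1 : ∑ K ∈ T.layer k K0, energyOn w K.toSet ≤ Z :=
      Finset.sum_le_sum_of_subset_of_nonneg (Mesh.layer_mono hK0 (by omega))
        fun K _ _ => energyOn_nonneg _ _
    have z2 : energyOn w K0.toSet ≤ Z :=
      Finset.single_le_sum (f := fun K : Cell d => energyOn w K.toSet)
        (fun K _ => energyOn_nonneg _ _) (Mesh.self_mem_layer hK0 _)
    have z3 := S.sum_cellNormSq_le q (Mesh.layer_subset hK0 k)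
    have s1 : (linForm l α p Set.univ q w) ^ 2 ≤
        b ^ 2 * (((1 + CF ^ 2) * ((b / μ) ^ 2 * N)) * Z) := by
      rw [← sq_abs]
      refine (pow_le_pow_left₀ (abs_nonneg _) h1 2).trans ?_
      rw [mul_pow, mul_pow, Real.sq_sqrt (Finset.sum_nonneg fun K _ => cellNormSq_nonneg _ _),
        Real.sq_sqrt (Finset.sum_nonneg fun K _ => energyOn_nonneg _ _)]
      have : ∑ K ∈ T.layer k K0, cellNormSq q K ≤ (1 + CF ^ 2) * ((b / μ) ^ 2 * N) :=
        z3.trans (mul_le_mul_of_nonneg_left hsemi (by positivity))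
      have hh : 0 ≤ ∑ K ∈ T.layer k K0, energyOn w K.toSet :=
        Finset.sum_nonneg fun K _ => energyOn_nonneg _ _
      gcongr
    have s2 : (linForm l α p K0.toSet v w) ^ 2 ≤ b ^ 2 * (N * Z) := by
      rw [← sq_abs]
      refine (pow_le_pow_left₀ (abs_nonneg _) h2 2).trans ?_
      rw [mul_pow, mul_pow, Real.sq_sqrt (cellNormSq_nonneg _ _),
        Real.sq_sqrt (energyOn_nonneg _ _)]
      gcongr
    have s3 : (linForm l α p Set.univ q w - linForm l α p K0.toSet v w) ^ 2 ≤ A1 * N * Z := by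
      have e : A1 * N * Z = 2 * (b ^ 2 * (((1 + CF ^ 2) * ((b / μ) ^ 2 * N)) * Z)) +
          2 * (b ^ 2 * (N * Z)) := by rw [hA1]; ring
      rw [e]
      nlinarith [sq_nonneg (linForm l α p Set.univ q w + linForm l α p K0.toSet v w)]
    have s4 : 0 ≤ A2 * N * Z := by positivity
    calc _ ≤ A1 * N * Z := s3
      _ ≤ (A1 + A2) * N * Z := by linarith
  · obtain ⟨n, hn'⟩ := Nat.exists_eq_succ_of_ne_zero hn.ne'
    -- Of the `n + 1` complete blocks of `M + 6` layers, `n` are used for decay and the last leaves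
    -- room for cutting off `w`. The missing block is the factor `ϑ⁻¹` in `A2`.
    rw [hn', Nat.succ_eq_add_one]
    have hk : (n + 1) * (M + 6) ≤ k := by
      rw [← Nat.succ_eq_add_one, ← hn']
      exact Nat.div_mul_le_self _ _
    have hk' : n * (M + 6) + (M + 6) ≤ k := by linarith
    set i := n * (M + 6) with hi
    obtain ⟨r, hr, hr1, hr2, hr3⟩ := S.exists_fine_cutoff hK0 (i + 1) hw
    have hrf : r ∈ fineSpace I (T.patch k K0) :=
      mem_fineSpace_of_cellNormSq S.isOpen hr fun K hK => hr3 K (by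
        rw [Mesh.mem_exterior] at hK ⊢
        exact ⟨hK.1, fun h => hK.2 (Mesh.layer_mono hK0 (by omega) h)⟩)
    -- The residual vanishes on the admissible `r`, and `w - r` vanishes on `K0`. Only the far part
    -- of `w` is left, and it meets `q` only where `q` has decayed.
    have hR : linForm l α p Set.univ q w - linForm l α p K0.toSet v w =
        linForm l α p Set.univ q (w - r) := by
      have e1 := (S.flux.bilin Set.univ q).map_sub w r
      have e2 := (S.flux.bilin K0.toSet v).map_sub w r
      simp only [BoundedFlux.bilin_apply] at e1 e2
      have e3 := S.linForm_cell_eq_zero v (hr2 K0 (Mesh.self_mem_layer hK0 _))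
      have e4 := hqv r hrf
      linarith
    have hring := Mesh.ring_subset hK0 (i + 1) k (T := T)
    have h1 := S.abs_linForm_le (v := q) (w := w - r) hring (fun K hK hK' => by
      rw [Mesh.mem_ring, not_and, not_not] at hK'
      by_cases hl : K ∈ T.layer k K0
      · exact Or.inr (hr2 K (hK' hl))
      · exact Or.inl (cellNormSq_eq_zero_of_mem_fineSpace S.isOpen hK0 hq
          (Mesh.mem_exterior.2 ⟨hK, hl⟩)))
    rw [← hb] at h1
    have hq1 : ∑ K ∈ T.ring (i + 1) k K0, cellNormSq q K ≤
        localConst κ D * M * (ϑ ^ n * ((b / μ) ^ 2 * N)) := by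
      refine (Finset.sum_le_sum fun K hK =>
        S.interp.cellNormSq_le_of_mem_ker S.size_le (hring hK) hq.1).trans ?_
      rw [← Finset.mul_sum, mul_assoc]
      refine mul_le_mul_of_nonneg_left ?_ hL0.le
      refine (S.packed.sum_nbSum_le (fun K => energyOn_nonneg _ _) hring
        (T.exterior_subset i K0) fun K hK => Mesh.layer_one_subset_exterior
          (Mesh.mem_exterior.2 ⟨hring hK, (Mesh.mem_ring.1 hK).2⟩)).trans ?_
      refine mul_le_mul_of_nonneg_left ?_ (Nat.cast_nonneg _)
      refine (S.exterior_energy_le_decayRate hK0 hq hqv n (by omega)).trans ?_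
      exact mul_le_mul_of_nonneg_left hsemi (by positivity)
    have hw1 : ∑ K ∈ T.ring (i + 1) k K0, energyOn (w - r) K.toSet ≤
        (2 + 2 * (cutoffConst κ D * (M * M))) * Z := by
      have hsub : T.ring (i + 1) k K0 ⊆ T.layer k K0 := fun K hK => (Mesh.mem_ring.1 hK).1
      have a1 : ∑ K ∈ T.ring (i + 1) k K0, energyOn w K.toSet ≤ Z :=
        Finset.sum_le_sum_of_subset_of_nonneg (hsub.trans (Mesh.layer_mono hK0 (by omega)))
          fun K _ _ => energyOn_nonneg _ _
      have a2 : ∑ K ∈ T.ring (i + 1) k K0, energyOn r K.toSet ≤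
          cutoffConst κ D * ((M * M) * Z) := by
        refine (Finset.sum_le_sum fun K hK =>
          (energyOn_le_cellNormSq r K).trans (hr1 K (hring hK))).trans ?_
        rw [← Finset.mul_sum]
        refine mul_le_mul_of_nonneg_left ?_ hC0.le
        exact S.sum_nbSum_nbSum_le w hring (Mesh.layer_subset hK0 (k + 1))
          (Mesh.layer_subset hK0 (k + 2)) (fun K hK => Mesh.layer_one_subset (hsub hK))
          (fun K hK => Mesh.layer_one_subset hK)
      calc ∑ K ∈ T.ring (i + 1) k K0, energyOn (w - r) K.toSet
          ≤ ∑ K ∈ T.ring (i + 1) k K0, (2 * energyOn w K.toSet + 2 * energyOn r K.toSet) :=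
            Finset.sum_le_sum fun K _ => energyOn_sub_le w r K.toSet
        _ = 2 * ∑ K ∈ T.ring (i + 1) k K0, energyOn w K.toSet +
            2 * ∑ K ∈ T.ring (i + 1) k K0, energyOn r K.toSet := by
            rw [Finset.sum_add_distrib, Finset.mul_sum, Finset.mul_sum]
        _ ≤ _ := by linarith
    have s1 : (linForm l α p Set.univ q w - linForm l α p K0.toSet v w) ^ 2 ≤
        A2 * ϑ ^ (n + 1) * N * Z := by
      rw [hR, ← sq_abs]
      refine (pow_le_pow_left₀ (abs_nonneg _) h1 2).trans ?_
      rw [mul_pow, mul_pow, Real.sq_sqrt (Finset.sum_nonneg fun K _ => cellNormSq_nonneg _ _),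
        Real.sq_sqrt (Finset.sum_nonneg fun K _ => energyOn_nonneg _ _)]
      calc b ^ 2 * ((∑ K ∈ T.ring (i + 1) k K0, cellNormSq q K) *
            ∑ K ∈ T.ring (i + 1) k K0, energyOn (w - r) K.toSet)
          ≤ b ^ 2 * ((localConst κ D * M * (ϑ ^ n * ((b / μ) ^ 2 * N))) *
            ((2 + 2 * (cutoffConst κ D * (M * M))) * Z)) := by
            refine mul_le_mul_of_nonneg_left (mul_le_mul hq1 hw1
              (Finset.sum_nonneg fun K _ => energyOn_nonneg _ _) ?_) (sq_nonneg _)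
            positivity
        _ = A2 * ϑ ^ (n + 1) * N * Z := by
            have e : ϑ ^ n = ϑ ^ (n + 1) * ϑ⁻¹ := by
              rw [pow_succ, mul_assoc, mul_inv_cancel₀ hϑ0.ne', mul_one]
            rw [hA2, e]
            ring
    have s4 : 0 ≤ A1 * ϑ ^ (n + 1) * N * Z := by positivity
    calc _ ≤ A2 * ϑ ^ (n + 1) * N * Z := s1
      _ ≤ (A1 + A2) * ϑ ^ (n + 1) * N * Z := by linarith

end Corrector

/-! ### Summation of the localization errors -/

theorem residualConst_nonneg (M : ℕ) (κ D CF μ Lam1 Cp : ℝ) :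
    0 ≤ residualConst M κ D CF μ Lam1 Cp := by
  have h1 := localConst_pos κ D
  have h2 := cutoffConst_pos κ D
  have h3 := decayRate_pos M κ D μ Lam1 Cp
  have h4 := fluxConst_nonneg Lam1 Cp
  unfold residualConst
  positivity

/-- By symmetry of the layers, an element lies in as many patches as its own patch has elements. The
two layers beyond `k`, caused by the cut-off, cost a factor `M` each. -/
theorem sum_layer_energy_le (S : FineScale l α p T I M κ D CF μ Lam1 Cp) (k : ℕ) (w : H10 Ω) :
    ∑ K0 ∈ T.cells, ∑ K ∈ T.layer (k + 2) K0, energyOn w K.toSet ≤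
      M * (M * T.overlap k) * semi w ^ 2 := by
  classical
  rw [Finset.sum_comm' (t' := T.cells) (s' := fun K => T.cells.filter fun K0 =>
    K ∈ T.layer (k + 2) K0) (fun K0 K => by
      rw [Finset.mem_filter]
      exact ⟨fun h => ⟨h, Mesh.layer_subset h.1 _ h.2⟩, fun h => h.1⟩), ← T.sum_energyOn S.isOpen,
    Finset.mul_sum]
  refine Finset.sum_le_sum fun K hK => ?_
  rw [Finset.sum_const, nsmul_eq_mul]
  refine mul_le_mul_of_nonneg_right ?_ (energyOn_nonneg _ _)
  have h1 : (T.cells.filter fun K0 => K ∈ T.layer (k + 2) K0).card ≤ (T.layer (k + 2) K).card :=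
    Finset.card_le_card fun K0 h => by
      rw [Finset.mem_filter] at h
      exact Mesh.mem_layer_symm h.1 h.2
  have h2 := S.packed.card_layer_succ_le hK (k + 1)
  have h3 := S.packed.card_layer_succ_le hK k
  have h4 := Mesh.card_layer_le_overlap hK k
  have h5 : (T.cells.filter fun K0 => K ∈ T.layer (k + 2) K0).card ≤ M * (M * T.overlap k) :=
    h1.trans (h2.trans (Nat.mul_le_mul_left _ (h3.trans (Nat.mul_le_mul_left _ h4))))
  exact_mod_cast h5

/-- The localization error of the correctors. -/
theorem abs_sum_residual_le (S : FineScale l α p T I M κ D CF μ Lam1 Cp) {k : ℕ}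
    {v : H10 Ω} {q : Cell d → H10 Ω}
    (hq : ∀ K ∈ T.cells, q K ∈ fineSpace I (T.patch k K))
    (hqv : ∀ K ∈ T.cells, ∀ w ∈ fineSpace I (T.patch k K),
      linForm l α p Set.univ (q K) w = linForm l α p K.toSet v w) {w : H10 Ω}
    (hw : w ∈ LinearMap.ker I) :
    |∑ K ∈ T.cells, (linForm l α p Set.univ (q K) w - linForm l α p K.toSet v w)| ≤
      Real.sqrt (residualConst M κ D CF μ Lam1 Cp * (1 + CF ^ 2)) * M *
        (Real.sqrt (T.overlap k) * Real.sqrt (decayRate M κ D μ Lam1 Cp) ^ (k / (M + 6))) *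
          semi v * semi w := by
  set c := residualConst M κ D CF μ Lam1 Cp with hc
  have hc0 : 0 ≤ c := residualConst_nonneg _ _ _ _ _ _ _
  set ϑ := decayRate M κ D μ Lam1 Cp with hϑ
  have hϑ0 : 0 < ϑ := decayRate_pos _ _ _ _ _ _
  set n := k / (M + 6) with hn
  refine (Finset.abs_sum_le_sum_abs _ _).trans ?_
  have h1 : ∀ K ∈ T.cells,
      |linForm l α p Set.univ (q K) w - linForm l α p K.toSet v w| ≤
        Real.sqrt (c * ϑ ^ n * cellNormSq v K) *
          Real.sqrt (∑ K' ∈ T.layer (k + 2) K, energyOn w K'.toSet) := by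
    intro K hK
    rw [← Real.sqrt_mul (by have := cellNormSq_nonneg v K; positivity)]
    refine Real.abs_le_sqrt ?_
    exact S.residual_sq_le hK (hq K hK) (hqv K hK) hw
  -- Cauchy–Schwarz over the elements: the norms of `v` are on disjoint elements and only the
  -- energies of `w` overlap, so the overlap enters under a square root.
  refine (Finset.sum_le_sum h1).trans ((Real.sum_sqrt_mul_sqrt_le _
    (fun K => mul_nonneg (by positivity) (cellNormSq_nonneg v K))
    (fun K => Finset.sum_nonneg fun K' _ => energyOn_nonneg w K'.toSet)).trans ?_)
  rw [← Finset.mul_sum]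
  have h2 : c * ϑ ^ n * ∑ K ∈ T.cells, cellNormSq v K ≤
      c * (1 + CF ^ 2) * (Real.sqrt ϑ ^ n * semi v) ^ 2 := by
    have := S.sum_cellNormSq_le v Finset.Subset.rfl
    calc c * ϑ ^ n * ∑ K ∈ T.cells, cellNormSq v K
        ≤ c * ϑ ^ n * ((1 + CF ^ 2) * semi v ^ 2) := by gcongr
      _ = c * (1 + CF ^ 2) * (Real.sqrt ϑ ^ n * semi v) ^ 2 := by
          rw [mul_pow, ← pow_mul, mul_comm n 2, pow_mul, Real.sq_sqrt hϑ0.le]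
          ring
  have h3 : ∑ K ∈ T.cells, ∑ K' ∈ T.layer (k + 2) K, energyOn w K'.toSet ≤
      T.overlap k * (M * semi w) ^ 2 := by
    refine (S.sum_layer_energy_le k w).trans (le_of_eq ?_)
    ring
  have h4 := Real.sqrt_le_sqrt h2
  have h5 := Real.sqrt_le_sqrt h3
  have hv0 := semi_nonneg v
  have hw0 := semi_nonneg w
  rw [Real.sqrt_mul (x := c * (1 + CF ^ 2)) (by positivity), Real.sqrt_sq (by positivity)] at h4
  rw [Real.sqrt_mul (by positivity), Real.sqrt_sq (by positivity)] at h5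
  refine (mul_le_mul h4 h5 (Real.sqrt_nonneg _) (by positivity)).trans (le_of_eq ?_)
  ring

end FineScale

end

section

open Filter Topology
open scoped NNReal ENNReal

variable {d : ℕ} {Ω : Set (Pt d)}

/-! ### The multiscale space and the error estimate -/

theorem abs_load_le (f : L2 Ω) (v : H10 Ω) : |load f v| ≤ ‖f‖ * ‖val v‖ := by
  have h : load f v = inner ℝ f (val v) := by
    rw [load, L2.inner_def]
    refine integral_congr_ae (Eventually.of_forall fun x => ?_)
    simp [mul_comm]
  rw [h]
  exact abs_real_inner_le_norm f (val v)

/-- Ellipticity minus the drift. With `Cp = 0` this is coercivity on all of `H10 Ω`; otherwise the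
drift can be absorbed where `‖val w‖` is of order `H * semi w`. -/
theorem sub_semi_mul_le_linForm (hΩ : IsOpen Ω) {lam Lam0 Lam1 Cp : ℝ} {l : Linearization}
    {α : Coeff d} {p : H10 Ω} (hα : CoeffAssumption Ω lam Lam0 Lam1 α)
    (h : BoundedFlux l α p Lam1 Cp) (hCp : 0 ≤ Cp) (w : H10 Ω) :
    lam * semi w ^ 2 - Cp * (‖val w‖ * semi w) ≤ linForm l α p Set.univ w w := by
  rw [← energyOn_univ, energyOn, linForm, setIntegral_univ, setIntegral_univ]
  have h1 := integral_norm_mul_norm_le (Lp.memLp (val w)) (Lp.memLp (grad w))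
  rw [← norm_eq_sqrt_integral, ← norm_eq_sqrt_integral] at h1
  have hi := integrable_norm_mul_norm (Lp.memLp (val w)) (Lp.memLp (grad w))
  have h2 : ∫ x in Ω, (lam * ‖grad w x‖ ^ 2 - Cp * (‖val w x‖ * ‖grad w x‖)) ≤
      ∫ x in Ω, inner ℝ (linFlux l α p w x) (grad w x) := by
    refine integral_mono_ae (((integrable_energy w).const_mul lam).sub (hi.const_mul Cp))
      (h.integrable_inner w w) ?_
    filter_upwards [h.bound_drift, ae_restrict_mem hΩ.measurableSet] with x hx hxΩ
    have a1 := hα.elliptic x hxΩ (val p x) (grad w x)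
    have a2 : |inner ℝ (val w x • drift l α p x) (grad w x)| ≤
        Cp * (‖val w x‖ * ‖grad w x‖) := by
      refine (abs_real_inner_le_norm _ _).trans ?_
      rw [norm_smul]
      calc ‖val w x‖ * ‖drift l α p x‖ * ‖grad w x‖ ≤ ‖val w x‖ * Cp * ‖grad w x‖ := by gcongr
        _ = Cp * (‖val w x‖ * ‖grad w x‖) := by ring
    rw [linFlux, inner_add_left]
    linarith [(abs_le.1 a2).1]
  rw [integral_sub ((integrable_energy w).const_mul lam) (hi.const_mul Cp), integral_const_mul,
    integral_const_mul] at h2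
  have h3 := mul_le_mul_of_nonneg_left h1 hCp
  change _ ≤ Cp * (‖val w‖ * semi w) at h3
  linarith

theorem BoundedFlux.abs_linForm_univ_le_semi {l : Linearization} {α : Coeff d} {p : H10 Ω}
    {Lam1 Cp CF : ℝ} (h : BoundedFlux l α p Lam1 Cp)
    (hF : ∀ v : H10 Ω, ‖val v‖ ≤ CF * semi v) (v w : H10 Ω) :
    |linForm l α p Set.univ v w| ≤
      fluxConst Lam1 Cp * Real.sqrt (1 + CF ^ 2) * semi v * semi w := by
  refine (h.abs_linForm_le Set.univ v w).trans ?_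
  rw [energyOn_univ, energyOn_univ, massOn_univ, Real.sqrt_sq (semi_nonneg w)]
  have h1 : Real.sqrt (semi v ^ 2 + ‖val v‖ ^ 2) ≤ Real.sqrt (1 + CF ^ 2) * semi v := by
    rw [← Real.sqrt_sq (semi_nonneg v), ← Real.sqrt_mul (by positivity),
      Real.sqrt_sq (semi_nonneg v)]
    refine Real.sqrt_le_sqrt ?_
    have := pow_le_pow_left₀ (norm_nonneg _) (hF v) 2
    rw [mul_pow] at this
    linarith
  have hw := semi_nonneg w
  calc _ ≤ fluxConst Lam1 Cp * (Real.sqrt (1 + CF ^ 2) * semi v * semi w) :=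
        mul_le_mul_of_nonneg_left (mul_le_mul_of_nonneg_right h1 hw) (fluxConst_nonneg _ _)
    _ = _ := by ring

namespace FineScale

variable {l : Linearization} {α : Coeff d} {p : H10 Ω} {T : Mesh Ω} {I : H10 Ω →ₗ[ℝ] H10 Ω} {M : ℕ}
  {κ D CF μ Lam1 Cp : ℝ} {k : ℕ} {Q : Cell d → H10 Ω → H10 Ω}

/-! ### Linearity of the multiscale space, consistency and Galerkin errors -/

theorem corrector_eq (S : FineScale l α p T I M κ D CF μ Lam1 Cp)
    (hQ : IsCorrector l α p T I k Q) {K : Cell d} (hK : K ∈ T.cells) {v : H10 Ω}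
    (hv : v ∈ T.feSpace) {w : H10 Ω} (hw : w ∈ fineSpace I (T.patch k K)) :
    linForm l α p Set.univ (Q K v) w = linForm l α p K.toSet v w := by
  rw [← (hQ K hK v hv).2 w hw]
  exact (linForm_eq_univ_of_grad _ _
    (grad_eq_zero_of_val_eq_zero S.isOpen (T.isClosed_patch k K) w hw.2)).symm

/-- The correctors are given only through their equations. Coercivity on `W` makes solutions unique
and hence compatible with differences, so the difference of two multiscale functions is an
admissible test function. -/
theorem corrector_sub (S : FineScale l α p T I M κ D CF μ Lam1 Cp)
    (hQ : IsCorrector l α p T I k Q) {K : Cell d} (hK : K ∈ T.cells) {v v' : H10 Ω}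
    (hv : v ∈ T.feSpace) (hv' : v' ∈ T.feSpace) : Q K (v - v') = Q K v - Q K v' := by
  have hvv := Submodule.sub_mem _ hv hv'
  set δ := Q K (v - v') - (Q K v - Q K v') with hδ
  have hδf : δ ∈ fineSpace I (T.patch k K) :=
    fineSpace_sub (hQ K hK _ hvv).1 (fineSpace_sub (hQ K hK v hv).1 (hQ K hK v' hv').1)
  have h0 : linForm l α p Set.univ δ δ = 0 := by
    have e1 := (S.flux.bilin Set.univ).map_sub₂ (Q K (v - v')) (Q K v - Q K v') δ
    have e2 := (S.flux.bilin Set.univ).map_sub₂ (Q K v) (Q K v') δ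
    have e3 := (S.flux.bilin K.toSet).map_sub₂ v v' δ
    simp only [BoundedFlux.bilin_apply, ← hδ] at e1 e2 e3
    rw [e1, e2, S.corrector_eq hQ hK hvv hδf, S.corrector_eq hQ hK hv hδf,
      S.corrector_eq hQ hK hv' hδf, e3]
    ring
  have h1 := S.coercive δ hδf.1
  rw [h0] at h1
  have h2 : semi δ = 0 := by
    have h3 : semi δ ^ 2 ≤ 0 := by
      by_contra hcon
      push Not at hcon
      linarith [mul_pos S.pos hcon]
    exact pow_eq_zero_iff (two_ne_zero) |>.1 (le_antisymm h3 (sq_nonneg _))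
  exact sub_eq_zero.1 (eq_zero_of_semi_eq_zero S.one_le S.isBounded h2)

theorem msSpace_sub (S : FineScale l α p T I M κ D CF μ Lam1 Cp)
    (hQ : IsCorrector l α p T I k Q) {y z : H10 Ω} (hy : y ∈ msSpace T Q) (hz : z ∈ msSpace T Q) :
    y - z ∈ msSpace T Q := by
  obtain ⟨a, ha, rfl⟩ := hy
  obtain ⟨b, hb, rfl⟩ := hz
  refine ⟨a - b, Submodule.sub_mem _ ha hb, ?_⟩
  rw [correct, correct, correct,
    Finset.sum_congr rfl fun K hK => S.corrector_sub hQ hK ha hb, Finset.sum_sub_distrib]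
  abel

/-- The consistency error of the linearization. -/
theorem abs_linearization_le {lam Lam0 : ℝ} (S : FineScale l α p T I M κ D CF μ Lam1 Cp)
    (hα : CoeffAssumption Ω lam Lam0 Lam1 α) (u w : H10 Ω) :
    |form α u u w - linForm l α p Set.univ u w| ≤ linError l α p u * semi w := by
  have hu := hα.boundedFlux_kacanov S.isOpen u
  set F : Pt d → Pt d := fun x => α x (val u x) (grad u x) - linFlux l α p u x with hF
  have hFm : MemLp F 2 (volume.restrict Ω) := by
    have := (hu.memLp_linFlux u).sub (S.flux.memLp_linFlux u)
    refine this.congr_norm ?_ ?_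
    · refine this.1.congr (Eventually.of_forall fun x => ?_)
      simp [hF, linFlux, drift]
    · exact Eventually.of_forall fun x => by simp [hF, linFlux, drift]
  have hform : ∀ w, form α u u w - linForm l α p Set.univ u w =
      ∫ x in Ω, inner ℝ (F x) (grad w x) := by
    intro w
    rw [form_eq_linForm, linForm, linForm, setIntegral_univ, setIntegral_univ,
      ← integral_sub (hu.integrable_inner u w) (S.flux.integrable_inner u w)]
    refine integral_congr_ae (Eventually.of_forall fun x => ?_)
    simp [hF, linFlux, drift, inner_sub_left]
  rcases (semi_nonneg w).eq_or_lt with h0 | h0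
  -- A vanishing seminorm cannot be normalized, but by Friedrichs it forces `w = 0`.
  · rw [← h0, mul_zero]
    have hw := eq_zero_of_semi_eq_zero S.one_le S.isBounded h0.symm
    have e1 := (hu.bilin Set.univ u).map_zero
    have e2 := (S.flux.bilin Set.univ u).map_zero
    simp only [BoundedFlux.bilin_apply] at e1 e2
    rw [hw, form_eq_linForm, e1, e2]
    simp
  · have hs : semi ((semi w)⁻¹ • w) = 1 := by
      rw [semi_smul, abs_of_pos (inv_pos.2 h0), inv_mul_cancel₀ h0.ne']
    -- The real supremum bounds its elements only if the set is bounded above; here the `L²`-norm of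
    -- the flux difference is a bound.
    have hbdd : BddAbove {r : ℝ | ∃ w : H10 Ω, semi w = 1 ∧
        r = |∫ x in Ω, inner ℝ (F x) (grad w x)|} := by
      refine ⟨Real.sqrt (∫ x in Ω, ‖F x‖ ^ 2), ?_⟩
      rintro r ⟨w, hw, rfl⟩
      refine (abs_integral_inner_le hFm (Lp.memLp (grad w))).trans ?_
      rw [← norm_eq_sqrt_integral]
      change _ * semi w ≤ _
      rw [hw, mul_one]
    have h1 : |form α u u ((semi w)⁻¹ • w) - linForm l α p Set.univ u ((semi w)⁻¹ • w)| ≤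
        linError l α p u := by
      rw [hform]
      exact le_csSup hbdd ⟨_, hs, rfl⟩
    have e1 := (hu.bilin Set.univ u).map_smul (semi w)⁻¹ w
    have e2 := (S.flux.bilin Set.univ u).map_smul (semi w)⁻¹ w
    simp only [BoundedFlux.bilin_apply, smul_eq_mul] at e1 e2
    rw [form_eq_linForm, e1, e2, ← mul_sub, abs_mul, abs_of_pos (inv_pos.2 h0), inv_mul_le_iff₀ h0,
      ← form_eq_linForm] at h1
    linarith

theorem sum_mem_ker (hQ : IsCorrector l α p T I k Q) {v : H10 Ω} (hv : v ∈ T.feSpace) :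
    ∑ K ∈ T.cells, Q K v ∈ LinearMap.ker I :=
  Submodule.sum_mem _ fun K hK => (hQ K hK v hv).1.1

/-- The error of the corrected interpolant. -/
theorem semi_sub_correct_le {lam Lam0 : ℝ} (S : FineScale l α p T I M κ D CF μ Lam1 Cp)
    (hα : CoeffAssumption Ω lam Lam0 Lam1 α) (hQ : IsCorrector l α p T I k Q) {f : L2 Ω}
    {u : H10 Ω} (hu : IsWeakSolution α f u) :
    μ * semi (u - correct T Q (I u)) ≤
      κ * Real.sqrt M * T.size * ‖f‖ + linError l α p u +
      Real.sqrt (residualConst M κ D CF μ Lam1 Cp * (1 + CF ^ 2)) * M *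
        (Real.sqrt (T.overlap k) * Real.sqrt (decayRate M κ D μ Lam1 Cp) ^ (k / (M + 6))) *
          (κ * Real.sqrt M * semi u) := by
  have hIu := S.interp.mem u
  set w := u - correct T Q (I u) with hw
  have hwe : w = (u - I u) + ∑ K ∈ T.cells, Q K (I u) := by
    rw [hw, correct]
    abel
  have hwk : w ∈ LinearMap.ker I := by
    rw [hwe]
    exact Submodule.add_mem _ (S.interp.sub_mem_ker u) (sum_mem_ker hQ hIu)
  -- The form of `I u` over `Ω` is the sum of its parts over the elements, and each part is paired
  -- with the corrector that it generates.
  have hB : linForm l α p Set.univ w w = linForm l α p Set.univ u w +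
      ∑ K ∈ T.cells, (linForm l α p Set.univ (Q K (I u)) w - linForm l α p K.toSet (I u) w) := by
    have e1 := (S.flux.bilin Set.univ).map_add₂ (u - I u) (∑ K ∈ T.cells, Q K (I u)) w
    have e2 := (S.flux.bilin Set.univ).map_sub₂ u (I u) w
    have e3 := (S.flux.bilin Set.univ).map_sum₂ T.cells (fun K => Q K (I u)) w
    simp only [BoundedFlux.bilin_apply, ← hwe] at e1 e2 e3
    rw [e1, e2, e3, Finset.sum_sub_distrib, S.flux.sum_linForm S.isOpen]
    ring
  have h1 := S.abs_sum_residual_le (v := I u) (q := fun K => Q K (I u))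
    (fun K hK => (hQ K hK _ hIu).1) (fun K hK w hw => S.corrector_eq hQ hK hIu hw) hwk
  have h2 := S.abs_linearization_le hα u w
  have h3 := abs_load_le f w
  have h4 := S.interp.norm_val_le_of_mem_ker S.isOpen S.kappa_nonneg S.packed hwk
  have h5 := S.interp.semi_le S.isOpen S.kappa_nonneg S.packed u
  have h6 := S.coercive w hwk
  rw [hu w] at h2
  set A := Real.sqrt (residualConst M κ D CF μ Lam1 Cp * (1 + CF ^ 2)) * M *
        (Real.sqrt (T.overlap k) * Real.sqrt (decayRate M κ D μ Lam1 Cp) ^ (k / (M + 6))) with hA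
  have hA0 : 0 ≤ A := by positivity
  have hw0 := semi_nonneg w
  have h7 : ‖f‖ * ‖val w‖ ≤ ‖f‖ * (κ * Real.sqrt M * T.size * semi w) := by gcongr
  have h8 : A * semi (I u) * semi w ≤ A * (κ * Real.sqrt M * semi u) * semi w := by gcongr
  have h9 : μ * semi w ^ 2 ≤ (κ * Real.sqrt M * T.size * ‖f‖ + linError l α p u +
      A * (κ * Real.sqrt M * semi u)) * semi w := by
    have b1 := le_abs_self (∑ K ∈ T.cells,
      (linForm l α p Set.univ (Q K (I u)) w - linForm l α p K.toSet (I u) w))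
    have b2 := (abs_le.1 h2).1
    have b3 := le_abs_self (load f w)
    calc μ * semi w ^ 2 ≤ _ := h6
      _ = _ := hB
      _ ≤ ‖f‖ * (κ * Real.sqrt M * T.size * semi w) + linError l α p u * semi w +
          A * (κ * Real.sqrt M * semi u) * semi w := by linarith
      _ = _ := by ring
  have hη : 0 ≤ linError l α p u :=
    Real.sSup_nonneg (by rintro r ⟨w, -, rfl⟩; exact abs_nonneg _)
  have hRHS : 0 ≤ κ * Real.sqrt M * T.size * ‖f‖ + linError l α p u +
      A * (κ * Real.sqrt M * semi u) := by
    have := S.kappa_nonneg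
    have := T.size_nonneg
    have := semi_nonneg u
    positivity
  have h10 := le_div_of_mul_sq_le S.pos hw0 hRHS h9
  rwa [le_div_iff₀ S.pos, mul_comm] at h10

/-- The Galerkin error relative to an element of the multiscale space. -/
theorem semi_sub_galerkin_le {lam Lam0 : ℝ} (hlam : 0 < lam)
    (S : FineScale l α p T I M κ D CF μ Lam1 Cp) (hα : CoeffAssumption Ω lam Lam0 Lam1 α)
    (hQ : IsCorrector l α p T I k Q) {f : L2 Ω} {u y z : H10 Ω} (hu : IsWeakSolution α f u)
    (hy : IsGalerkinSolution α f T Q y) (hz : z ∈ msSpace T Q) :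
    lam * semi (z - y) ≤ mismatch α p u y z +
      fluxConst Lam1 0 * Real.sqrt (1 + CF ^ 2) * semi (u - z) := by
  have hp := hα.boundedFlux_kacanov S.isOpen p
  have hu' := hα.boundedFlux_kacanov S.isOpen u
  have hy' := hα.boundedFlux_kacanov S.isOpen y
  set e := z - y with he
  have hem : e ∈ msSpace T Q := S.msSpace_sub hQ hz hy.1
  set F : Pt d → Pt d := fun x => (α x (val p x) - α x (val u x)) (grad z x)
    + (α x (val y x) - α x (val p x)) (grad y x) with hF
  have hFe : ∀ x, F x = linFlux .kacanov α p z x - linFlux .kacanov α u z x +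
      (linFlux .kacanov α y y x - linFlux .kacanov α p y x) := fun x => by
    simp [hF, linFlux, drift]
  have hFm : MemLp F 2 (volume.restrict Ω) := by
    rw [show F = fun x => _ from funext hFe]
    exact ((hp.memLp_linFlux z).sub (hu'.memLp_linFlux z)).add
      ((hy'.memLp_linFlux y).sub (hp.memLp_linFlux y))
  have hint : ∫ x in Ω, inner ℝ (F x) (grad e x) =
      linForm .kacanov α p Set.univ z e - linForm .kacanov α u Set.univ z e +
        (linForm .kacanov α y Set.univ y e - linForm .kacanov α p Set.univ y e) := by
    have i1 : Integrable (fun x => inner ℝ (linFlux .kacanov α p z x) (grad e x) -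
        inner ℝ (linFlux .kacanov α u z x) (grad e x)) (volume.restrict Ω) :=
      (hp.integrable_inner z e).sub (hu'.integrable_inner z e)
    have i2 : Integrable (fun x => inner ℝ (linFlux .kacanov α y y x) (grad e x) -
        inner ℝ (linFlux .kacanov α p y x) (grad e x)) (volume.restrict Ω) :=
      (hy'.integrable_inner y e).sub (hp.integrable_inner y e)
    simp only [linForm, setIntegral_univ]
    rw [← integral_sub (hp.integrable_inner z e) (hu'.integrable_inner z e),
      ← integral_sub (hy'.integrable_inner y e) (hp.integrable_inner y e), ← integral_add i1 i2]
    refine integral_congr_ae (Eventually.of_forall fun x => ?_)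
    simp only [hFe, inner_add_left, inner_sub_left]
  have h1 := abs_integral_inner_le hFm (Lp.memLp (grad e))
  rw [← norm_eq_sqrt_integral] at h1
  change _ ≤ mismatch α p u y z * semi e at h1
  have h2 := sub_semi_mul_le_linForm S.isOpen hα hp le_rfl e
  rw [zero_mul, sub_zero] at h2
  have e1 := (hp.bilin Set.univ).map_sub₂ z y e
  have e2 := (hu'.bilin Set.univ).map_sub₂ u z e
  simp only [BoundedFlux.bilin_apply, ← he] at e1 e2
  have e3 := hu e
  have e4 := hy.2 e hem
  rw [form_eq_linForm] at e3 e4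
  have h3 := hu'.abs_linForm_univ_le_semi S.friedrichs (u - z) e
  -- The loads cancel: `A(u; u, e) = (f, e) = A(y; y, e)`. Thus `A(p; e, e)` is the integral of `F`
  -- against `∇e` minus `A(u; u - z, e)`.
  have h4 : lam * semi e ^ 2 ≤ (mismatch α p u y z +
      fluxConst Lam1 0 * Real.sqrt (1 + CF ^ 2) * semi (u - z)) * semi e := by
    have b1 := le_abs_self (∫ x in Ω, inner ℝ (F x) (grad e x))
    have b2 := (abs_le.1 h3).1
    calc lam * semi e ^ 2 ≤ _ := h2
      _ = (∫ x in Ω, inner ℝ (F x) (grad e x)) - linForm .kacanov α u Set.univ (u - z) e := by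
        rw [hint]; linarith
      _ ≤ _ := by linarith
  have h5 := le_div_of_mul_sq_le hlam (semi_nonneg e)
    (add_nonneg (Real.sqrt_nonneg _) (mul_nonneg (mul_nonneg (fluxConst_nonneg _ _)
      (Real.sqrt_nonneg _)) (semi_nonneg _))) h4
  rwa [le_div_iff₀ hlam, mul_comm] at h5

theorem semi_solution_le {lam Lam0 : ℝ} (hlam : 0 < lam)
    (S : FineScale l α p T I M κ D CF μ Lam1 Cp) (hα : CoeffAssumption Ω lam Lam0 Lam1 α)
    (hCF : 0 ≤ CF) {f : L2 Ω} {u : H10 Ω} (hu : IsWeakSolution α f u) :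
    semi u ≤ CF / lam * ‖f‖ := by
  have hu' := hα.boundedFlux_kacanov S.isOpen u
  have h1 := sub_semi_mul_le_linForm S.isOpen hα hu' le_rfl u
  rw [← form_eq_linForm, hu u, zero_mul, sub_zero] at h1
  have h2 := (le_abs_self _).trans (abs_load_le f u)
  have h3 : ‖f‖ * ‖val u‖ ≤ (‖f‖ * CF) * semi u := by
    rw [mul_assoc]
    exact mul_le_mul_of_nonneg_left (S.friedrichs u) (norm_nonneg _)
  have h4 := le_div_of_mul_sq_le hlam (semi_nonneg u) (by positivity) (h1.trans (h2.trans h3))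
  refine h4.trans (le_of_eq ?_)
  ring

end FineScale

/-! ### Constants of the error estimate -/

/-- Take `ν = ρ ^ (1 / s)`; rounding `k / s` down loses at most one factor `ρ`. Decay per block of
layers becomes decay per layer. -/
theorem exists_pow_div_le {ρ : ℝ} (h0 : 0 < ρ) (h1 : ρ < 1) {s : ℕ} (hs : 0 < s) :
    ∃ ν : ℝ, 0 < ν ∧ ν < 1 ∧ ∀ k : ℕ, ρ ^ (k / s) ≤ ρ⁻¹ * ν ^ k := by
  have hs' : (0 : ℝ) < (s : ℝ)⁻¹ := by positivity
  refine ⟨ρ ^ ((s : ℝ)⁻¹), Real.rpow_pos_of_pos h0 _, Real.rpow_lt_one h0.le h1 hs', fun k => ?_⟩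
  set ν := ρ ^ ((s : ℝ)⁻¹) with hν
  have hν0 : 0 < ν := Real.rpow_pos_of_pos h0 _
  have hν1 : ν < 1 := Real.rpow_lt_one h0.le h1 hs'
  have hνs : ν ^ s = ρ := by
    rw [hν, ← Real.rpow_natCast, ← Real.rpow_mul h0.le, inv_mul_cancel₀ (by positivity),
      Real.rpow_one]
  have h2 : ρ ^ (k / s) * ρ ≤ ν ^ k := by
    rw [← pow_succ, ← hνs, ← pow_mul]
    exact pow_le_pow_of_le_one hν0.le hν1.le
      (by rw [mul_comm]; exact (Nat.lt_div_mul_add hs |>.le.trans (by rw [Nat.succ_mul])))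
  rw [inv_mul_eq_div, le_div_iff₀ h0]
  exact h2

/-- The error estimate, with constants that depend on the data of the fine-scale problem only. -/
theorem exists_error_estimate {lam Lam0 Lam1 Cp κ D CF μ : ℝ} {M : ℕ} (hlam : 0 < lam)
    (hCF : 0 ≤ CF) (hκ : 0 ≤ κ) (hμ : 0 < μ) :
    ∃ C ν : ℝ, 0 < C ∧ 0 < ν ∧ ν < 1 ∧
      ∀ (l : Linearization) (α : Coeff d) (f : L2 Ω) (T : Mesh Ω) (I : H10 Ω →ₗ[ℝ] H10 Ω)
        (p : H10 Ω) (k : ℕ) (Q : Cell d → H10 Ω → H10 Ω) (u y : H10 Ω),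
        FineScale l α p T I M κ D CF μ Lam1 Cp → CoeffAssumption Ω lam Lam0 Lam1 α →
        IsCorrector l α p T I k Q → IsWeakSolution α f u → IsGalerkinSolution α f T Q y →
        semi (u - y) ≤ C * errorBound l α f p T I k Q ν u y := by
  set ρ := Real.sqrt (decayRate M κ D μ Lam1 Cp) with hρ
  have hρ0 : 0 < ρ := Real.sqrt_pos.2 (decayRate_pos _ _ _ _ _ _)
  have hρ1 : ρ < 1 := by
    rw [hρ, Real.sqrt_lt' one_pos, one_pow]
    exact decayRate_lt_one _ _ _ _ _ _
  obtain ⟨ν, hν0, hν1, hν⟩ := exists_pow_div_le hρ0 hρ1 (s := M + 6) (by omega)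
  set a := κ * Real.sqrt M with ha
  set b := Real.sqrt (FineScale.residualConst M κ D CF μ Lam1 Cp * (1 + CF ^ 2)) * M with hb
  set c := fluxConst Lam1 0 * Real.sqrt (1 + CF ^ 2) with hc
  have ha0 : 0 ≤ a := by positivity
  have hb0 : 0 ≤ b := by positivity
  have hc0 : 0 ≤ c := mul_nonneg (fluxConst_nonneg _ _) (Real.sqrt_nonneg _)
  set A := a + 1 + b * ρ⁻¹ * (a * (CF / lam)) with hA
  have hA0 : 0 < A := by positivity
  -- `A / μ` bounds `u - z`, this error enters `z - y` once more with factor `c / lam`, and the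
  -- mismatch enters with `1 / lam`.
  refine ⟨(1 + c / lam) * (A / μ) + 1 / lam, ν, by positivity, hν0, hν1, ?_⟩
  intro l α f T I p k Q u y S hα hQ hu hy
  set z := correct T Q (I u) with hz
  have hzm : z ∈ msSpace T Q := ⟨I u, S.interp.mem u, rfl⟩
  have h1 := S.semi_sub_correct_le hα hQ hu
  have h2 := S.semi_sub_galerkin_le hlam hα hQ hu hy hzm
  have h3 := S.semi_solution_le hlam hα hCF hu
  rw [← hz, ← ha, ← hb, ← hρ] at h1
  rw [← hc] at h2
  have hη : 0 ≤ linError l α p u :=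
    Real.sSup_nonneg (by rintro r ⟨w, -, rfl⟩; exact abs_nonneg _)
  have hG : 0 ≤ mismatch α p u y z := Real.sqrt_nonneg _
  have hH := T.size_nonneg
  have hf := norm_nonneg f
  set o := Real.sqrt (T.overlap k) with ho
  have ho0 : 0 ≤ o := Real.sqrt_nonneg _
  have hE : errorBound l α f p T I k Q ν u y =
      (T.size + o * ν ^ k) * ‖f‖ + linError l α p u + mismatch α p u y z := rfl
  set X := (T.size + o * ν ^ k) * ‖f‖ + linError l α p u with hX
  have hX0 : 0 ≤ X := by positivity
  have h4 : b * (o * ρ ^ (k / (M + 6))) * (a * semi u) ≤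
      b * ρ⁻¹ * (a * (CF / lam)) * (o * ν ^ k * ‖f‖) := by
    calc b * (o * ρ ^ (k / (M + 6))) * (a * semi u)
        ≤ b * (o * (ρ⁻¹ * ν ^ k)) * (a * (CF / lam * ‖f‖)) := by
          gcongr
          · exact mul_nonneg ha0 (semi_nonneg u)
          · exact hν k
      _ = _ := by ring
  have h5 : μ * semi (u - z) ≤ A * X := by
    have t1 : 0 ≤ T.size * ‖f‖ := by positivity
    have t2 : 0 ≤ o * ν ^ k * ‖f‖ := by positivity
    have t3 : 0 ≤ b * ρ⁻¹ * (a * (CF / lam)) := by positivity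
    set B := b * ρ⁻¹ * (a * (CF / lam)) with hB
    set x1 := T.size * ‖f‖ with hx1
    set x2 := o * ν ^ k * ‖f‖ with hx2
    have hXe : X = x1 + x2 + linError l α p u := by rw [hX, hx1, hx2]; ring
    have h6 : a * T.size * ‖f‖ = a * x1 := by rw [hx1]; ring
    rw [h6] at h1
    rw [hXe, hA]
    have p1 := mul_nonneg ha0 t2
    have p2 := mul_nonneg ha0 hη
    have p3 := mul_nonneg t3 t1
    have p4 := mul_nonneg t3 hη
    linarith
  have h6 : semi (u - z) ≤ A / μ * X := by
    rw [div_mul_eq_mul_div, le_div_iff₀ hμ]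
    linarith
  have h7 : semi (z - y) ≤ (mismatch α p u y z + c * semi (u - z)) / lam := by
    rw [le_div_iff₀ hlam]
    linarith
  have h8 : semi (u - y) ≤ semi (u - z) + semi (z - y) := by
    have := semi_add_le (u - z) (z - y)
    rwa [sub_add_sub_cancel] at this
  rw [hE]
  have hG' : 0 ≤ (1 + c / lam) * (A / μ) * mismatch α p u y z := by positivity
  have hX' : 0 ≤ 1 / lam * X := by positivity
  calc semi (u - y) ≤ semi (u - z) + (mismatch α p u y z + c * semi (u - z)) / lam := by linarith
    _ = (1 + c / lam) * semi (u - z) + 1 / lam * mismatch α p u y z := by ring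
    _ ≤ (1 + c / lam) * (A / μ * X) + 1 / lam * mismatch α p u y z := by gcongr
    _ ≤ ((1 + c / lam) * (A / μ) + 1 / lam) * (X + mismatch α p u y z) := by linarith

end

end LOD

/-! ### Coercivity on the fine scale for the two linearizations -/

theorem mainTheorem1 {d : ℕ} (hd : 1 ≤ d) (hd3 : d ≤ 3) (Ω : Set (Pt d)) (hΩ : IsOpen Ω)
    (hΩb : Bornology.IsBounded Ω) (lam Lam0 Lam1 γ κ : ℝ) (hlam : 0 < lam) (hLam0 : 0 < Lam0)
    (hLam1 : 0 < Lam1) (hγ : 0 < γ) (hκ : 0 < κ) :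
    (∃ C ν : ℝ, 0 < C ∧ 0 < ν ∧ ν < 1 ∧
      ∀ (α : Coeff d) (f : L2 Ω) (T : Mesh Ω) (I : H10 Ω →ₗ[ℝ] H10 Ω) (p : H10 Ω) (k : ℕ)
        (Q : Cell d → H10 Ω → H10 Ω) (u y : H10 Ω),
        CoeffAssumption Ω lam Lam0 Lam1 α → T.Regular γ → IsInterpolation T κ I →
        IsCorrector .kacanov α p T I k Q →
        IsWeakSolution α f u → IsGalerkinSolution α f T Q y →
        semi (u - y) ≤ C * errorBound .kacanov α f p T I k Q ν u y) ∧
    (∀ Cp θ : ℝ, 0 ≤ Cp → 0 < θ → θ < 1 → ∃ C ν : ℝ, 0 < C ∧ 0 < ν ∧ ν < 1 ∧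
      ∀ (α : Coeff d) (f : L2 Ω) (T : Mesh Ω) (I : H10 Ω →ₗ[ℝ] H10 Ω) (p : H10 Ω) (k : ℕ)
        (Q : Cell d → H10 Ω → H10 Ω) (u y : H10 Ω) (CI : ℝ),
        CoeffAssumption Ω lam Lam0 Lam1 α → TwiceDifferentiable Ω α →
        T.Regular γ → IsInterpolation T κ I →
        (∀ᵐ x ∂(volume.restrict Ω), ‖deriv (α x) (val p x) (grad p x)‖ ≤ Cp) →
        (∀ v : H10 Ω, ‖val (v - I v)‖ ≤ CI * T.size * semi v) →
        CI * Cp * T.size ≤ θ * lam →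
        IsCorrector .frechet α p T I k Q →
        IsWeakSolution α f u → IsGalerkinSolution α f T Q y →
        semi (u - y) ≤ C * errorBound .frechet α f p T I k Q ν u y) := by
  obtain ⟨R, hR⟩ := hΩb.exists_norm_le
  obtain ⟨M, hM⟩ := Mesh.exists_isPacked d hγ
  -- The absolute value keeps the constant nonnegative if `Ω` is empty and `R` is negative.
  have hF : ∀ v : H10 Ω, ‖val v‖ ≤ 2 * |R| * semi v :=
    friedrichs hd fun x hx => (hR x hx).trans (le_abs_self R)
  refine ⟨?_, fun Cp θ hCp hθ hθ1 => ?_⟩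
  · obtain ⟨C, ν, hC, hν, hν1, h⟩ := exists_error_estimate (Ω := Ω) (lam := lam) (Lam0 := Lam0)
      (Lam1 := Lam1) (Cp := 0) (κ := κ) (D := Metric.diam (closure Ω)) (CF := 2 * |R|) (μ := lam)
      (M := M) hlam (by positivity) hκ.le hlam
    refine ⟨C, ν, hC, hν, hν1, fun α f T I p k Q u y hα hT hI hQ hu hy =>
      h .kacanov α f T I p k Q u y ?_ hα hQ hu hy⟩
    have hflux := hα.boundedFlux_kacanov hΩ p
    exact
      { isOpen := hΩ, isBounded := hΩb, one_le := hd, regular := ⟨γ, hT⟩, packed := hM Ω T hT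
        size_le := T.size_le hΩb, kappa_nonneg := hκ.le, interp := hI, flux := hflux
        friedrichs := hF, pos := hlam
        coercive := fun w _ => by
          simpa using sub_semi_mul_le_linForm hΩ hα hflux le_rfl w }
  -- On `W` the drift consumes at most the fraction `θ` of the ellipticity, because `‖w‖₀ = ‖w - I
  -- w‖₀ ≤ C_I H |w|₁` there.
  · have hμ : 0 < (1 - θ) * lam := mul_pos (by linarith) hlam
    obtain ⟨C, ν, hC, hν, hν1, h⟩ := exists_error_estimate (Ω := Ω) (lam := lam) (Lam0 := Lam0)
      (Lam1 := Lam1) (Cp := Cp) (κ := κ) (D := Metric.diam (closure Ω)) (CF := 2 * |R|)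
      (μ := (1 - θ) * lam) (M := M) hlam (by positivity) hκ.le hμ
    refine ⟨C, ν, hC, hν, hν1, fun α f T I p k Q u y CI hα hα2 hT hI hp hCI hθC hQ hu hy =>
      h .frechet α f T I p k Q u y ?_ hα hQ hu hy⟩
    have hflux := hα.boundedFlux_frechet hΩ hα2 p hp
    exact
      { isOpen := hΩ, isBounded := hΩb, one_le := hd, regular := ⟨γ, hT⟩, packed := hM Ω T hT
        size_le := T.size_le hΩb, kappa_nonneg := hκ.le, interp := hI, flux := hflux
        friedrichs := hF, pos := hμ
        coercive := fun w hw => by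
          have h1 := sub_semi_mul_le_linForm hΩ hα hflux hCp w
          have h2 := hCI w
          rw [LinearMap.mem_ker.1 hw, sub_zero] at h2
          have h3 : Cp * (‖val w‖ * semi w) ≤ θ * lam * semi w ^ 2 := by
            have hw0 := semi_nonneg w
            calc Cp * (‖val w‖ * semi w) ≤ Cp * (CI * T.size * semi w * semi w) := by gcongr
              _ = CI * Cp * T.size * semi w ^ 2 := by ring
              _ ≤ θ * lam * semi w ^ 2 := by gcongr
          linarith }
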